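/- \textbf{Setting.} An instance of \textsc{Non-Uniform CKM} (capacitated $k$-median) consists of disjoint finite sets $F$ of facilities and $C$ of clients, a capacity $u_f\in\mathbb{Z}_{\ge 0}$ for every $f\in F$, a bound $k\in\mathbb{Z}_{\ge 0}$, and a metric $d$ (distance $0$ between distinct points is allowed). A feasible solution is a set $O\subseteq F$ with $|O|\le k$ together with a map $\phi:C\to O$ such that $|\phi^{-1}(f)|\le u_f$ for all $f\in O$; its cost is $\sum_{c\in C}d(c,\phi(c))$, which is to be minimized. The instance is \emph{$\ell$-centered} if it comes with a further finite set $S$ of centers, disjoint from $F\cup C$, with $|S|\le\ell$, and $d$ is the shortest-path metric on $F\cup C\cup S$ of a graph with nonnegative edge lengths in which $S$ is a clique and every $v\in F\cup C$ has exactly one incident edge, which connects $v$ to some center in $S$. The input consists of $F$, $C$, $S$, $k$, the capacities, the matrix of the metric $d$ on $F\cup C\cup S$, and the accuracy $\varepsilon$. Put $n=|F|+|C|$. Time is the number of elementary steps on a unit-cost real RAM (addition, truncated subtraction and comparison of natural numbers, field operations and comparison of real numbers, indirect addressing by natural numbers). \textbf{Lemma.} There are one algorithm and absolute constants $A,c$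 such that, for all $\ell$, all $\ell$-centered instances of \textsc{Non-Uniform CKM} with $n\ge 2$, and all real $\varepsilon$ with $0<\varepsilon\le 1$, the algorithm halts after at most \[ \Bigl(A\cdot \ell\cdot\frac1\varepsilon\cdot\ln\frac n\varepsilon\Bigr)^{k}\cdot n^{c} \] steps and returns a feasible solution whose cost is at most $(1+\varepsilon)$ times the minimum cost of a feasible solution; if there is no feasible solution, it reports this. That is, \textsc{Non-Uniform CKM} can be solved on $\ell$-centered instances with approximation ratio $1+\varepsilon$ in time $\bigl(O(\ell\cdot\frac1\varepsilon\ln\frac n\varepsilon)\bigr)^{k}\cdot n^{O(1)}$. -/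

import Mathlib

/-! ## The machine model: a real RAM with unit cost

Memory consists of arrays of natural numbers and arrays of real numbers. A program names its arrays
by numerals, so it uses finitely many of them; cells are addressed indirectly, by computed natural
numbers. Natural numbers admit addition, truncated subtraction and comparison; real numbers admit
the four field operations and comparison. There is no rounding and no conversion from real to
natural numbers, and the only constants are natural numerals. -/

namespace RealRAM

/-- Expressions for natural numbers; `read a i` is cell `i` of the array of naturals named `a`. -/
inductive NExp : Type where
  | lit (m : ℕ)
  | read (a : ℕ) (i : NExp)
  | add (x y : NExp)
  | sub (x y : NExp)

/-- Expressions for real numbers; `read a i` is cell `i` of the array of reals named `a`. -/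
inductive RExp : Type where
  | lit (m : ℕ)
  | read (a : ℕ) (i : NExp)
  | add (x y : RExp)
  | sub (x y : RExp)
  | mul (x y : RExp)
  | div (x y : RExp)

/-- Tests. -/
inductive Test : Type where
  | natLE (x y : NExp)
  | realLE (x y : RExp)
  | not (b : Test)
  | and (b b' : Test)

/-- Programs. `setNat a i e` stores the value of `e` in cell `i` of the array of naturals `a`,
and `setReal a i e` does the same with an array of reals. -/
inductive Prog : Type where
  | skip
  | setNat (a : ℕ) (i e : NExp)
  | setReal (a : ℕ) (i : NExp) (e : RExp)
  | seq (P Q : Prog)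
  | ite (b : Test) (P Q : Prog)
  | loop (b : Test) (P : Prog)

/-- The contents of the memory: `s.nat a i` and `s.real a i` are the cells with index `i` of the
array of naturals and of the array of reals with name `a`. -/
structure State : Type where
  nat : ℕ → ℕ → ℕ
  real : ℕ → ℕ → ℝ

/-- Value of an expression. -/
def NExp.eval (s : State) : NExp → ℕ
  | .lit m => m
  | .read a i => s.nat a (i.eval s)
  | .add x y => x.eval s + y.eval s
  | .sub x y => x.eval s - y.eval s

/-- Value of an expression (division by zero yields zero). -/
noncomputable def RExp.eval (s : State) : RExp → ℝ
  | .lit m => (m : ℝ)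
  | .read a i => s.real a (i.eval s)
  | .add x y => x.eval s + y.eval s
  | .sub x y => x.eval s - y.eval s
  | .mul x y => x.eval s * y.eval s
  | .div x y => x.eval s / y.eval s

/-- Truth of a test. -/
def Test.Holds (s : State) : Test → Prop
  | .natLE x y => x.eval s ≤ y.eval s
  | .realLE x y => x.eval s ≤ y.eval s
  | .not b => ¬ b.Holds s
  | .and b b' => b.Holds s ∧ b'.Holds s

/-- Number of elementary operations in the evaluation of an expression. -/
def NExp.cost : NExp → ℕ
  | .lit _ => 1
  | .read _ i => i.cost + 1
  | .add x y => x.cost + y.cost + 1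
  | .sub x y => x.cost + y.cost + 1

/-- Number of elementary operations in the evaluation of an expression. -/
def RExp.cost : RExp → ℕ
  | .lit _ => 1
  | .read _ i => i.cost + 1
  | .add x y => x.cost + y.cost + 1
  | .sub x y => x.cost + y.cost + 1
  | .mul x y => x.cost + y.cost + 1
  | .div x y => x.cost + y.cost + 1

/-- Number of elementary operations in the evaluation of a test. -/
def Test.cost : Test → ℕ
  | .natLE x y => x.cost + y.cost + 1
  | .realLE x y => x.cost + y.cost + 1
  | .not b => b.cost + 1
  | .and b b' => b.cost + b'.cost + 1

/-- Store `v` in cell `i` of the array of naturals `a`. -/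
def State.putNat (s : State) (a i v : ℕ) : State :=
  { s with nat := Function.update s.nat a (Function.update (s.nat a) i v) }

/-- Store `v` in cell `i` of the array of reals `a`. -/
noncomputable def State.putReal (s : State) (a i : ℕ) (v : ℝ) : State :=
  { s with real := Function.update s.real a (Function.update (s.real a) i v) }

/-- `Exec P s s' t`: started in the memory `s`, the program `P` halts in the memory `s'` after
exactly `t` elementary steps. -/
inductive Exec : Prog → State → State → ℕ → Prop where
  | skip (s : State) : Exec .skip s s 1
  | setNat (s : State) (a : ℕ) (i e : NExp) :
      Exec (.setNat a i e) s (s.putNat a (i.eval s) (e.eval s)) (i.cost + e.cost + 1)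
  | setReal (s : State) (a : ℕ) (i : NExp) (e : RExp) :
      Exec (.setReal a i e) s (s.putReal a (i.eval s) (e.eval s)) (i.cost + e.cost + 1)
  | seq {P Q : Prog} {s s₁ s₂ : State} {t₁ t₂ : ℕ} :
      Exec P s s₁ t₁ → Exec Q s₁ s₂ t₂ → Exec (.seq P Q) s s₂ (t₁ + t₂)
  | iteTrue {b : Test} {P Q : Prog} {s s' : State} {t : ℕ} :
      b.Holds s → Exec P s s' t → Exec (.ite b P Q) s s' (b.cost + t)
  | iteFalse {b : Test} {P Q : Prog} {s s' : State} {t : ℕ} :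
      ¬ b.Holds s → Exec Q s s' t → Exec (.ite b P Q) s s' (b.cost + t)
  | loopDone {b : Test} {P : Prog} {s : State} :
      ¬ b.Holds s → Exec (.loop b P) s s b.cost
  | loopStep {b : Test} {P : Prog} {s s₁ s₂ : State} {t₁ t₂ : ℕ} :
      b.Holds s → Exec P s s₁ t₁ → Exec (.loop b P) s₁ s₂ t₂ →
      Exec (.loop b P) s s₂ (b.cost + t₁ + t₂)

end RealRAM

/-! ## Capacitated k-median -/

/-- The data of an instance of (non-uniform) capacitated `k`-median that comes with a set of
centers: facilities `Fin nF`, clients `Fin nC`, centers `Fin nS`, the bound `k` on the number of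
open facilities, the capacities `u`, and the distances between all nodes. -/
structure CKM : Type where
  nF : ℕ
  nC : ℕ
  nS : ℕ
  k : ℕ
  u : Fin nF → ℕ
  d : Fin nF ⊕ Fin nC ⊕ Fin nS → Fin nF ⊕ Fin nC ⊕ Fin nS → ℝ

namespace CKM

/-- The nodes: facilities, clients and centers. -/
abbrev Node (I : CKM) : Type := Fin I.nF ⊕ Fin I.nC ⊕ Fin I.nS

/-- The node of a facility. -/
abbrev facility (I : CKM) (f : Fin I.nF) : I.Node := Sum.inl f

/-- The node of a client. -/
abbrev client (I : CKM) (c : Fin I.nC) : I.Node := Sum.inr (Sum.inl c)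

/-- The node of a center. -/
abbrev center (I : CKM) (s : Fin I.nS) : I.Node := Sum.inr (Sum.inr s)

/-- The size `n` of an instance: the number of facilities and clients. -/
def size (I : CKM) : ℕ := I.nF + I.nC

/-- `d` is the metric induced by the graph `G` with edge lengths `w`: the distance of two nodes is
the least length of a walk between them. -/
def InducedBy {V : Type} (d : V → V → ℝ) (G : SimpleGraph V) (w : Sym2 V → ℝ) : Prop :=
  ∀ x y : V, IsLeast {r : ℝ | ∃ p : G.Walk x y, r = (p.edges.map w).sum} (d x y)

/-- The instance is `ℓ`-centered: there are at most `ℓ` centers, and the distances are induced by a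
graph with nonnegative edge lengths in which the centers form a clique and every facility and every
client has exactly one incident edge, which leads to a center. -/
def IsCentered (I : CKM) (ℓ : ℕ) : Prop :=
  I.nS ≤ ℓ ∧
  ∃ (G : SimpleGraph I.Node) (w : Sym2 I.Node → ℝ),
    (∀ e ∈ G.edgeSet, 0 ≤ w e) ∧
    (∀ s s' : Fin I.nS, s ≠ s' → G.Adj (I.center s) (I.center s')) ∧
    (∀ f : Fin I.nF, ∃ s : Fin I.nS, G.neighborSet (I.facility f) = {I.center s}) ∧
    (∀ c : Fin I.nC, ∃ s : Fin I.nS, G.neighborSet (I.client c) = {I.center s}) ∧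
    InducedBy I.d G w

/-- A candidate solution: the set of open facilities and the assignment of the clients. -/
structure Sol (I : CKM) : Type where
  opened : Finset (Fin I.nF)
  assign : Fin I.nC → Fin I.nF

/-- At most `k` facilities are open, every client is assigned to an open facility, and no open
facility serves more clients than its capacity allows. -/
def Sol.IsFeasible {I : CKM} (T : I.Sol) : Prop :=
  T.opened.card ≤ I.k ∧
  (∀ c, T.assign c ∈ T.opened) ∧
  ∀ f ∈ T.opened, (Finset.univ.filter fun c => T.assign c = f).card ≤ I.u f

/-- The connection cost. -/
def Sol.cost {I : CKM} (T : I.Sol) : ℝ :=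
  ∑ c, I.d (I.client c) (I.facility (T.assign c))

/-- The number of nodes. -/
def numNodes (I : CKM) : ℕ := I.nF + (I.nC + I.nS)

/-- The nodes in the order facilities, clients, centers. -/
def node (I : CKM) (i : Fin I.numNodes) : I.Node :=
  Sum.map id finSumFinEquiv.symm (finSumFinEquiv.symm i)

/-- The memory at the start of a computation on the instance `I` and the accuracy `ε`. Array `0` of
naturals holds the three numbers of nodes and `k`, array `1` of naturals the capacities; array `0`
of reals holds `ε`, array `1` of reals the distance matrix, row by row. All other cells are `0`. -/
noncomputable def input (I : CKM) (ε : ℝ) : RealRAM.State where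
  nat a i :=
    if a = 0 then
      if i = 0 then I.nF else if i = 1 then I.nC else if i = 2 then I.nS
      else if i = 3 then I.k else 0
    else if a = 1 then
      if h : i < I.nF then I.u ⟨i, h⟩ else 0
    else 0
  real a i :=
    if a = 0 then
      if i = 0 then ε else 0
    else if a = 1 then
      if h : i < I.numNodes * I.numNodes then
        I.d (I.node (finProdFinEquiv.symm ⟨i, h⟩).1) (I.node (finProdFinEquiv.symm ⟨i, h⟩).2)
      else 0
    else 0

/-- The memory `s` presents the solution `T` as output: cell `0` of array `2` of naturals is the
flag `1`, array `3` is the indicator of the open facilities, and array `4` is the assignment. -/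
def Presents {I : CKM} (s : RealRAM.State) (T : I.Sol) : Prop :=
  s.nat 2 0 = 1 ∧
  (∀ f : Fin I.nF, f ∈ T.opened ↔ s.nat 3 f = 1) ∧
  ∀ c : Fin I.nC, s.nat 4 c = T.assign c

/-- The memory `s` reports that there is no feasible solution. -/
def ReportsInfeasible (s : RealRAM.State) : Prop := s.nat 2 0 = 0

/-- The output in the memory `s` is correct with approximation ratio `ρ`: a feasible solution whose
cost is at most `ρ` times that of every feasible solution, or, if there is no feasible solution,
a report of this. -/
def IsApproxOutput (I : CKM) (ρ : ℝ) (s : RealRAM.State) : Prop :=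
  (∃ T : I.Sol, Presents s T ∧ T.IsFeasible ∧
    ∀ T' : I.Sol, T'.IsFeasible → T.cost ≤ ρ * T'.cost) ∨
  ((¬ ∃ T : I.Sol, T.IsFeasible) ∧ ReportsInfeasible s)

end CKM

/-! Let δ(f) be the distance from a facility f to a nearest center σ(f). The only edge at f leads to
a center, so a facility g with σ(g) = σ(f) can take over any client of f at an extra cost of at most
δ(g) - δ(f) (`IsCentered.dist_le_of_nearest_eq`). Apart from its capacity, a facility thus matters
only through σ and δ, and δ may be rounded.

Guess the facility e of largest δ among those used by an optimal solution, put D = δ(e), disregard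
all facilities with δ > D, and round δ up to (ε/2)·D/n times a power of 1 + ε/2. Then
O((1/ε)·ln(n/ε)) exponents suffice (`exists_class_bound`). Center and exponent form the label of a
facility. Guess the labels of the optimal facilities, and for each label in turn open an unopened
facility of that label with largest capacity. By `exists_greedy_dominating`, the optimal facilities
can be exchanged injectively for opened ones with the same labels and no smaller capacities. Each
client then pays at most 1 + ε/2 times its old cost plus (ε/2)·D/n. The additive terms sum to at
most (ε/2)·D, and D is at most the optimal cost since some client is served by e
(`Problem.Nearest.exists_greedy`).

For a fixed set of open facilities the best assignment is a transportation problem. The Hungarian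
method solves it exactly: prices on facilities and values of clients certify optimality
(`Dual.optimal`), and each phase grows a tree of tight edges until it meets an unsaturated facility
(`growTree_runs`, `hungarian_runs`).

Correctness and time are proved together by means of `Runs`, a total correctness statement with a
time bound; `Exec.frame` reads off from the text of a program what it leaves unchanged. The number
of label sequences is the only factor not polynomial in n: for k ≥ 1 it also absorbs the time for
scanning centers and computing exponents, and k = 0 is settled in constant time. -/

namespace RealRAM

/-! ### Frame conditions -/

/-- `P` writes into the array of naturals `a`. -/
def Prog.writesNat : Prog → ℕ → Bool
  | .skip, _ => false
  | .setNat b _ _, a => a == b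
  | .setReal _ _ _, _ => false
  | .seq P Q, a => P.writesNat a || Q.writesNat a
  | .ite _ P Q, a => P.writesNat a || Q.writesNat a
  | .loop _ P, a => P.writesNat a

/-- `P` writes into the array of reals `a`. -/
def Prog.writesReal : Prog → ℕ → Bool
  | .skip, _ => false
  | .setNat _ _ _, _ => false
  | .setReal b _ _, a => a == b
  | .seq P Q, a => P.writesReal a || Q.writesReal a
  | .ite _ P Q, a => P.writesReal a || Q.writesReal a
  | .loop _ P, a => P.writesReal a

/-- `s'` differs from `s` at most in arrays into which `P` writes. -/
structure Frame (P : Prog) (s s' : State) : Prop where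
  nat : ∀ a, P.writesNat a = false → s'.nat a = s.nat a
  real : ∀ a, P.writesReal a = false → s'.real a = s.real a

section State

variable (s : State) (a b i v : ℕ) (r : ℝ)

@[simp] theorem State.putNat_nat_self :
    (s.putNat a i v).nat a = Function.update (s.nat a) i v := by simp [State.putNat]

@[simp] theorem State.putNat_nat_ne (h : b ≠ a) : (s.putNat a i v).nat b = s.nat b := by
  simp [State.putNat, h]

@[simp] theorem State.putNat_real : (s.putNat a i v).real = s.real := rfl

@[simp] theorem State.putReal_real_self :
    (s.putReal a i r).real a = Function.update (s.real a) i r := by simp [State.putReal]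

@[simp] theorem State.putReal_real_ne (h : b ≠ a) : (s.putReal a i r).real b = s.real b := by
  simp [State.putReal, h]

@[simp] theorem State.putReal_nat : (s.putReal a i r).nat = s.nat := rfl

end State

theorem Frame.refl (P : Prog) (s : State) : Frame P s s := ⟨fun _ _ => rfl, fun _ _ => rfl⟩

theorem Frame.trans {P : Prog} {s s₁ s₂ : State} (h : Frame P s s₁) (h' : Frame P s₁ s₂) :
    Frame P s s₂ :=
  ⟨fun a ha => (h'.nat a ha).trans (h.nat a ha), fun a ha => (h'.real a ha).trans (h.real a ha)⟩

/-- The arrays written are computed from the program text, so for a concrete program and array the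
side condition holds by `rfl`. Nearly all transport of facts between memories below uses this. -/
theorem Exec.frame {P : Prog} {s s' : State} {t : ℕ} (h : Exec P s s' t) : Frame P s s' := by
  induction h with
  | skip s => exact Frame.refl _ _
  | setNat s a i e =>
    refine ⟨fun b hb => ?_, fun _ _ => rfl⟩
    simp only [Prog.writesNat, beq_eq_false_iff_ne] at hb
    simp [hb]
  | setReal s a i e =>
    refine ⟨fun _ _ => rfl, fun b hb => ?_⟩
    simp only [Prog.writesReal, beq_eq_false_iff_ne] at hb
    simp [hb]
  | seq _ _ h₁ h₂ =>
    refine ⟨fun a ha => ?_, fun a ha => ?_⟩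
    · simp only [Prog.writesNat, Bool.or_eq_false_iff] at ha
      rw [h₂.nat a ha.2, h₁.nat a ha.1]
    · simp only [Prog.writesReal, Bool.or_eq_false_iff] at ha
      rw [h₂.real a ha.2, h₁.real a ha.1]
  | iteTrue _ _ h =>
    refine ⟨fun a ha => ?_, fun a ha => ?_⟩
    · simp only [Prog.writesNat, Bool.or_eq_false_iff] at ha
      exact h.nat a ha.1
    · simp only [Prog.writesReal, Bool.or_eq_false_iff] at ha
      exact h.real a ha.1
  | iteFalse _ _ h =>
    refine ⟨fun a ha => ?_, fun a ha => ?_⟩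
    · simp only [Prog.writesNat, Bool.or_eq_false_iff] at ha
      exact h.nat a ha.2
    · simp only [Prog.writesReal, Bool.or_eq_false_iff] at ha
      exact h.real a ha.2
  | loopDone _ => exact Frame.refl _ _
  | loopStep _ _ _ h₁ h₂ =>
    refine ⟨fun a ha => ?_, fun a ha => ?_⟩
    · rw [h₂.nat a ha, h₁.nat a ha]
    · rw [h₂.real a ha, h₁.real a ha]

/-! ### Total correctness with time bounds -/

/-- Started in the memory `s`, the program `P` halts after at most `T` steps in a memory
with the property `Q`. -/
def Runs (P : Prog) (s : State) (Q : State → Prop) (T : ℕ) : Prop :=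
  ∃ s' t, Exec P s s' t ∧ t ≤ T ∧ Q s'

/-- The rule of consequence supplies the frame condition for free, so postconditions and invariants
need not list what stays unchanged. -/
theorem Runs.mono {P : Prog} {s : State} {Q R : State → Prop} {T T' : ℕ} (h : Runs P s Q T)
    (hQ : ∀ s', Q s' → Frame P s s' → R s') (hT : T ≤ T') : Runs P s R T' := by
  obtain ⟨s', t, he, ht, hq⟩ := h
  exact ⟨s', t, he, ht.trans hT, hQ s' hq he.frame⟩

theorem Runs.seq {P P' : Prog} {s : State} {Q R : State → Prop} {T₁ T₂ T : ℕ}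
    (h : Runs P s Q T₁) (h' : ∀ s', Q s' → Frame P s s' → Runs P' s' R T₂)
    (hT : T₁ + T₂ ≤ T) : Runs (P.seq P') s R T := by
  obtain ⟨s₁, t₁, he, ht, hq⟩ := h
  obtain ⟨s₂, t₂, he', ht', hq'⟩ := h' s₁ hq he.frame
  exact ⟨s₂, _, he.seq he', by omega, hq'⟩

theorem Runs.ite {b : Test} {P P' : Prog} {s : State} {R : State → Prop} {T' T : ℕ}
    (h : b.Holds s → Runs P s R T') (h' : ¬ b.Holds s → Runs P' s R T')
    (hT : b.cost + T' ≤ T) : Runs (.ite b P P') s R T := by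
  by_cases hb : b.Holds s
  · obtain ⟨s', t, he, ht, hq⟩ := h hb
    exact ⟨s', _, .iteTrue hb he, by omega, hq⟩
  · obtain ⟨s', t, he, ht, hq⟩ := h' hb
    exact ⟨s', _, .iteFalse hb he, by omega, hq⟩

/-- The index counts completed rounds and need not be stored in the memory. Termination comes from
`hstep`: the test cannot hold at index `N`. The extra round in `N + 1` covers the final test. -/
theorem Runs.loop {b : Test} {P : Prog} {s : State} (N T : ℕ) (Inv : ℕ → State → Prop)
    (h0 : Inv 0 s)
    (hstep : ∀ i s', Frame P s s' → Inv i s' → b.Holds s' → i < N ∧ Runs P s' (Inv (i + 1)) T) :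
    Runs (.loop b P) s (fun s' => (∃ i, Inv i s') ∧ ¬ b.Holds s') ((N + 1) * (T + b.cost)) := by
  have key : ∀ m i s', i + m = N → Frame P s s' → Inv i s' →
      Runs (.loop b P) s' (fun s' => (∃ i, Inv i s') ∧ ¬ b.Holds s')
        (m * (T + b.cost) + b.cost) := by
    intro m
    induction m with
    | zero =>
      intro i s' hi hf hI
      by_cases hb : b.Holds s'
      · have := (hstep i s' hf hI hb).1; omega
      · exact ⟨s', _, .loopDone hb, by omega, ⟨i, hI⟩, hb⟩
    | succ m ih =>
      intro i s' hi hf hI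
      by_cases hb : b.Holds s'
      · obtain ⟨hlt, s₁, t₁, he, ht, hq⟩ := hstep i s' hf hI hb
        obtain ⟨s₂, t₂, he₂, ht₂, hq₂⟩ :=
          ih (i + 1) s₁ (by omega) (hf.trans he.frame) hq
        exact ⟨s₂, _, .loopStep hb he he₂, by rw [Nat.succ_mul]; omega, hq₂⟩
      · exact ⟨s', _, .loopDone hb, by omega, ⟨i, hI⟩, hb⟩
  exact (key N 0 s (by omega) (Frame.refl _ _) h0).mono (fun _ h _ => h)
    (by rw [Nat.succ_mul]; omega)

/-! ### Loop-free programs and counting loops -/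

/-- Programs without loops. -/
def Prog.flat : Prog → Bool
  | .seq P Q => P.flat && Q.flat
  | .ite _ P Q => P.flat && Q.flat
  | .loop _ _ => false
  | _ => true

open Classical in
/-- The effect of a program without loops. -/
noncomputable def Prog.den : Prog → State → State
  | .skip, s => s
  | .setNat a i e, s => s.putNat a (i.eval s) (e.eval s)
  | .setReal a i e, s => s.putReal a (i.eval s) (e.eval s)
  | .seq P Q, s => Q.den (P.den s)
  | .ite b P Q, s => if b.Holds s then P.den s else Q.den s
  | .loop _ _, s => s

/-- A bound on the time of a program without loops. -/
def Prog.time : Prog → ℕ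
  | .skip => 1
  | .setNat _ i e => i.cost + e.cost + 1
  | .setReal _ i e => i.cost + e.cost + 1
  | .seq P Q => P.time + Q.time
  | .ite b P Q => b.cost + (P.time + Q.time)
  | .loop _ _ => 0

/-- Loop-free programs are executed symbolically: `simp` evaluates `Prog.den`, and the time bound is
a computation. Adding the times of both branches avoids a case distinction there. -/
theorem Runs.of_flat {P : Prog} {s : State} {Q : State → Prop} {T : ℕ} (hP : P.flat = true)
    (hT : P.time ≤ T) (hQ : Q (P.den s)) : Runs P s Q T := by
  suffices H : ∀ (P : Prog) (s : State), P.flat = true → ∃ t, Exec P s (P.den s) t ∧ t ≤ P.time by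
    obtain ⟨t, he, ht⟩ := H P s hP
    exact ⟨_, t, he, ht.trans hT, hQ⟩
  clear hP hT hQ
  intro P
  induction P with
  | skip => exact fun s _ => ⟨_, .skip s, le_rfl⟩
  | setNat a i e => exact fun s _ => ⟨_, .setNat s a i e, le_rfl⟩
  | setReal a i e => exact fun s _ => ⟨_, .setReal s a i e, le_rfl⟩
  | seq P Q ihP ihQ =>
    intro s h
    simp only [Prog.flat, Bool.and_eq_true] at h
    obtain ⟨t, he, ht⟩ := ihP s h.1
    obtain ⟨t', he', ht'⟩ := ihQ (P.den s) h.2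
    exact ⟨_, he.seq he', by simp only [Prog.time]; omega⟩
  | ite b P Q ihP ihQ =>
    intro s h
    simp only [Prog.flat, Bool.and_eq_true] at h
    obtain ⟨t, he, ht⟩ := ihP s h.1
    obtain ⟨t', he', ht'⟩ := ihQ s h.2
    by_cases hb : b.Holds s
    · exact ⟨_, by simpa [Prog.den, hb] using Exec.iteTrue hb he, by simp only [Prog.time]; omega⟩
    · exact ⟨_, by simpa [Prog.den, hb] using Exec.iteFalse hb he',
        by simp only [Prog.time]; omega⟩
  | loop b P _ => intro s h; simp [Prog.flat] at h

/-- The number stored in cell `0` of the array of naturals `a`. -/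
abbrev nv (a : ℕ) : NExp := .read a (.lit 0)

/-- The number stored in cell `0` of the array of reals `a`. -/
abbrev rv (a : ℕ) : RExp := .read a (.lit 0)

/-- The test `x < y`. -/
abbrev natLT (x y : NExp) : Test := .not (.natLE y x)

/-- The test `x < y`. -/
abbrev realLT (x y : RExp) : Test := .not (.realLE y x)

/-- The test `x = y`. -/
abbrev natEq (x y : NExp) : Test := .and (.natLE x y) (.natLE y x)

/-- The disjunction of two tests. -/
abbrev tor (b b' : Test) : Test := .not (.and (.not b) (.not b'))

/-- Run `P` with the counter `v` going from `0` up to, but not including, the number in `b`. -/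
abbrev forN (v b : ℕ) (P : Prog) : Prog :=
  .seq (.setNat v (.lit 0) (.lit 0))
    (.loop (natLT (nv v) (nv b)) (.seq P (.setNat v (.lit 0) (.add (nv v) (.lit 1)))))

/-- The invariant refers to the memory after the increment of the counter, whence the `putNat` in
`hstep`. Of the 15 extra steps per round, 6 pay for the test and 6 for the increment; the other 3
cover the initialization. -/
theorem Runs.forN {v b : ℕ} {P : Prog} {s : State} {n T : ℕ} {Inv : ℕ → State → Prop}
    (hn : s.nat b 0 = n) (hv : P.writesNat v = false)
    (hb : (forN v b P).writesNat b = false) (h0 : Inv 0 (s.putNat v 0 0))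
    (hstep : ∀ i, i < n → ∀ s', Frame (forN v b P) s s' → s'.nat v 0 = i → Inv i s' →
      Runs P s' (fun s'' => Inv (i + 1) (s''.putNat v 0 (i + 1))) T) :
    Runs (forN v b P) s (Inv n) ((n + 1) * (T + 15)) := by
  have hb' := hb
  simp only [Prog.writesNat, Bool.or_eq_false_iff, beq_eq_false_iff_ne] at hb'
  have hfr : ∀ {P' : Prog} {s₁ s₂ : State}, Frame (.seq P (.setNat v (.lit 0)
      (.add (nv v) (.lit 1)))) s₁ s₂ → Frame (RealRAM.forN v b P) s₁ s₂ := by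
    intro P' s₁ s₂ h
    refine ⟨fun a ha => h.nat a ?_, fun a ha => h.real a ?_⟩
    · simpa [Prog.writesNat] using (by simpa [Prog.writesNat] using ha : _ ∧ _).2
    · simpa [Prog.writesReal] using ha
  have h1 : Runs (.setNat v (.lit 0) (.lit 0)) s (fun s' => s' = s.putNat v 0 0) 3 :=
    Runs.of_flat rfl le_rfl rfl
  refine h1.seq (T₂ := (n + 1) * (T + 6 + 6)) ?_ (by nlinarith)
  intro s₁ hs₁ hf₁
  subst hs₁
  have h2 := Runs.loop (b := natLT (nv v) (nv b)) (s := s.putNat v 0 0)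
    (P := .seq P (.setNat v (.lit 0) (.add (nv v) (.lit 1)))) n (T + 6)
    (fun i s' => i ≤ n ∧ s'.nat v 0 = i ∧ s'.nat b 0 = n ∧ Inv i s') ?_ ?_
  · refine h2.mono ?_ le_rfl
    rintro s' ⟨⟨i, hi, hvi, hbn, hI⟩, hnot⟩ -
    simp only [Test.Holds, NExp.eval, not_not, hvi, hbn] at hnot
    obtain rfl : i = n := le_antisymm hi hnot
    exact hI
  · refine ⟨Nat.zero_le _, by simp, ?_, h0⟩
    rw [State.putNat_nat_ne _ _ _ _ _ hb'.1]; exact hn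
  · rintro i s' hf ⟨hi, hvi, hbn, hI⟩ hb
    simp only [Test.Holds, NExp.eval, hvi, hbn, not_le] at hb
    refine ⟨hb, ?_⟩
    have hF : Frame (RealRAM.forN v b P) s s' := by
      refine Frame.trans ?_ (hfr (P' := P) hf)
      refine ⟨fun a ha => ?_, fun _ _ => rfl⟩
      simp only [Prog.writesNat, Bool.or_eq_false_iff, beq_eq_false_iff_ne] at ha
      rw [State.putNat_nat_ne _ _ _ _ _ ha.1]
    refine (hstep i hb s' hF hvi hI).seq (T₂ := 6) ?_ le_rfl
    intro s'' hI'' hf''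
    have hv'' : s''.nat v 0 = i := by rw [hf''.nat v hv, hvi]
    refine Runs.of_flat rfl le_rfl ?_
    simp only [Prog.den, NExp.eval, hv'']
    refine ⟨hb, by simp, ?_, hI''⟩
    rw [State.putNat_nat_ne _ _ _ _ _ hb'.1, hf''.nat b hb'.2.1, hbn]

theorem Runs.forN_flat {v b : ℕ} {P : Prog} {s : State} {n T : ℕ} {Inv : ℕ → State → Prop}
    (hn : s.nat b 0 = n) (hv : P.writesNat v = false)
    (hb : (RealRAM.forN v b P).writesNat b = false) (hP : P.flat = true) (hT : P.time ≤ T)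
    (h0 : Inv 0 (s.putNat v 0 0))
    (hstep : ∀ i, i < n → ∀ s', Frame (RealRAM.forN v b P) s s' → s'.nat v 0 = i → Inv i s' →
      Inv (i + 1) ((P.den s').putNat v 0 (i + 1))) :
    Runs (RealRAM.forN v b P) s (Inv n) ((n + 1) * (T + 15)) :=
  Runs.forN hn hv hb h0 fun i hi s' hf hvi hI => Runs.of_flat hP hT (hstep i hi s' hf hvi hI)

/-! ### Names of the arrays -/

notation "aCap" => (1 : ℕ)
notation "aFlag" => (2 : ℕ)
notation "aOpen" => (3 : ℕ)
notation "aAsg" => (4 : ℕ)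
notation "cNC" => (5 : ℕ)
notation "cNS" => (6 : ℕ)
notation "cSize" => (7 : ℕ)
notation "cNodes" => (8 : ℕ)
notation "cK" => (9 : ℕ)
notation "aRow" => (10 : ℕ)
notation "aSig" => (11 : ℕ)
notation "aCls" => (12 : ℕ)
notation "aLab" => (13 : ℕ)
notation "cM" => (14 : ℕ)
notation "aPw" => (15 : ℕ)
notation "cRem" => (16 : ℕ)
notation "cDig" => (17 : ℕ)
notation "cPick" => (18 : ℕ)
notation "aOp" => (19 : ℕ)
notation "aOl" => (20 : ℕ)
notation "cLen" => (21 : ℕ)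
notation "cSum" => (22 : ℕ)
notation "aX" => (23 : ℕ)
notation "aLd" => (24 : ℕ)
notation "aTree" => (25 : ℕ)
notation "aPar" => (26 : ℕ)
notation "cFound" => (27 : ℕ)
notation "cHas" => (28 : ℕ)
notation "cBi" => (29 : ℕ)
notation "cBh" => (30 : ℕ)
notation "cTmp" => (31 : ℕ)
notation "cCnt" => (32 : ℕ)
notation "cE" => (40 : ℕ)
notation "cF" => (41 : ℕ)
notation "cG" => (42 : ℕ)
notation "cJ" => (43 : ℕ)
notation "cI" => (44 : ℕ)
notation "cH" => (45 : ℕ)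
notation "cA" => (46 : ℕ)
notation "cT" => (47 : ℕ)
notation "rDist" => (1 : ℕ)
notation "rSize" => (2 : ℕ)
notation "rEps" => (3 : ℕ)
notation "rDel" => (4 : ℕ)
notation "rD" => (5 : ℕ)
notation "rMin" => (6 : ℕ)
notation "rThr" => (7 : ℕ)
notation "rPi" => (8 : ℕ)
notation "rV" => (9 : ℕ)
notation "rSl" => (10 : ℕ)
notation "rCost" => (11 : ℕ)
notation "rBest" => (12 : ℕ)

infixr:60 " ;; " => Prog.seq

/-! ### The transportation problem -/

/-- Among the first `n` clients, the number of those that `X` assigns to `j`. -/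
def load (n : ℕ) (X : ℕ → ℕ) (j : ℕ) : ℕ := ((Finset.range n).filter fun i => X i = j).card

/-- The distance of client `i` and the open facility number `h`. -/
abbrev distE (i h : NExp) : RExp :=
  .read rDist (.add (.read aRow (.add (nv 0) i)) (.read aOl h))

/-- The reduced cost of assigning client `i` to the open facility number `h`. -/
abbrev slackE (i h : NExp) : RExp :=
  .sub (.add (distE i h) (.read rPi h)) (.read rV i)

/-- The distance of client `i` and the open facility number `h` in the memory `s`. -/
def State.dist (s : State) : ℕ → ℕ → ℝ := fun i h =>
  s.real rDist (s.nat aRow (s.nat 0 0 + i) + s.nat aOl h)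

theorem State.dist_eq (s : State) :
    s.dist = fun i h => s.real rDist (s.nat aRow (s.nat 0 0 + i) + s.nat aOl h) := rfl

/-- The reduced cost of assigning client `i` to the open facility number `h`. -/
def State.slack (s : State) (i h : ℕ) : ℝ := s.dist i h + s.real rPi h - s.real rV i

/-- Client `i` is in the tree and the open facility number `h` is not. -/
def State.Leaving (s : State) (i h : ℕ) : Prop :=
  1 ≤ s.nat aTree (s.nat aX i) ∧ s.nat aTree h = 0

/-- Find a pair of least reduced cost that leaves the tree. -/
def minSlackBody : Prog :=
  .ite (.and (.natLE (.lit 1) (.read aTree (.read aX (nv cI))))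
      (.and (.natLE (.read aTree (nv cH)) (.lit 0))
        (tor (.natLE (nv cHas) (.lit 0)) (realLT (slackE (nv cI) (nv cH)) (rv rSl)))))
    (.setNat cHas (.lit 0) (.lit 1) ;; .setReal rSl (.lit 0) (slackE (nv cI) (nv cH)) ;;
      .setNat cBi (.lit 0) (nv cI) ;; .setNat cBh (.lit 0) (nv cH)) .skip

def minSlack : Prog :=
  .setNat cHas (.lit 0) (.lit 0) ;; forN cI cNC (forN cH cLen minSlackBody)

/-- `cBi`, `cBh`, `rSl` hold the best among the leaving pairs in `S`, and `cHas` is `0` if there is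
none. -/
def MinSlackInv (s₀ s : State) (S : ℕ → ℕ → Prop) : Prop :=
  (s.nat cHas 0 = 0 ∧ ∀ i h, S i h → ¬ s₀.Leaving i h) ∨
  (s.nat cHas 0 = 1 ∧ s₀.Leaving (s.nat cBi 0) (s.nat cBh 0) ∧ S (s.nat cBi 0) (s.nat cBh 0) ∧
    s.real rSl 0 = s₀.slack (s.nat cBi 0) (s.nat cBh 0) ∧
    ∀ i h, S i h → s₀.Leaving i h → s.real rSl 0 ≤ s₀.slack i h)

/-- A lexicographic scan: the pairs seen are those of earlier clients and, for the current client,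
those at earlier positions. The flag `cHas` is needed because `rSl` means nothing before the first
leaving pair is met. -/
theorem minSlack_runs {s : State} {n m B : ℕ} (hn : s.nat cNC 0 = n) (hm : s.nat cLen 0 = m)
    (hB : n + 1 ≤ B) (hB' : m + 1 ≤ B) :
    Runs minSlack s (fun s' => MinSlackInv s s' fun i h => i < n ∧ h < m) (B * (B * 120 + 20)) := by
  refine Runs.seq (Q := fun s' => s' = s.putNat cHas 0 0) (T₁ := 3) (Runs.of_flat rfl le_rfl rfl)
    (T₂ := (n + 1) * ((m + 1) * (100 + 15) + 15)) ?_ ?_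
  swap
  · nlinarith [Nat.mul_le_mul hB hB', Nat.mul_le_mul hB hB]
  rintro s₁ rfl -
  refine (Runs.forN (n := n) (Inv := fun a s' => MinSlackInv s s' fun i h => i < a ∧ h < m)
    (by simpa using hn) rfl rfl ?_ ?_).mono (fun _ h _ => h) le_rfl
  · left; simp
  intro a ha s' hf hcI hI
  refine (Runs.forN_flat (n := m)
    (Inv := fun b s' => MinSlackInv s s' fun i h => (i < a ∧ h < m) ∨ (i = a ∧ h < b))
    ?_ rfl rfl rfl ?_ ?_ ?_).mono ?_ le_rfl
  · rw [hf.nat cLen rfl]; simpa using hm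
  · decide
  · simpa [MinSlackInv] using hI
  · intro b hb s'' hf' hcH hI'
    have hcI' : s''.nat cI 0 = a := by rw [hf'.nat cI rfl, hcI]
    have hX : s''.nat aX = s.nat aX := by rw [hf'.nat aX rfl, hf.nat aX rfl]; simp
    have hT : s''.nat aTree = s.nat aTree := by rw [hf'.nat aTree rfl, hf.nat aTree rfl]; simp
    have hS : s''.slack = s.slack := by
      ext i h
      simp only [State.slack, State.dist]
      rw [hf'.nat aRow rfl, hf.nat aRow rfl, hf'.nat aOl rfl, hf.nat aOl rfl, hf'.nat 0 rfl,
        hf.nat 0 rfl, hf'.real rDist rfl, hf.real rDist rfl, hf'.real rPi rfl, hf.real rPi rfl,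
        hf'.real rV rfl, hf.real rV rfl]
      simp
    have hS' : s''.real rDist (s''.nat aRow (s''.nat 0 0 + a) + s''.nat aOl b) + s''.real rPi b -
        s''.real rV a = s.slack a b := by rw [← hS]; rfl
    simp only [minSlackBody, Prog.den, Test.Holds, NExp.eval, RExp.eval, hcI', hcH, hX, hT, hS']
    split_ifs with hc
    · right
      obtain ⟨h1, h2, h3⟩ := hc
      have hL : s.Leaving a b := ⟨h1, by omega⟩
      simp only [ne_eq, Nat.reduceEqDiff, not_false_eq_true,
        State.putNat_nat_ne, State.putNat_nat_self, State.putReal_nat, State.putNat_real,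
        State.putReal_real_self, Function.update_self, hcI', hcH, hS']
      refine ⟨trivial, hL, Or.inr ⟨trivial, Nat.lt_succ_self b⟩, trivial, ?_⟩
      rintro i h hih hL'
      by_cases hih' : i < a ∧ h < m ∨ i = a ∧ h < b
      · rcases hI' with ⟨h0, hI'⟩ | ⟨h0, -, -, -, hI'⟩
        · exact absurd hL' (hI' i h hih')
        · have := hI' i h hih' hL'
          simp only [h0, nonpos_iff_eq_zero, one_ne_zero, not_false_eq_true, true_and,
            not_not, not_le] at h3
          linarith
      · obtain ⟨rfl, rfl⟩ : i = a ∧ h = b := by omega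
        exact le_rfl
    · simp only [MinSlackInv, ne_eq, Nat.reduceEqDiff,
        not_false_eq_true, State.putNat_nat_ne, State.putNat_real]
      -- The one new pair failed the test, so if it leaves the tree, a pair that is at least as good
      -- is already recorded.
      have key : ∀ i h, (i < a ∧ h < m ∨ i = a ∧ h < b + 1) → s.Leaving i h →
          (i < a ∧ h < m ∨ i = a ∧ h < b) ∨ (s''.nat cHas 0 ≠ 0 ∧
            s''.real rSl 0 ≤ s.slack i h) := by
        intro i h hih hL
        by_cases hih' : i < a ∧ h < m ∨ i = a ∧ h < b
        · exact Or.inl hih'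
        · obtain ⟨rfl, rfl⟩ : i = a ∧ h = b := by omega
          right
          obtain ⟨hL1, hL2⟩ := hL
          simpa [hL1, hL2] using hc
      rcases hI' with ⟨h0, hI'⟩ | ⟨h0, hL, hS, hd, hI'⟩
      · refine Or.inl ⟨h0, fun i h hih hL => ?_⟩
        rcases key i h hih hL with h' | h'
        · exact hI' i h h' hL
        · exact h'.1 h0
      · refine Or.inr ⟨h0, hL, by omega, hd, fun i h hih hL => ?_⟩
        rcases key i h hih hL with h' | h'
        · exact hI' i h h' hL
        · exact h'.2
  · intro s'' h hf'
    simp only [MinSlackInv, ne_eq, Nat.reduceEqDiff,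
        not_false_eq_true, State.putNat_nat_ne, State.putNat_real]
    have e : ∀ i h, (i < a + 1 ∧ h < m) ↔ (i < a ∧ h < m ∨ i = a ∧ h < m) := by omega
    simpa only [e, MinSlackInv] using h

/-! ### Complementary slackness and augmenting paths -/

theorem sum_comp_eq_sum_load {n m : ℕ} {Y : ℕ → ℕ} (hY : ∀ i < n, Y i < m) (f : ℕ → ℝ) :
    ∑ i ∈ Finset.range n, f (Y i) = ∑ j ∈ Finset.range m, (load n Y j : ℝ) * f j := by
  rw [← Finset.sum_fiberwise_of_maps_to (t := Finset.range m) (g := Y)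
    (fun i hi => Finset.mem_range.2 (hY i (Finset.mem_range.1 hi)))]
  refine Finset.sum_congr rfl fun j _ => ?_
  rw [Finset.sum_congr rfl (g := fun _ => f j)
    (fun i hi => by rw [(Finset.mem_filter.1 hi).2])]
  simp [load]

theorem sum_load {n m : ℕ} {Y : ℕ → ℕ} (hY : ∀ i < n, Y i < m) :
    ∑ j ∈ Finset.range m, load n Y j = n := by
  have := Finset.card_eq_sum_card_fiberwise (s := Finset.range n) (t := Finset.range m) (f := Y)
    (fun i hi => by simpa using hY i (by simpa using hi))
  simpa [load] using this.symm

/-- Indicators are added on both sides; this avoids truncated subtraction and covers the case `h = X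
i`. -/
theorem load_update {n : ℕ} {X : ℕ → ℕ} {i : ℕ} (hi : i < n) (h j : ℕ) :
    load n (Function.update X i h) j + (if j = X i then 1 else 0) =
      load n X j + (if j = h then 1 else 0) := by
  have e : ∀ Y : ℕ → ℕ, load n Y j = (if Y i = j then 1 else 0) +
      (((Finset.range n).erase i).filter fun i' => Y i' = j).card := by
    intro Y
    rw [load, ← Finset.insert_erase (Finset.mem_range.2 hi), Finset.filter_insert]
    split_ifs with hY
    · rw [Finset.card_insert_of_notMem (by simp), add_comm]; simp
    · simp
  rw [e, e X]
  have : (((Finset.range n).erase i).filter fun i' => Function.update X i h i' = j) =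
      ((Finset.range n).erase i).filter fun i' => X i' = j := by
    refine Finset.filter_congr fun i' hi' => ?_
    rw [Function.update_of_ne (Finset.ne_of_mem_erase hi')]
  rw [this, Function.update_self]
  simp only [eq_comm (a := j)]
  omega

/-- The assignment `X` of the first `n` clients to `m` facilities, in which `X i = m` says that `i`
is not assigned, respects the capacities, and satisfies together with the prices `p` and the client
values `v` the conditions of complementary slackness. -/
structure Dual (n m : ℕ) (C : ℕ → ℕ → ℝ) (cap X ld : ℕ → ℕ) (p v : ℕ → ℝ) : Prop where
  le : ∀ i < n, X i ≤ m
  low : ∀ i < n, ∀ h < m, v i ≤ C i h + p h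
  tight : ∀ i < n, X i < m → v i = C i (X i) + p (X i)
  ld_eq : ∀ j < m, ld j = load n X j
  ld_le : ∀ j < m, ld j ≤ cap j
  nonneg : ∀ j < m, 0 ≤ p j
  slack : ∀ j < m, ld j < cap j → p j = 0

/-- Weak duality. `X` sends every client to a facility that minimizes distance plus price, and `Y`
pays no more in prices than `X`: where the price is positive, `X` uses the full capacity, which `Y`
cannot exceed. -/
theorem Dual.optimal {n m : ℕ} {C : ℕ → ℕ → ℝ} {cap X ld : ℕ → ℕ} {p v : ℕ → ℝ}
    (H : Dual n m C cap X ld p v) (hX : ∀ i < n, X i < m) {Y : ℕ → ℕ} (hY : ∀ i < n, Y i < m)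
    (hcap : ∀ j < m, load n Y j ≤ cap j) :
    ∑ i ∈ Finset.range n, C i (X i) ≤ ∑ i ∈ Finset.range n, C i (Y i) := by
  have h1 : ∑ i ∈ Finset.range n, (C i (X i) + p (X i)) ≤
      ∑ i ∈ Finset.range n, (C i (Y i) + p (Y i)) := by
    refine Finset.sum_le_sum fun i hi => ?_
    rw [Finset.mem_range] at hi
    rw [← H.tight i hi (hX i hi)]
    exact H.low i hi _ (hY i hi)
  have h2 : ∑ i ∈ Finset.range n, p (Y i) ≤ ∑ i ∈ Finset.range n, p (X i) := by
    rw [sum_comp_eq_sum_load hY, sum_comp_eq_sum_load hX]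
    refine Finset.sum_le_sum fun j hj => ?_
    rw [Finset.mem_range] at hj
    by_cases hs : ld j < cap j
    · simp [H.slack j hj hs]
    · refine mul_le_mul_of_nonneg_right ?_ (H.nonneg j hj)
      have := H.ld_eq j hj
      have := hcap j hj
      exact_mod_cast (by omega : load n Y j ≤ load n X j)
  rw [Finset.sum_add_distrib, Finset.sum_add_distrib] at h1
  linarith

/-- The Hungarian tree: `T` marks the facilities in the tree, `m` is the root, and `par h` is a
client in the tree with a tight edge to `h`. -/
structure Tree (n m : ℕ) (C : ℕ → ℕ → ℝ) (X T par : ℕ → ℕ) (p v : ℕ → ℝ) (rk : ℕ → ℕ) :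
    Prop where
  root : 1 ≤ T m
  rk_le : ∀ h ≤ m, rk h ≤ m
  edge : ∀ h < m, 1 ≤ T h → par h < n ∧ 1 ≤ T (X (par h)) ∧ rk (X (par h)) < rk h ∧
    v (par h) = C (par h) h + p h

/-- A client is in the tree exactly if its facility is, so both ends of a tight assignment rise
together or not at all. Only pairs leaving the tree lose slack, and `δ` is at most that slack.
Prices rise on saturated facilities only. -/
theorem Dual.raise {n m : ℕ} {C : ℕ → ℕ → ℝ} {cap X ld T : ℕ → ℕ} {p v p' v' : ℕ → ℝ} {δ : ℝ}
    (H : Dual n m C cap X ld p v) (h0 : 0 ≤ δ)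
    (hsat : ∀ h < m, 1 ≤ T h → ¬ ld h < cap h)
    (hp : ∀ h < m, p' h = if 1 ≤ T h then p h + δ else p h)
    (hv : ∀ i < n, v' i = if 1 ≤ T (X i) then v i + δ else v i)
    (hδ : ∀ i < n, ∀ h < m, 1 ≤ T (X i) → T h = 0 → δ ≤ C i h + p h - v i) :
    Dual n m C cap X ld p' v' := by
  refine ⟨H.le, fun i hi h hh => ?_, fun i hi hX => ?_, H.ld_eq, H.ld_le, fun j hj => ?_,
    fun j hj hs => ?_⟩
  · have := H.low i hi h hh
    rw [hp h hh, hv i hi]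
    split_ifs with h1 h2 h2
    · linarith
    · linarith [hδ i hi h hh h1 (by omega)]
    · linarith
    · linarith
  · have := H.tight i hi hX
    rw [hp _ hX, hv i hi]
    split_ifs <;> linarith
  · have := H.nonneg j hj
    rw [hp j hj]
    split_ifs <;> linarith
  · rw [hp j hj, if_neg (fun h => hsat j hj h hs), H.slack j hj hs]

/-- Both ends of an old tree edge rise by `δ`, so it stays tight; `δ` is the reduced cost of the
pair `bi`, `bh`, so this edge becomes tight. The new facility is ranked above all others. Ranks
exist only in the proof; they show that the parent pointers lead to the root. -/
theorem Tree.grow {n m : ℕ} {C : ℕ → ℕ → ℝ} {cap X ld T par rk : ℕ → ℕ} {p v p' v' : ℕ → ℝ}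
    {δ : ℝ} {bi bh r : ℕ} (H : Dual n m C cap X ld p v) (K : Tree n m C X T par p v rk)
    (hp : ∀ h < m, p' h = if 1 ≤ T h then p h + δ else p h)
    (hv : ∀ i < n, v' i = if 1 ≤ T (X i) then v i + δ else v i)
    (hbi : bi < n) (hbh : bh < m) (h1 : 1 ≤ T (X bi)) (h2 : T bh = 0)
    (hδ : δ = C bi bh + p bh - v bi) (hr : ∀ h ≤ m, rk h ≤ r) (hrm : r < m) :
    Tree n m C X (Function.update T bh 1) (Function.update par bh bi) p' v'
      (Function.update rk bh (r + 1)) := by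
  have hne : ∀ h, 1 ≤ T h → h ≠ bh := by rintro h hh rfl; omega
  refine ⟨?_, fun h hh => ?_, fun h hh hT => ?_⟩
  · rw [Function.update_of_ne hbh.ne']; exact K.root
  · rw [Function.update_apply]
    split_ifs
    · omega
    · exact K.rk_le h hh
  · by_cases hb : h = bh
    · subst hb
      simp only [Function.update_self]
      rw [Function.update_of_ne (hne _ h1), Function.update_of_ne (hne _ h1)]
      refine ⟨hbi, h1, Nat.lt_succ_of_le (hr _ (H.le bi hbi)), ?_⟩
      rw [hp h hh, hv bi hbi, if_pos h1, if_neg (by omega)]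
      linarith
    · rw [Function.update_of_ne hb] at hT ⊢
      obtain ⟨e1, e2, e3, e4⟩ := K.edge h hh hT
      rw [Function.update_of_ne (hne _ e2), Function.update_of_ne (hne _ e2),
        Function.update_of_ne hb]
      refine ⟨e1, e2, e3, ?_⟩
      rw [hp h hh, hv _ e1, if_pos e2, if_pos hT]
      linarith

/-- The intermediate state of an augmentation along the path from `h₀` to the root, at `cur`. -/
structure Augment (n m : ℕ) (C : ℕ → ℕ → ℝ) (X₀ X T : ℕ → ℕ) (p v : ℕ → ℝ) (rk : ℕ → ℕ)
    (h₀ cur : ℕ) : Prop where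
  le : ∀ i < n, X i ≤ m
  tight : ∀ i < n, X i < m → v i = C i (X i) + p (X i)
  cur_le : cur ≤ m
  cur_tree : 1 ≤ T cur
  ld : ∀ j, load n X j + (if j = cur then 1 else 0) = load n X₀ j + (if j = h₀ then 1 else 0)
  agree : ∀ i < n, rk (X₀ i) < rk cur → X i = X₀ i

/-- All clients moved so far came from facilities of rank at least that of `cur`, which is what
`agree` records. Hence the parent client of `cur` is still where it was when the tree was built, and
its tight edge can be used. -/
theorem Augment.step {n m : ℕ} {C : ℕ → ℕ → ℝ} {cap X₀ X ld T par rk : ℕ → ℕ} {p v : ℕ → ℝ}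
    {h₀ cur : ℕ} (H : Dual n m C cap X₀ ld p v) (K : Tree n m C X₀ T par p v rk)
    (A : Augment n m C X₀ X T p v rk h₀ cur) (hcur : cur ≠ m) :
    Augment n m C X₀ (Function.update X (par cur) cur) T p v rk h₀ (X (par cur)) ∧
      rk (X (par cur)) < rk cur := by
  have hc : cur < m := lt_of_le_of_ne A.cur_le hcur
  obtain ⟨e1, e2, e3, e4⟩ := K.edge cur hc A.cur_tree
  have hX : X (par cur) = X₀ (par cur) := A.agree _ e1 e3
  refine ⟨⟨fun i hi => ?_, fun i hi hXi => ?_, ?_, ?_, fun j => ?_, fun i hi hrk => ?_⟩, ?_⟩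
  · rw [Function.update_apply]; split_ifs
    · exact A.cur_le
    · exact A.le i hi
  · rw [Function.update_apply] at hXi ⊢
    split_ifs at hXi ⊢ with h
    · rw [h]; exact e4
    · exact A.tight i hi hXi
  · rw [hX]; exact H.le _ e1
  · rw [hX]; exact e2
  · rw [load_update e1]; exact A.ld j
  · rw [hX] at hrk
    rw [Function.update_of_ne, A.agree i hi (hrk.trans e3)]
    rintro rfl
    exact lt_irrefl _ hrk
  · rw [hX]; exact e3

/-- Facilities inside the path gain one client and lose one, so only the loads of `h₀` and of the
dummy facility `m` change. Prices are untouched, and `h₀` was unsaturated, so its price is 0 and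
stays so. -/
theorem Dual.augment {n m : ℕ} {C : ℕ → ℕ → ℝ} {cap X₀ X ld T rk : ℕ → ℕ} {p v : ℕ → ℝ}
    {h₀ : ℕ} (H : Dual n m C cap X₀ ld p v)
    (A : Augment n m C X₀ X T p v rk h₀ m) (hh : h₀ < m) (hs : ld h₀ < cap h₀) :
    Dual n m C cap X (Function.update ld h₀ (ld h₀ + 1)) p v ∧ load n X m + 1 = load n X₀ m := by
  refine ⟨⟨A.le, H.low, A.tight, fun j hj => ?_, fun j hj => ?_, H.nonneg, fun j hj hc => ?_⟩, ?_⟩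
  · have := A.ld j
    rw [if_neg hj.ne] at this
    rw [Function.update_apply]
    have := H.ld_eq j hj
    split_ifs at * with h
    · subst h; omega
    · omega
  · rw [Function.update_apply]; split_ifs with h
    · subst h; exact hs
    · exact H.ld_le j hj
  · rw [Function.update_apply] at hc; split_ifs at hc with h
    · subst h; exact H.slack j hj hs
    · exact H.slack j hj hc
  · have := A.ld m
    rw [if_pos rfl, if_neg hh.ne'] at this
    exact this

/-! ### Loops that fill or raise arrays -/

theorem Runs.fillNat {v b a : ℕ} {e : NExp} {s : State} {n : ℕ} (f : ℕ → ℕ)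
    (hn : s.nat b 0 = n) (hva : v ≠ a) (hvb : b ≠ v) (hba : b ≠ a)
    (he : ∀ i, i < n → ∀ s', Frame (RealRAM.forN v b (.setNat a (nv v) e)) s s' →
      s'.nat v 0 = i → e.eval s' = f i) :
    Runs (RealRAM.forN v b (.setNat a (nv v) e)) s
      (fun s' => s'.nat a = fun i => if i < n then f i else s.nat a i)
      ((n + 1) * (e.cost + 20)) := by
  refine (Runs.forN_flat (T := e.cost + 5) (Inv := fun j s' => s'.nat a = fun i =>
    if i < j then f i else s.nat a i) hn ?_ ?_ rfl ?_ ?_ ?_).mono (fun _ h _ => h) le_rfl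
  · simp [Prog.writesNat, hva]
  · simp [Prog.writesNat, hvb, hba]
  · simp only [Prog.time, NExp.cost]; omega
  · simp [hva.symm]
  · intro i hi s' hf hv hI
    simp only [Prog.den, NExp.eval, hv, he i hi s' hf hv]
    rw [State.putNat_nat_ne _ _ _ _ _ hva.symm, State.putNat_nat_self, hI]
    ext j
    rw [Function.update_apply]
    by_cases h1 : j = i
    · subst h1; simp
    · simp [h1, show (j < i + 1 ↔ j < i) by omega]

theorem Runs.fillReal {v b a : ℕ} {e : RExp} {s : State} {n : ℕ} (f : ℕ → ℝ)
    (hn : s.nat b 0 = n) (hvb : b ≠ v)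
    (he : ∀ i, i < n → ∀ s', Frame (RealRAM.forN v b (.setReal a (nv v) e)) s s' →
      s'.nat v 0 = i → e.eval s' = f i) :
    Runs (RealRAM.forN v b (.setReal a (nv v) e)) s
      (fun s' => s'.real a = fun i => if i < n then f i else s.real a i)
      ((n + 1) * (e.cost + 20)) := by
  refine (Runs.forN_flat (T := e.cost + 5) (Inv := fun j s' => s'.real a = fun i =>
    if i < j then f i else s.real a i) hn rfl ?_ rfl ?_ ?_ ?_).mono (fun _ h _ => h) le_rfl
  · simp [Prog.writesNat, hvb]
  · simp only [Prog.time, NExp.cost]; omega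
  · simp
  · intro i hi s' hf hv hI
    simp only [Prog.den, NExp.eval, hv, he i hi s' hf hv]
    rw [State.putNat_real, State.putReal_real_self, hI]
    ext j
    rw [Function.update_apply]
    by_cases h1 : j = i
    · subst h1; simp
    · simp [h1, show (j < i + 1 ↔ j < i) by omega]

/-- A loop that adds `rSl` to the entries of an array that satisfy a test. -/
theorem Runs.raise {v b a : ℕ} {c : Test} {s : State} {n : ℕ} (q : ℕ → Prop)
    [DecidablePred q] (hn : s.nat b 0 = n) (hvb : b ≠ v) (ha : a ≠ rSl)
    (hc : ∀ i, i < n → ∀ s', Frame (RealRAM.forN v b (.setReal a (nv v) (.lit 0))) s s' →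
      s'.nat v 0 = i → (c.Holds s' ↔ q i)) :
    Runs (RealRAM.forN v b (.ite c (.setReal a (nv v) (.add (.read a (nv v)) (rv rSl))) .skip)) s
      (fun s' => ∀ i, i < n → s'.real a i = if q i then s.real a i + s.real rSl 0 else s.real a i)
      ((n + 1) * (c.cost + 30)) := by
  have hfr : ∀ s', Frame (RealRAM.forN v b (.ite c (.setReal a (nv v)
      (.add (.read a (nv v)) (rv rSl))) .skip)) s s' →
      Frame (RealRAM.forN v b (.setReal a (nv v) (.lit 0))) s s' := by
    refine fun s' h => ⟨fun x hx => h.nat x ?_, fun x hx => h.real x ?_⟩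
    · simpa [Prog.writesNat] using hx
    · simpa [Prog.writesReal] using hx
  refine (Runs.forN_flat (T := c.cost + 15) (Inv := fun j s' => ∀ i, s'.real a i =
    if i < j ∧ q i then s.real a i + s.real rSl 0 else s.real a i) hn rfl ?_ rfl ?_ ?_ ?_).mono
      ?_ le_rfl
  · simp [Prog.writesNat, hvb]
  · simp only [Prog.time, NExp.cost, RExp.cost]; omega
  · simp
  · intro i hi s' hf hv hI j
    have hq := hc i hi s' (hfr s' hf) hv
    have hsl : s'.real rSl 0 = s.real rSl 0 := by
      rw [hf.real]; simp [Prog.writesReal, ha.symm]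
    simp only [Prog.den, hq]
    split_ifs with h1 h2 h2
    · simp only [NExp.eval, RExp.eval, hv, hsl, State.putNat_real, State.putReal_real_self,
        Function.update_apply, hI]
      by_cases h : j = i
      · simp [h]
      · rw [if_neg h, if_pos ⟨by omega, h2.2⟩]
    · simp only [NExp.eval, RExp.eval, hv, hsl, State.putNat_real, State.putReal_real_self,
        Function.update_apply, hI]
      have h : j ≠ i := by rintro rfl; exact h2 ⟨by omega, h1⟩
      rw [if_neg h, if_neg (fun h' => h2 ⟨by omega, h'.2⟩)]
    · have h : j ≠ i := by rintro rfl; exact h1 h2.2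
      rw [State.putNat_real, hI, if_pos ⟨by omega, h2.2⟩]
    · rw [State.putNat_real, hI, if_neg (fun h' => h2 ⟨by omega, h'.2⟩)]
  · intro s' h _ i hi
    rw [h i]; simp [hi]

/-! ### The Hungarian method as a program -/

/-- Grow the Hungarian tree by one facility. -/
def growTree : Prog :=
  minSlack ;;
  forN cJ cLen (.ite (.natLE (.lit 1) (.read aTree (nv cJ)))
    (.setReal rPi (nv cJ) (.add (.read rPi (nv cJ)) (rv rSl))) .skip) ;;
  forN cI cNC (.ite (.natLE (.lit 1) (.read aTree (.read aX (nv cI))))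
    (.setReal rV (nv cI) (.add (.read rV (nv cI)) (rv rSl))) .skip) ;;
  .setNat aTree (nv cBh) (.lit 1) ;; .setNat aPar (nv cBh) (nv cBi) ;;
  .ite (natLT (.read aLd (nv cBh)) (.read aCap (.read aOl (nv cBh))))
    (.setNat cFound (.lit 0) (.lit 1)) .skip

/-- Move one client along the path to the root. -/
def moveClient : Prog :=
  .setNat cBi (.lit 0) (.read aPar (nv cBh)) ;; .setNat cTmp (.lit 0) (.read aX (nv cBi)) ;;
  .setNat aX (nv cBi) (nv cBh) ;; .setNat cBh (.lit 0) (nv cTmp)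

/-- Assign one more client. -/
def assignOne : Prog :=
  forN cJ cLen (.setNat aTree (nv cJ) (.lit 0)) ;; .setNat aTree (nv cLen) (.lit 1) ;;
  .setNat cFound (.lit 0) (.lit 0) ;;
  .loop (.natLE (nv cFound) (.lit 0)) growTree ;;
  .setNat aLd (nv cBh) (.add (.read aLd (nv cBh)) (.lit 1)) ;;
  .loop (.not (natEq (nv cBh) (nv cLen))) moveClient

/-- Compute an optimal assignment of the clients to the open facilities. -/
def hungarian : Prog :=
  forN cJ cLen (.setReal rPi (nv cJ) (.lit 0)) ;; forN cJ cLen (.setNat aLd (nv cJ) (.lit 0)) ;;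
  forN cI cNC (.setReal rV (nv cI) (.lit 0)) ;; forN cI cNC (.setNat aX (nv cI) (nv cLen)) ;;
  forN cA cNC assignOne

/-- The conditions of complementary slackness for the data in the memory. -/
def State.IsDual (s : State) : Prop :=
  Dual (s.nat cNC 0) (s.nat cLen 0) s.dist (fun h => s.nat aCap (s.nat aOl h)) (s.nat aX)
    (s.nat aLd) (s.real rPi) (s.real rV)

/-- The Hungarian tree in the memory. -/
def State.IsTree (s : State) (rk : ℕ → ℕ) : Prop :=
  Tree (s.nat cNC 0) (s.nat cLen 0) s.dist (s.nat aX) (s.nat aTree) (s.nat aPar) (s.real rPi)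
    (s.real rV) rk

/-- The invariant of the growth of the tree; `r` is the number of the facilities in it. -/
def TreeInv (r : ℕ) (s : State) : Prop :=
  s.IsDual ∧ (∃ rk, s.IsTree rk ∧ ∀ h ≤ s.nat cLen 0, rk h ≤ r) ∧
  ((Finset.range (s.nat cLen 0)).filter fun h => 1 ≤ s.nat aTree h).card = r ∧
  ((s.nat cFound 0 = 0 ∧ ∀ h < s.nat cLen 0, 1 ≤ s.nat aTree h →
      ¬ s.nat aLd h < s.nat aCap (s.nat aOl h)) ∨
    (s.nat cFound 0 = 1 ∧ s.nat cBh 0 < s.nat cLen 0 ∧ 1 ≤ s.nat aTree (s.nat cBh 0) ∧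
      s.nat aLd (s.nat cBh 0) < s.nat aCap (s.nat aOl (s.nat cBh 0))))

/-- The conclusion `r < s.nat cLen 0` bounds the number of rounds of the growing loop. The capacity
hypothesis keeps the tree from getting stuck. -/
theorem growTree_runs {s : State} {r B : ℕ} (hI : TreeInv r s) (h0 : s.nat cFound 0 = 0)
    (hun : ∃ i < s.nat cNC 0, s.nat aX i = s.nat cLen 0)
    (hcap : s.nat cNC 0 ≤ ∑ j ∈ Finset.range (s.nat cLen 0), s.nat aCap (s.nat aOl j))
    (hB : s.nat cNC 0 + 1 ≤ B) (hB' : s.nat cLen 0 + 1 ≤ B) :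
    r < s.nat cLen 0 ∧ Runs growTree s (TreeInv (r + 1)) (B * (B * 120 + 200)) := by
  obtain ⟨hD, ⟨rk, hK, hrk⟩, hr, hF⟩ := hI
  set n := s.nat cNC 0 with hn
  set m := s.nat cLen 0 with hm
  have hsat : ∀ h < m, 1 ≤ s.nat aTree h → ¬ s.nat aLd h < s.nat aCap (s.nat aOl h) := by
    rcases hF with h | h
    · exact h.2
    · omega
  obtain ⟨i₀, hi₀, hX₀⟩ := hun
  -- If all facilities were in the tree, all would be saturated and their loads would sum to at
  -- least `n`. The unassigned client `i₀`, counted under the dummy facility `m`, would push the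
  -- total above `n`.
  have hout : ∃ h < m, s.nat aTree h = 0 := by
    by_contra hcon
    simp only [not_exists, not_and] at hcon
    have h1 : n ≤ ∑ j ∈ Finset.range m, load n (s.nat aX) j := by
      refine hcap.trans (Finset.sum_le_sum fun j hj => ?_)
      rw [Finset.mem_range] at hj
      have := hsat j hj (Nat.one_le_iff_ne_zero.2 (hcon j hj))
      have := hD.ld_eq j hj
      change s.nat aLd j = load n (s.nat aX) j at this
      omega
    have h2 : ∑ j ∈ Finset.range (m + 1), load n (s.nat aX) j = n :=
      sum_load fun i hi => Nat.lt_succ_of_le (hD.le i hi)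
    rw [Finset.sum_range_succ] at h2
    have h3 : 0 < load n (s.nat aX) m :=
      Finset.card_pos.2 ⟨i₀, Finset.mem_filter.2 ⟨Finset.mem_range.2 hi₀, hX₀⟩⟩
    omega
  have hrm : r < m := by
    obtain ⟨h, hh, hT⟩ := hout
    have hss : ((Finset.range m).filter fun h => 1 ≤ s.nat aTree h) ⊂ Finset.range m :=
      Finset.filter_ssubset.2 ⟨h, Finset.mem_range.2 hh, by omega⟩
    simpa [hr] using Finset.card_lt_card hss
  refine ⟨hrm, ?_⟩
  refine (minSlack_runs hn.symm hm.symm hB hB').seq (T₂ := B * 180) ?_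
    (by nlinarith)
  intro s₁ h₁ f₁
  obtain ⟨hL, ⟨hbi, hbh⟩, hd, hmin⟩ : s.Leaving (s₁.nat cBi 0) (s₁.nat cBh 0) ∧
      (s₁.nat cBi 0 < n ∧ s₁.nat cBh 0 < m) ∧
      s₁.real rSl 0 = s.slack (s₁.nat cBi 0) (s₁.nat cBh 0) ∧
      ∀ i h, i < n ∧ h < m → s.Leaving i h → s₁.real rSl 0 ≤ s.slack i h := by
    -- The unassigned client `i₀` belongs to the tree through the root `m`, so a leaving pair
    -- exists.
    rcases h₁ with ⟨-, h⟩ | ⟨-, h⟩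
    · obtain ⟨h', hh', hT'⟩ := hout
      exact absurd ⟨by rw [hX₀]; exact hK.root, hT'⟩ (h i₀ h' ⟨hi₀, hh'⟩)
    · exact h
  set bi := s₁.nat cBi 0 with hbi_def
  set bh := s₁.nat cBh 0 with hbh_def
  refine (Runs.raise (n := m) (a := rPi) (fun j => 1 ≤ s.nat aTree j) ?_ (by decide) (by decide)
    ?_).seq (T₂ := B * 100) ?_ ?_
  · rw [f₁.nat cLen rfl]
  · intro i hi s' hf hv
    simp only [Test.Holds, NExp.eval, hv]
    rw [hf.nat aTree rfl, f₁.nat aTree rfl]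
  swap
  · simp only [Test.cost, NExp.cost]; nlinarith
  intro s₂ h₂ f₂
  refine (Runs.raise (n := n) (a := rV) (fun i => 1 ≤ s.nat aTree (s.nat aX i)) ?_ (by decide)
    (by decide) ?_).seq (T₂ := 40) ?_ ?_
  · rw [f₂.nat cNC rfl, f₁.nat cNC rfl]
  · intro i hi s' hf hv
    simp only [Test.Holds, NExp.eval, hv]
    rw [hf.nat aTree rfl, f₂.nat aTree rfl, f₁.nat aTree rfl, hf.nat aX rfl, f₂.nat aX rfl,
      f₁.nat aX rfl]
  swap
  · simp only [Test.cost, NExp.cost]; nlinarith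
  intro s₃ h₃ f₃
  refine Runs.of_flat rfl (by decide) ?_
  have ebh : s₃.nat cBh 0 = bh := by rw [f₃.nat cBh rfl, f₂.nat cBh rfl]
  have ebi : s₃.nat cBi 0 = bi := by rw [f₃.nat cBi rfl, f₂.nat cBi rfl]
  have eT : s₃.nat aTree = s.nat aTree := by
    rw [f₃.nat aTree rfl, f₂.nat aTree rfl, f₁.nat aTree rfl]
  have eP : s₃.nat aPar = s.nat aPar := by
    rw [f₃.nat aPar rfl, f₂.nat aPar rfl, f₁.nat aPar rfl]
  have eX : s₃.nat aX = s.nat aX := by rw [f₃.nat aX rfl, f₂.nat aX rfl, f₁.nat aX rfl]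
  have eL : s₃.nat aLd = s.nat aLd := by rw [f₃.nat aLd rfl, f₂.nat aLd rfl, f₁.nat aLd rfl]
  have eC : s₃.nat aCap = s.nat aCap := by
    rw [f₃.nat aCap rfl, f₂.nat aCap rfl, f₁.nat aCap rfl]
  have eO : s₃.nat aOl = s.nat aOl := by rw [f₃.nat aOl rfl, f₂.nat aOl rfl, f₁.nat aOl rfl]
  have eR : s₃.nat aRow = s.nat aRow := by
    rw [f₃.nat aRow rfl, f₂.nat aRow rfl, f₁.nat aRow rfl]
  have e0 : s₃.nat 0 = s.nat 0 := by rw [f₃.nat 0 rfl, f₂.nat 0 rfl, f₁.nat 0 rfl]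
  have eF : s₃.nat cFound = s.nat cFound := by
    rw [f₃.nat cFound rfl, f₂.nat cFound rfl, f₁.nat cFound rfl]
  have em : s₃.nat cLen 0 = m := by rw [f₃.nat cLen rfl, f₂.nat cLen rfl, f₁.nat cLen rfl]
  have en : s₃.nat cNC 0 = n := by rw [f₃.nat cNC rfl, f₂.nat cNC rfl, f₁.nat cNC rfl]
  have eD : s₃.real rDist = s.real rDist := by
    rw [f₃.real rDist rfl, f₂.real rDist rfl, f₁.real rDist rfl]
  set δ := s₁.real rSl 0 with hδ_def
  have ep : ∀ h < m, s₃.real rPi h =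
      if 1 ≤ s.nat aTree h then s.real rPi h + δ else s.real rPi h := by
    intro h hh
    rw [f₃.real rPi rfl, h₂ h hh, f₁.real rPi rfl]
  have ev : ∀ i < n, s₃.real rV i =
      if 1 ≤ s.nat aTree (s.nat aX i) then s.real rV i + δ else s.real rV i := by
    intro i hi
    rw [h₃ i hi, f₂.real rV rfl, f₁.real rV rfl, f₂.real rSl rfl]
  have hδ0 : 0 ≤ δ := by
    rw [hd]
    have := hD.low bi hbi bh hbh
    simp only [State.slack]; linarith
  have hD' := Dual.raise hD hδ0 hsat ep ev
    (fun i hi h hh h1 h2 => hmin i h ⟨hi, hh⟩ ⟨h1, h2⟩)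
  have hK' := Tree.grow hD hK ep ev hbi hbh hL.1 hL.2 (by rw [hd]; rfl) hrk hrm
  have hcard : ((Finset.range m).filter fun h => 1 ≤ Function.update (s.nat aTree) bh 1 h).card
      = r + 1 := by
    rw [← hr, ← Finset.card_insert_of_notMem (a := bh)
      (s := (Finset.range m).filter fun h => 1 ≤ s.nat aTree h)]
    · congr 1
      ext h
      simp only [Finset.mem_filter, Finset.mem_range, Finset.mem_insert, Function.update_apply]
      split_ifs with hb
      · simp [hb, hbh]
      · simp [hb]
    · have := hL.2; simp [this]
  have hmne : m ≠ bh := hbh.ne'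
  simp only [Prog.den, Test.Holds, NExp.eval]
  simp only [ne_eq, Nat.reduceEqDiff, not_false_eq_true, State.putNat_nat_ne, ebh, ebi,
    eC, eO, eL, not_le]
  split_ifs with hs
  · refine ⟨?_, ⟨Function.update rk bh (r + 1), ?_, ?_⟩, ?_, ?_⟩
    · simpa [State.IsDual, State.dist_eq, eX, eL, eC, eO, eR, e0, em, en, eD, eT, eP, ← hn, ← hm] using hD'
    · simpa [State.IsTree, State.dist_eq, eX, eL, eC, eO, eR, e0, em, en, eD, eT, eP, ← hn, ← hm] using hK'
    · intro h hh
      rw [Function.update_apply]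
      split_ifs
      · exact le_rfl
      · exact (hrk h (by simpa [em] using hh)).trans (Nat.le_succ r)
    · simpa [em, eT] using hcard
    · right
      simp [em, ebh, eC, eO, eL, hbh, hs]
  · refine ⟨?_, ⟨Function.update rk bh (r + 1), ?_, ?_⟩, ?_, ?_⟩
    · simpa [State.IsDual, State.dist_eq, eX, eL, eC, eO, eR, e0, em, en, eD, eT, eP, ← hn, ← hm] using hD'
    · simpa [State.IsTree, State.dist_eq, eX, eL, eC, eO, eR, e0, em, en, eD, eT, eP, ← hn, ← hm] using hK'
    · intro h hh
      rw [Function.update_apply]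
      split_ifs
      · exact le_rfl
      · exact (hrk h (by simpa [em] using hh)).trans (Nat.le_succ r)
    · simpa [em, eT] using hcard
    · left
      refine ⟨by simp [eF, h0], fun h hh hT => ?_⟩
      simp only [ne_eq, Nat.reduceEqDiff, not_false_eq_true, State.putNat_nat_ne,
        State.putNat_nat_self, eL, eC, eO, eT, em] at hh hT ⊢
      by_cases hb : h = bh
      · rw [hb]; exact hs
      · rw [Function.update_of_ne hb] at hT
        exact hsat h hh hT

/-- The rank of the current facility falls with every move, which bounds the number of moves. `ld`
is a parameter because the load array in the memory has already been incremented when the path is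
followed. -/
theorem moveClients_runs {s : State} {rk : ℕ → ℕ} {h₀ B : ℕ} {cap ld : ℕ → ℕ}
    (hD : Dual (s.nat cNC 0) (s.nat cLen 0) s.dist cap (s.nat aX) ld (s.real rPi) (s.real rV))
    (hK : s.IsTree rk)
    (hbh : s.nat cBh 0 = h₀) (hh : h₀ < s.nat cLen 0) (hT : 1 ≤ s.nat aTree h₀)
    (hB : s.nat cLen 0 + 1 ≤ B) :
    Runs (.loop (.not (natEq (nv cBh) (nv cLen))) moveClient) s (fun s' =>
      Augment (s.nat cNC 0) (s.nat cLen 0) s.dist (s.nat aX) (s'.nat aX) (s.nat aTree) (s.real rPi)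
        (s.real rV) rk h₀ (s.nat cLen 0)) (B * 60) := by
  refine (Runs.loop (s.nat cLen 0) 40 (fun i s' => Augment (s.nat cNC 0) (s.nat cLen 0) s.dist
    (s.nat aX) (s'.nat aX) (s.nat aTree) (s.real rPi) (s.real rV) rk h₀ (s'.nat cBh 0) ∧
      rk (s'.nat cBh 0) + i ≤ s.nat cLen 0) ?_ ?_).mono ?_ ?_
  · rw [hbh]
    exact ⟨⟨hD.le, hD.tight, hh.le, hT, fun _ => rfl, fun _ _ _ => rfl⟩, hK.rk_le _ hh.le⟩
  · rintro i s' hf ⟨hA, hi⟩ hb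
    have hne : s'.nat cBh 0 ≠ s.nat cLen 0 := by
      simp only [Test.Holds, NExp.eval] at hb
      rw [hf.nat cLen rfl] at hb
      omega
    obtain ⟨hA', hlt⟩ := Augment.step hD hK hA hne
    refine ⟨by omega, Runs.of_flat rfl (by decide) ?_⟩
    have e : s'.nat aPar = s.nat aPar := hf.nat aPar rfl
    simp only [moveClient, Prog.den, NExp.eval, ne_eq, Nat.reduceEqDiff, not_false_eq_true,
      State.putNat_nat_ne, State.putNat_nat_self, Function.update_self, e]
    exact ⟨hA', by omega⟩
  · rintro s' ⟨⟨i, hA, -⟩, hb⟩ hf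
    have : s'.nat cBh 0 = s.nat cLen 0 := by
      simp only [Test.Holds, NExp.eval] at hb
      rw [hf.nat cLen rfl] at hb
      omega
    rwa [this] at hA
  · simp only [Test.cost, NExp.cost]; nlinarith

/-- The invariant of the computation of an optimal assignment when `a` clients are assigned. -/
def HungarianInv (a : ℕ) (s : State) : Prop :=
  s.IsDual ∧ load (s.nat cNC 0) (s.nat aX) (s.nat cLen 0) + a = s.nat cNC 0

theorem assignOne_runs {s : State} {a B : ℕ} (hI : HungarianInv a s) (ha : a < s.nat cNC 0)
    (hcap : s.nat cNC 0 ≤ ∑ j ∈ Finset.range (s.nat cLen 0), s.nat aCap (s.nat aOl j))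
    (hB : s.nat cNC 0 + 1 ≤ B) (hB' : s.nat cLen 0 + 1 ≤ B) :
    Runs assignOne s (HungarianInv (a + 1)) (B * (B * (B * 120 + 200) + 200)) := by
  obtain ⟨hD, hl⟩ := hI
  set n := s.nat cNC 0 with hn
  set m := s.nat cLen 0 with hm
  refine (Runs.fillNat (n := m) (fun _ => 0) hm.symm (by decide) (by decide) (by decide)
    (fun _ _ _ _ _ => rfl)).seq (T₂ := B * (B * (B * 120 + 200) + 170)) ?_
    (by simp only [NExp.cost]; nlinarith)
  intro s₁ h₁ f₁
  refine (Runs.of_flat (T := 10) (Q := fun s' => s' = s₁.putNat aTree m 1) rfl (by decide)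
    ?_).seq (T₂ := B * (B * (B * 120 + 200) + 160)) ?_ ?_
  · simp only [Prog.den, NExp.eval]
    rw [f₁.nat cLen rfl]
  swap
  · nlinarith [Nat.one_le_iff_ne_zero.2 (show B ≠ 0 by omega)]
  rintro s₂ rfl f₂
  refine (Runs.of_flat (T := 10) (Q := fun s' => s' = (s₁.putNat aTree m 1).putNat cFound 0 0) rfl
    (by decide) rfl).seq (T₂ := B * (B * (B * 120 + 200) + 150)) ?_ ?_
  swap
  · nlinarith [Nat.one_le_iff_ne_zero.2 (show B ≠ 0 by omega)]
  rintro s₃ hs₃ f₃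
  have e : ∀ x, x ≠ cJ → x ≠ aTree → x ≠ cFound → s₃.nat x = s.nat x := by
    intro x h1 h2 h3
    rw [hs₃, State.putNat_nat_ne _ _ _ _ _ h3, State.putNat_nat_ne _ _ _ _ _ h2, f₁.nat]
    simp [Prog.writesNat, h1, h2]
  have e' : s₃.real = s.real := by
    rw [hs₃]
    ext x : 1
    exact f₁.real x rfl
  have ed : s₃.dist = s.dist := by
    simp only [State.dist_eq, e', e 0 (by decide) (by decide) (by decide),
      e aRow (by decide) (by decide) (by decide), e aOl (by decide) (by decide) (by decide)]
  have eT : s₃.nat aTree = Function.update (s₁.nat aTree) m 1 := by rw [hs₃]; simp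
  have en : s₃.nat cNC 0 = n := by rw [e] <;> decide
  have em : s₃.nat cLen 0 = m := by rw [e] <;> decide
  have eF : s₃.nat cFound 0 = 0 := by rw [hs₃]; simp
  have hD₃ : s₃.IsDual := by
    rw [State.IsDual, e', ed]
    simpa only [State.IsDual, e, ne_eq, Nat.reduceEqDiff, not_false_eq_true] using hD
  have hT0 : ∀ h < m, ¬ 1 ≤ s₃.nat aTree h := by
    intro h hh
    rw [eT, Function.update_of_ne hh.ne, h₁]
    simp [hh]
  -- Only the root `m` is marked, and it is not among the facilities counted by `r`.
  have hI₀ : TreeInv 0 s₃ := by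
    refine ⟨hD₃, ⟨fun _ => 0, ⟨?_, fun _ _ => Nat.zero_le _, ?_⟩, fun _ _ => le_rfl⟩, ?_, ?_⟩
    · rw [em, eT]; simp
    · intro h hh hT
      exact absurd hT (hT0 h (em ▸ hh))
    · rw [Finset.card_eq_zero, Finset.filter_eq_empty_iff]
      intro h hh
      exact hT0 h (em ▸ Finset.mem_range.1 hh)
    · left
      exact ⟨eF, fun h hh hT => absurd hT (hT0 h (em ▸ hh))⟩
  have hun : ∃ i < n, s.nat aX i = m := by
    have : 0 < load n (s.nat aX) m := by omega
    obtain ⟨i, hi⟩ := Finset.card_pos.1 this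
    exact ⟨i, by simpa using hi⟩
  -- The loop index is the number of facilities in the tree, so `m` bounds the rounds.
  refine (Runs.loop m (B * (B * 120 + 200)) TreeInv hI₀ ?_).seq (T₂ := B * 80) ?_ ?_
  · intro r s' hf hI hb
    have := growTree_runs (B := B) hI (by simpa [Test.Holds, NExp.eval] using hb)
      (by simpa only [hf.nat cNC rfl, hf.nat aX rfl, hf.nat cLen rfl, e, ne_eq, Nat.reduceEqDiff,
        not_false_eq_true] using hun)
      (by simpa only [hf.nat cNC rfl, hf.nat aCap rfl, hf.nat aOl rfl, hf.nat cLen rfl, e, ne_eq,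
        Nat.reduceEqDiff, not_false_eq_true] using hcap)
      (by rw [hf.nat cNC rfl, en]; exact hB) (by rw [hf.nat cLen rfl, em]; exact hB')
    rwa [hf.nat cLen rfl, em] at this
  swap
  · simp only [Test.cost, NExp.cost]
    nlinarith [Nat.mul_le_mul hB' (le_refl (B * (B * 120 + 200) + 4))]
  rintro s₄ ⟨⟨r, hI⟩, hb⟩ f₄
  obtain ⟨hD₄, ⟨rk, hK₄, -⟩, -, h | ⟨-, hlt, hT, hs⟩⟩ := hI
  · simp [Test.Holds, NExp.eval, h.1] at hb
  have em₄ : s₄.nat cLen 0 = m := by rw [f₄.nat cLen rfl, em]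
  have en₄ : s₄.nat cNC 0 = n := by rw [f₄.nat cNC rfl, en]
  refine (Runs.of_flat (T := 10) (Q := fun s' => s' = s₄.putNat aLd (s₄.nat cBh 0)
    (s₄.nat aLd (s₄.nat cBh 0) + 1)) rfl (by decide) rfl).seq (T₂ := B * 60) ?_ ?_
  swap
  · nlinarith [Nat.one_le_iff_ne_zero.2 (show B ≠ 0 by omega)]
  rintro s₅ hs₅ f₅
  have e₅ : ∀ x, x ≠ aLd → s₅.nat x = s₄.nat x := by
    intro x h1
    rw [hs₅, State.putNat_nat_ne _ _ _ _ _ h1]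
  have e₅' : s₅.real = s₄.real := by rw [hs₅]; rfl
  have ed₅ : s₅.dist = s₄.dist := by
    simp only [State.dist_eq, e₅', e₅ 0 (by decide), e₅ aRow (by decide), e₅ aOl (by decide)]
  refine (moveClients_runs (s := s₅) (rk := rk) (B := B) (h₀ := s₄.nat cBh 0)
    (cap := fun h => s₄.nat aCap (s₄.nat aOl h)) (ld := s₄.nat aLd) ?_ ?_ ?_ ?_ ?_ ?_).mono ?_ le_rfl
  · simpa only [State.IsDual, ed₅, e₅', e₅, ne_eq, Nat.reduceEqDiff, not_false_eq_true] using hD₄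
  · simpa only [State.IsTree, ed₅, e₅', e₅, ne_eq, Nat.reduceEqDiff, not_false_eq_true] using hK₄
  · rw [e₅ _ (by decide)]
  · rwa [e₅ _ (by decide)]
  · rwa [e₅ _ (by decide)]
  · rw [e₅ _ (by decide), em₄]; exact hB'
  intro s' hA f'
  have g : s'.nat aLd = Function.update (s₄.nat aLd) (s₄.nat cBh 0)
      (s₄.nat aLd (s₄.nat cBh 0) + 1) := by
    rw [f'.nat aLd rfl, hs₅]; simp
  have gd : s'.dist = s₄.dist := by
    simp only [State.dist_eq, f'.nat 0 rfl, f'.nat aRow rfl, f'.nat aOl rfl, f'.real rDist rfl, e₅',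
      e₅ 0 (by decide), e₅ aRow (by decide), e₅ aOl (by decide)]
  have gm : s'.nat cLen 0 = s₄.nat cLen 0 := by rw [f'.nat cLen rfl, e₅ _ (by decide)]
  have gn : s'.nat cNC 0 = s₄.nat cNC 0 := by rw [f'.nat cNC rfl, e₅ _ (by decide)]
  have hA' : Augment (s₄.nat cNC 0) (s₄.nat cLen 0) s₄.dist (s₄.nat aX) (s'.nat aX) (s₄.nat aTree)
      (s₄.real rPi) (s₄.real rV) rk (s₄.nat cBh 0) (s₄.nat cLen 0) := by
    simpa only [ed₅, e₅', e₅, ne_eq, Nat.reduceEqDiff, not_false_eq_true] using hA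
  obtain ⟨hD', hl'⟩ := Dual.augment hD₄ hA' hlt hs
  refine ⟨?_, ?_⟩
  · rw [State.IsDual, g, gd, gm, gn, f'.nat aCap rfl, f'.nat aOl rfl, f'.real rPi rfl,
      f'.real rV rfl, e₅', e₅ aCap (by decide), e₅ aOl (by decide)]
    exact hD'
  · rw [gm, gn, em₄, en₄]
    rw [em₄, en₄, f₄.nat aX rfl, e aX (by decide) (by decide) (by decide)] at hl'
    omega

/-- With all clients unassigned, zero prices and values satisfy the dual conditions because
distances are nonnegative. The exponent 4 counts the nested loops: phases, rounds of growth,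
clients, facilities. -/
theorem hungarian_runs {s : State} {B : ℕ}
    (hcap : s.nat cNC 0 ≤ ∑ j ∈ Finset.range (s.nat cLen 0), s.nat aCap (s.nat aOl j))
    (hpos : ∀ i < s.nat cNC 0, ∀ h < s.nat cLen 0, 0 ≤ s.dist i h)
    (hB : s.nat cNC 0 + 1 ≤ B) (hB' : s.nat cLen 0 + 1 ≤ B) :
    Runs hungarian s (fun s' => (∀ i < s.nat cNC 0, s'.nat aX i < s.nat cLen 0) ∧
      (∀ j < s.nat cLen 0, load (s.nat cNC 0) (s'.nat aX) j ≤ s.nat aCap (s.nat aOl j)) ∧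
      ∀ Y : ℕ → ℕ, (∀ i < s.nat cNC 0, Y i < s.nat cLen 0) →
        (∀ j < s.nat cLen 0, load (s.nat cNC 0) Y j ≤ s.nat aCap (s.nat aOl j)) →
        ∑ i ∈ Finset.range (s.nat cNC 0), s.dist i (s'.nat aX i) ≤
          ∑ i ∈ Finset.range (s.nat cNC 0), s.dist i (Y i)) (1000 * B ^ 4) := by
  set n := s.nat cNC 0 with hn
  set m := s.nat cLen 0 with hm
  have hB0 : 1 ≤ B := by omega
  refine (Runs.fillReal (n := m) (fun _ => 0) hm.symm (by decide) (fun _ _ _ _ _ => by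
    simp [RExp.eval])).seq (T₂ := B * (B * (B * (B * 120 + 200) + 200)) + B * 200) ?_ ?_
  swap
  · simp only [RExp.cost]
    have h1 : B ≤ B ^ 4 := by nlinarith [Nat.pow_le_pow_right hB0 (show 1 ≤ 4 by norm_num)]
    have h2 : B ^ 2 ≤ B ^ 4 := Nat.pow_le_pow_right hB0 (by norm_num)
    have h3 : B ^ 3 ≤ B ^ 4 := Nat.pow_le_pow_right hB0 (by norm_num)
    nlinarith
  intro s₁ h₁ f₁
  refine (Runs.fillNat (n := m) (fun _ => 0) (f₁.nat cLen rfl ▸ rfl) (by decide) (by decide)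
    (by decide) (fun _ _ _ _ _ => rfl)).seq
    (T₂ := B * (B * (B * (B * 120 + 200) + 200)) + B * 150) ?_ (by simp only [NExp.cost]; nlinarith)
  intro s₂ h₂ f₂
  refine (Runs.fillReal (n := n) (fun _ => 0) (by rw [f₂.nat cNC rfl, f₁.nat cNC rfl]) (by decide)
    (fun _ _ _ _ _ => by simp [RExp.eval])).seq
    (T₂ := B * (B * (B * (B * 120 + 200) + 200)) + B * 100) ?_ (by simp only [RExp.cost]; nlinarith)
  intro s₃ h₃ f₃
  have em₃ : s₃.nat cLen 0 = m := by rw [f₃.nat cLen rfl, f₂.nat cLen rfl, f₁.nat cLen rfl]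
  have en₃ : s₃.nat cNC 0 = n := by rw [f₃.nat cNC rfl, f₂.nat cNC rfl, f₁.nat cNC rfl]
  refine (Runs.fillNat (n := n) (fun _ => m) en₃ (by decide) (by decide) (by decide)
    (fun i hi s' hf _ => ?_)).seq
    (T₂ := B * (B * (B * (B * 120 + 200) + 200)) + B * 50) ?_ (by simp only [NExp.cost]; nlinarith)
  · simp only [NExp.eval]; rw [hf.nat cLen rfl, em₃]
  intro s₄ h₄ f₄
  have e : ∀ x, x ≠ cJ → x ≠ cI → x ≠ aLd → x ≠ aX → s₄.nat x = s.nat x := by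
    intro x h1 h2 h3 h4
    rw [f₄.nat x, f₃.nat x, f₂.nat x, f₁.nat x] <;> simp [Prog.writesNat, h1, h2, h3, h4]
  have er : s₄.real rDist = s.real rDist := by
    rw [f₄.real _ rfl, f₃.real _ rfl, f₂.real _ rfl, f₁.real _ rfl]
  have ed : s₄.dist = s.dist := by
    rw [State.dist_eq, State.dist_eq, er, e 0, e aRow, e aOl] <;> decide
  have en : s₄.nat cNC 0 = n := by rw [e] <;> decide
  have em : s₄.nat cLen 0 = m := by rw [e] <;> decide
  have eO : s₄.nat aOl = s.nat aOl := by rw [e] <;> decide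
  have eC : s₄.nat aCap = s.nat aCap := by rw [e] <;> decide
  have eX : ∀ i < n, s₄.nat aX i = m := fun i hi => by rw [h₄]; simp [hi]
  have eL : ∀ j < m, s₄.nat aLd j = 0 := fun j hj => by
    rw [f₄.nat aLd rfl, f₃.nat aLd rfl, h₂]; simp [hj]
  have eP : ∀ j < m, s₄.real rPi j = 0 := fun j hj => by
    rw [f₄.real rPi rfl, f₃.real rPi rfl, f₂.real rPi rfl, h₁]; simp [hj]
  have eV : ∀ i < n, s₄.real rV i = 0 := fun i hi => by
    rw [f₄.real rV rfl, h₃]; simp [hi]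
  have hI₀ : HungarianInv 0 s₄ := by
    refine ⟨⟨?_, ?_, ?_, ?_, ?_, ?_, ?_⟩, ?_⟩ <;> simp only [en, em, ed, eC, eO]
    · exact fun i hi => (eX i hi).le
    · intro i hi h hh
      rw [eV i hi, eP h hh, add_zero]
      exact hpos i hi h hh
    · intro i hi h
      exact absurd (eX i hi) h.ne
    · intro j hj
      rw [eL j hj, eq_comm, load, Finset.card_eq_zero, Finset.filter_eq_empty_iff]
      intro i hi
      rw [eX i (Finset.mem_range.1 hi)]
      exact hj.ne'
    · intro j hj; rw [eL j hj]; exact Nat.zero_le _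
    · intro j hj; rw [eP j hj]
    · intro j hj _; exact eP j hj
    · rw [load, Finset.filter_true_of_mem, Finset.card_range, add_zero]
      exact fun i hi => eX i (Finset.mem_range.1 hi)
  refine (Runs.forN (n := n) (T := B * (B * (B * 120 + 200) + 200)) (Inv := HungarianInv) en rfl
    rfl ?_ ?_).mono ?_
    (by nlinarith [Nat.mul_le_mul hB (le_refl (B * (B * (B * 120 + 200) + 200) + 15))])
  · simpa [HungarianInv, State.IsDual, State.dist_eq] using hI₀
  · intro a ha s' hf _ hI
    refine (assignOne_runs (B := B) hI ?_ ?_ ?_ ?_).mono ?_ le_rfl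
    · rw [hf.nat cNC rfl, en]; exact ha
    · rw [hf.nat cNC rfl, en, hf.nat cLen rfl, em, hf.nat aCap rfl, eC, hf.nat aOl rfl, eO]
      exact hcap
    · rw [hf.nat cNC rfl, en]; exact hB
    · rw [hf.nat cLen rfl, em]; exact hB'
    · intro s'' h _
      simpa [HungarianInv, State.IsDual, State.dist_eq] using h
  · rintro s' ⟨hD, hl⟩ hf
    have gd : s'.dist = s.dist := by
      rw [← ed, State.dist_eq, State.dist_eq, hf.real rDist rfl, hf.nat 0 rfl, hf.nat aRow rfl,
        hf.nat aOl rfl]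
    rw [State.IsDual, hf.nat cNC rfl, en, hf.nat cLen rfl, em, hf.nat aCap rfl, eC, hf.nat aOl rfl,
      eO, gd] at hD
    rw [hf.nat cNC rfl, en, hf.nat cLen rfl, em] at hl
    -- After `n` phases `hl` says that the dummy facility `m` has load 0.
    have hX : ∀ i < n, s'.nat aX i < m := by
      intro i hi
      refine lt_of_le_of_ne (hD.le i hi) fun h => ?_
      have : 0 < load n (s'.nat aX) m := Finset.card_pos.2 ⟨i, by simp [hi, h]⟩
      omega
    refine ⟨hX, fun j hj => ?_, fun Y hY hYc => hD.optimal hX hY hYc⟩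
    rw [← hD.ld_eq j hj]
    exact hD.ld_le j hj

end RealRAM

/-! ### Distances in a centered graph -/

namespace CKM

section Metric

variable {V : Type} {d : V → V → ℝ} {G : SimpleGraph V} {w : Sym2 V → ℝ}

theorem InducedBy.symm (h : InducedBy d G w) (x y : V) : d x y = d y x := by
  have key : ∀ x y, d x y ≤ d y x := by
    intro x y
    obtain ⟨p, hp⟩ := (h y x).1
    rw [hp]
    refine (h x y).2 ⟨p.reverse, ?_⟩
    simp [SimpleGraph.Walk.edges_reverse, List.sum_reverse]
  exact le_antisymm (key x y) (key y x)

theorem InducedBy.triangle (h : InducedBy d G w) (x y z : V) : d x z ≤ d x y + d y z := by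
  obtain ⟨p, hp⟩ := (h x y).1
  obtain ⟨q, hq⟩ := (h y z).1
  rw [hp, hq]
  exact (h x z).2 ⟨p.append q, by simp [SimpleGraph.Walk.edges_append]⟩

theorem InducedBy.nonneg (h : InducedBy d G w) (hw : ∀ e ∈ G.edgeSet, 0 ≤ w e) (x y : V) :
    0 ≤ d x y := by
  obtain ⟨p, hp⟩ := (h x y).1
  rw [hp]
  refine List.sum_nonneg fun r hr => ?_
  obtain ⟨e, he, rfl⟩ := List.mem_map.1 hr
  exact hw e (p.edges_subset_edgeSet he)

theorem InducedBy.self (h : InducedBy d G w) (hw : ∀ e ∈ G.edgeSet, 0 ≤ w e) (x : V) :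
    d x x = 0 :=
  le_antisymm ((h x x).2 ⟨.nil, by simp⟩) (h.nonneg hw x x)

/-- A nonempty walk from `f` starts with the only edge at `f`, and the rest is a walk from `y`. The
empty walk is the reason for excluding `x = f`. -/
theorem InducedBy.eq_add_of_neighborSet (h : InducedBy d G w) {f y : V}
    (hf : G.neighborSet f = {y}) {x : V} (hx : f ≠ x) : d f x = w s(f, y) + d y x := by
  have hadj : G.Adj f y := by
    rw [← SimpleGraph.mem_neighborSet, hf]; rfl
  refine le_antisymm ?_ ?_
  · obtain ⟨p, hp⟩ := (h y x).1
    rw [hp]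
    exact (h f x).2 ⟨.cons hadj p, by simp⟩
  · obtain ⟨p, hp⟩ := (h f x).1
    cases p with
    | nil => exact absurd rfl hx
    | @cons _ z _ hz q =>
      obtain rfl : z = y := by
        have : z ∈ G.neighborSet f := hz
        rwa [hf] at this
      rw [hp]
      simpa using (h z x).2 ⟨q, rfl⟩

end Metric

variable {I : CKM} {ℓ : ℕ}

theorem IsCentered.dist_nonneg (h : I.IsCentered ℓ) (x y : I.Node) : 0 ≤ I.d x y := by
  obtain ⟨-, G, w, hw, -, -, -, hd⟩ := h
  exact hd.nonneg hw x y

/-- A shortest walk from `f` to the client passes through the neighbor `s` of `f`. A nearest center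
`σ` may differ from `s`, but then `s` and `σ` are at distance 0 and the detour through `σ` is free.
So nearest centers, which can be read off from the matrix, replace the unknown graph. -/
theorem IsCentered.nearest_add_le (h : I.IsCentered ℓ) {f : Fin I.nF} {σ : Fin I.nS}
    (hσ : ∀ s, I.d (I.facility f) (I.center σ) ≤ I.d (I.facility f) (I.center s))
    (c : Fin I.nC) :
    I.d (I.facility f) (I.center σ) + I.d (I.client c) (I.center σ) ≤
      I.d (I.client c) (I.facility f) := by
  obtain ⟨-, G, w, hw, -, hF, -, hd⟩ := h
  obtain ⟨s, hs⟩ := hF f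
  have h1 := hd.eq_add_of_neighborSet hs (x := I.center s) (by simp)
  have h2 := hd.eq_add_of_neighborSet hs (x := I.center σ) (by simp)
  have h3 := hd.eq_add_of_neighborSet hs (x := I.client c) (by simp)
  have h4 := hσ s
  have h5 := hd.self hw (I.center s)
  have h6 := hd.triangle (I.client c) (I.center s) (I.center σ)
  rw [hd.symm (I.client c) (I.facility f)]
  have h7 := hd.symm (I.client c) (I.center s)
  linarith

/-- Go from the client to `σ`, which saves the leg between `σ` and `f`, and on to `g`. -/
theorem IsCentered.dist_le_of_nearest_eq (h : I.IsCentered ℓ) {f g : Fin I.nF} {σ : Fin I.nS}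
    (hσ : ∀ s, I.d (I.facility f) (I.center σ) ≤ I.d (I.facility f) (I.center s))
    (c : Fin I.nC) :
    I.d (I.client c) (I.facility g) ≤ I.d (I.client c) (I.facility f) -
      I.d (I.facility f) (I.center σ) + I.d (I.facility g) (I.center σ) := by
  have h1 := h.nearest_add_le hσ c
  obtain ⟨-, G, w, hw, -, -, -, hd⟩ := h
  have h2 := hd.triangle (I.client c) (I.center σ) (I.facility g)
  rw [hd.symm (I.center σ)] at h2
  linarith

theorem IsCentered.nearest_le (h : I.IsCentered ℓ) {f : Fin I.nF} {σ : Fin I.nS}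
    (hσ : ∀ s, I.d (I.facility f) (I.center σ) ≤ I.d (I.facility f) (I.center s))
    (c : Fin I.nC) : I.d (I.facility f) (I.center σ) ≤ I.d (I.client c) (I.facility f) := by
  have h1 := h.nearest_add_le hσ c
  have h2 := h.dist_nonneg (I.client c) (I.center σ)
  linarith

theorem IsCentered.nS_pos (h : I.IsCentered ℓ) (hI : 2 ≤ I.size) : 0 < I.nS := by
  obtain ⟨-, G, w, -, -, hF, hC, -⟩ := h
  by_cases hf : 0 < I.nF
  · obtain ⟨s, -⟩ := hF ⟨0, hf⟩; exact s.pos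
  · obtain ⟨s, -⟩ := hC ⟨0, by rw [size] at hI; omega⟩; exact s.pos

end CKM

/-! ### Rounding -/

/-- Origin of the 10: `log (1 + ε/2) ≥ ε/3` and `log (2n/ε) ≤ 2 log (n/ε)` bound the quotient of
logarithms by `6 · (1/ε) log (n/ε)`. Rounding up and the `+ 1` add at most 2, which is below `4 ·
(1/ε) log (n/ε)` because `n/ε ≥ 2` and `ε ≤ 1`. -/
theorem exists_class_bound {n : ℕ} {ε : ℝ} (hn : 2 ≤ n) (h0 : 0 < ε) (h1 : ε ≤ 1) :
    ∃ L : ℕ, (n : ℝ) ≤ ε / 2 * (1 + ε / 2) ^ L ∧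
      (L : ℝ) + 1 ≤ 10 * (1 / ε * Real.log (n / ε)) := by
  have hn' : (2 : ℝ) ≤ n := by exact_mod_cast hn
  have hx2 : 2 ≤ (n : ℝ) / ε := by rw [le_div_iff₀ h0]; linarith
  set a := Real.log ((n : ℝ) / ε) with ha
  have hlog2 : (0.6931471803 : ℝ) < Real.log 2 := Real.log_two_gt_d9
  have ha2 : Real.log 2 ≤ a := Real.log_le_log (by norm_num) hx2
  have hq : ε / 3 ≤ Real.log (1 + ε / 2) := by
    have := Real.one_sub_inv_le_log_of_pos (show (0 : ℝ) < 1 + ε / 2 by linarith)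
    refine le_trans ?_ this
    rw [le_sub_iff_add_le, ← le_sub_iff_add_le', inv_le_iff_one_le_mul₀ (by linarith)]
    nlinarith
  have hq0 : 0 < Real.log (1 + ε / 2) := by linarith [div_pos h0 (show (0 : ℝ) < 3 by norm_num)]
  have hla : Real.log (n / (ε / 2)) ≤ 2 * a := by
    rw [show (n : ℝ) / (ε / 2) = 2 * (n / ε) by field_simp, Real.log_mul (by norm_num)
      (by positivity)]
    linarith
  refine ⟨⌈Real.log (n / (ε / 2)) / Real.log (1 + ε / 2)⌉₊, ?_, ?_⟩
  · have h2 := Nat.le_ceil (Real.log (n / (ε / 2)) / Real.log (1 + ε / 2))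
    set L := ⌈Real.log (n / (ε / 2)) / Real.log (1 + ε / 2)⌉₊
    rw [div_le_iff₀ hq0, ← Real.log_pow] at h2
    have h3 := (Real.log_le_log_iff (by positivity) (by positivity)).1 h2
    rw [div_le_iff₀ (by positivity)] at h3
    linarith
  · have h2 : Real.log (n / (ε / 2)) / Real.log (1 + ε / 2) ≤ 6 * (1 / ε * a) := by
      rw [div_le_iff₀ hq0]
      have : 2 * a = 6 * (1 / ε * a) * (ε / 3) := by field_simp; ring
      refine hla.trans (this.le.trans ?_)
      refine mul_le_mul_of_nonneg_left hq ?_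
      have : 0 ≤ a := by linarith
      positivity
    have h3 := (Nat.ceil_lt_add_one (a := Real.log (n / (ε / 2)) / Real.log (1 + ε / 2)) (by
      refine div_nonneg (Real.log_nonneg ?_) hq0.le
      rw [le_div_iff₀ (by positivity)]; linarith)).le
    have h4 : a ≤ 1 / ε * a := by
      have : 1 ≤ 1 / ε := by rw [le_div_iff₀ h0]; linarith
      nlinarith
    linarith

/-- Digit 0 is the most significant one, to match the order in which `nextDigit` splits digits off.
-/
theorem exists_digits {M K : ℕ} (dig : ℕ → ℕ) (hdig : ∀ j < K, dig j < M) :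
    ∃ t < M ^ K, ∀ j < K, t / M ^ (K - 1 - j) % M = dig j := by
  induction K with
  | zero => exact ⟨0, by simp, by simp⟩
  | succ K ih =>
    obtain ⟨t, ht, h⟩ := ih fun j hj => hdig j (hj.trans (Nat.lt_succ_self K))
    have hd := hdig K (Nat.lt_succ_self K)
    refine ⟨dig K + M * t, ?_, fun j hj => ?_⟩
    · calc dig K + M * t < M + M * t := by omega
        _ = M * (t + 1) := by ring
        _ ≤ M * M ^ K := Nat.mul_le_mul_left _ ht
        _ = M ^ (K + 1) := by ring
    · rcases Nat.lt_succ_iff_lt_or_eq.1 hj with hj | rfl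
      · rw [show K + 1 - 1 - j = (K - 1 - j) + 1 by omega, pow_succ', ← Nat.div_div_eq_div_mul,
          Nat.add_mul_div_left _ _ (by omega), Nat.div_eq_of_lt hd, zero_add, h j hj]
      · simp [Nat.mod_eq_of_lt hd]

/-! ### Greedy opening -/

open Classical in
/-- Among the numbers below `i` with property `P`, the last one with the largest value of `u`;
`o` if there is none. -/
noncomputable def pick (u : ℕ → ℕ) (P : ℕ → Prop) (o : ℕ) : ℕ → ℕ
  | 0 => o
  | i + 1 => if P i ∧ (o ≤ pick u P o i ∨ u (pick u P o i) ≤ u i) then i else pick u P o i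

/-- Since `i ≤ o`, the default value `o` cannot be confused with an index below `i`; this makes it a
sign of failure. -/
theorem pick_spec (u : ℕ → ℕ) (P : ℕ → Prop) {o i : ℕ} (hi : i ≤ o) :
    (pick u P o i = o ∧ ∀ f < i, ¬ P f) ∨
      (pick u P o i < i ∧ P (pick u P o i) ∧ ∀ f < i, P f → u f ≤ u (pick u P o i)) := by
  induction i with
  | zero => left; exact ⟨rfl, by simp⟩
  | succ i ih =>
    have ih := ih (by omega)
    rw [pick]
    split_ifs with h
    · right
      refine ⟨Nat.lt_succ_self i, h.1, fun f hf hP => ?_⟩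
      rcases Nat.lt_succ_iff_lt_or_eq.1 hf with hf | rfl
      · rcases ih with ⟨-, h'⟩ | ⟨h1, h2, h3⟩
        · exact absurd hP (h' f hf)
        · exact (h3 f hf hP).trans (h.2.resolve_left (by omega))
      · exact le_rfl
    · rcases ih with ⟨h1, h2⟩ | ⟨h1, h2, h3⟩
      · left
        refine ⟨h1, fun f hf hP => ?_⟩
        rcases Nat.lt_succ_iff_lt_or_eq.1 hf with hf | rfl
        · exact h2 f hf hP
        · exact h ⟨hP, Or.inl h1.ge⟩
      · right
        refine ⟨by omega, h2, fun f hf hP => ?_⟩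
        rcases Nat.lt_succ_iff_lt_or_eq.1 hf with hf | rfl
        · exact h3 f hf hP
        · by_contra hlt
          exact h ⟨hP, Or.inr (by omega)⟩

section Greedy

variable (nF : ℕ) (u lab : ℕ → ℕ) (E : ℕ → Prop)

/-- The facility that is opened next for the label `x` if the facilities in `G` are open. -/
noncomputable def nextOpen (G : Finset ℕ) (x : ℕ) : ℕ :=
  pick u (fun f => lab f = x ∧ f ∉ G ∧ E f) nF nF

/-- The facilities that are open after the labels `dig 0`, …, `dig (j - 1)` were treated. -/
noncomputable def greedy (dig : ℕ → ℕ) : ℕ → Finset ℕ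
  | 0 => ∅
  | j + 1 =>
    if nextOpen nF u lab E (greedy dig j) (dig j) < nF then
      insert (nextOpen nF u lab E (greedy dig j) (dig j)) (greedy dig j)
    else greedy dig j

/-- Allows a label to be chosen without disturbing the openings before it. -/
theorem greedy_congr {dig dig' : ℕ → ℕ} {j : ℕ} (h : ∀ i < j, dig i = dig' i) :
    greedy nF u lab E dig j = greedy nF u lab E dig' j := by
  induction j with
  | zero => rfl
  | succ j ih =>
    rw [greedy, greedy, ih fun i hi => h i (by omega), h j (by omega)]

theorem nextOpen_spec (G : Finset ℕ) (x : ℕ) :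
    (nextOpen nF u lab E G x = nF ∧ ∀ f < nF, ¬ (lab f = x ∧ f ∉ G ∧ E f)) ∨
      (nextOpen nF u lab E G x < nF ∧ lab (nextOpen nF u lab E G x) = x ∧
        nextOpen nF u lab E G x ∉ G ∧ E (nextOpen nF u lab E G x) ∧
        ∀ f < nF, lab f = x → f ∉ G → E f → u f ≤ u (nextOpen nF u lab E G x)) := by
  rcases pick_spec u (fun f => lab f = x ∧ f ∉ G ∧ E f) (le_refl nF) with h | ⟨h1, ⟨h2, h3, h4⟩, h5⟩
  · exact Or.inl h
  · exact Or.inr ⟨h1, h2, h3, h4, fun f hf ha hb hc => h5 f hf ⟨ha, hb, hc⟩⟩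

theorem greedy_subset (dig : ℕ → ℕ) (j : ℕ) : ∀ f ∈ greedy nF u lab E dig j, f < nF ∧ E f := by
  induction j with
  | zero => simp [greedy]
  | succ j ih =>
    intro f hf
    rw [greedy] at hf
    split_ifs at hf with h
    · rcases Finset.mem_insert.1 hf with rfl | hf
      · rcases nextOpen_spec nF u lab E (greedy nF u lab E dig j) (dig j) with h' | h'
        · omega
        · exact ⟨h, h'.2.2.2.1⟩
      · exact ih f hf
    · exact ih f hf

theorem card_greedy_le (dig : ℕ → ℕ) (j : ℕ) : (greedy nF u lab E dig j).card ≤ j := by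
  induction j with
  | zero => simp [greedy]
  | succ j ih =>
    rw [greedy]
    split_ifs
    · exact (Finset.card_insert_le _ _).trans (by omega)
    · omega

/-- Every set of facilities can be replaced by facilities of the same labels and of at least the
same capacities that are opened greedily for a suitable sequence of labels. -/
theorem exists_greedy_dominating {M K : ℕ} (hM : 0 < M) {U : Finset ℕ}
    (hU : ∀ f ∈ U, f < nF ∧ E f ∧ lab f < M) (hK : U.card ≤ K) :
    ∃ dig : ℕ → ℕ, (∀ j, dig j < M) ∧ ∃ ψ : ℕ → ℕ, Set.InjOn ψ U ∧
      ∀ f ∈ U, ψ f ∈ greedy nF u lab E dig K ∧ lab (ψ f) = lab f ∧ u f ≤ u (ψ f) := by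
  -- Labels and exchange are adapted one step at a time, so that after `j` greedy openings at most
  -- `U.card - j` of the substitutes are missing.
  have key : ∀ j, ∃ dig : ℕ → ℕ, (∀ j, dig j < M) ∧ ∃ ψ : ℕ → ℕ, Set.InjOn ψ U ∧
      (∀ f ∈ U, ψ f < nF ∧ E (ψ f) ∧ lab (ψ f) = lab f ∧ u f ≤ u (ψ f)) ∧
      ((U.image ψ) \ greedy nF u lab E dig j).card ≤ U.card - j := by
    intro j
    induction j with
    | zero =>
      refine ⟨fun _ => 0, fun _ => hM, id, Set.injOn_id _, fun f hf => ⟨(hU f hf).1, (hU f hf).2.1,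
        rfl, le_rfl⟩, ?_⟩
      simp [greedy]
    | succ j ih =>
      obtain ⟨dig, hdig, ψ, hinj, hψ, hc⟩ := ih
      by_cases hsub : ∀ f ∈ U, ψ f ∈ greedy nF u lab E dig j
      · refine ⟨dig, hdig, ψ, hinj, hψ, ?_⟩
        rw [Finset.card_eq_zero.2 ?_]
        · exact Nat.zero_le _
        rw [Finset.sdiff_eq_empty_iff_subset]
        intro g hg
        obtain ⟨f, hf, rfl⟩ := Finset.mem_image.1 hg
        rw [greedy]
        split_ifs
        · exact Finset.mem_insert_of_mem (hsub f hf)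
        · exact hsub f hf
      push Not at hsub
      obtain ⟨f, hf, hfG⟩ := hsub
      -- The next label is that of a facility whose substitute is still missing.
      set dig' := Function.update dig j (lab f) with hdig'_def
      have hG : greedy nF u lab E dig' j = greedy nF u lab E dig j :=
        greedy_congr nF u lab E fun i hi => by
          rw [hdig'_def, Function.update_of_ne hi.ne]
      have hj : dig' j = lab f := by rw [hdig'_def, Function.update_self]
      set G := greedy nF u lab E dig j with hG_def
      set g := nextOpen nF u lab E G (lab f) with hg_def
      obtain ⟨f1, f2, f3, f4⟩ := hψ f hf
      obtain ⟨hg, hgl, hgG, hgE, hgu⟩ : g < nF ∧ lab g = lab f ∧ g ∉ G ∧ E g ∧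
          ∀ f' < nF, lab f' = lab f → f' ∉ G → E f' → u f' ≤ u g := by
        rcases nextOpen_spec nF u lab E G (lab f) with h | h
        · exact absurd ⟨f3, hfG, f2⟩ (h.2 (ψ f) f1)
        · exact h
      have hG' : greedy nF u lab E dig' (j + 1) = insert g G := by
        rw [greedy, hG, hj, if_pos hg]
      have hdig' : ∀ i, dig' i < M := by
        intro i
        rw [hdig'_def, Function.update_apply]
        split_ifs
        · exact (hU f hf).2.2
        · exact hdig i
      -- Either the newly opened `g` is itself a missing substitute, or it becomes the substitute of
      -- `f`. In the second case the greedy choice gives it at least the capacity of `ψ f`, which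
      -- was also available.
      by_cases hgim : g ∈ U.image ψ
      · refine ⟨dig', hdig', ψ, hinj, hψ, ?_⟩
        rw [hG', Finset.sdiff_insert, Finset.card_erase_of_mem (by simp [hgim, hgG])]
        omega
      · refine ⟨dig', hdig', Function.update ψ f g, ?_, ?_, ?_⟩
        · intro x hx y hy hxy
          rw [Function.update_apply, Function.update_apply] at hxy
          split_ifs at hxy with h1 h2 h2
          · rw [h1, h2]
          · exact absurd (Finset.mem_image.2 ⟨y, hy, hxy.symm⟩) hgim
          · exact absurd (Finset.mem_image.2 ⟨x, hx, hxy⟩) hgim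
          · exact hinj hx hy hxy
        · intro x hx
          rw [Function.update_apply]
          split_ifs with h1
          · subst h1
            exact ⟨hg, hgE, hgl, f4.trans (hgu _ f1 f3 hfG f2)⟩
          · exact hψ x hx
        · rw [hG']
          have hss : (U.image (Function.update ψ f g)) \ insert g G ⊆
              ((U.image ψ) \ G).erase (ψ f) := by
            intro y hy
            simp only [Finset.mem_sdiff, Finset.mem_image, Finset.mem_insert, not_or] at hy
            obtain ⟨⟨x, hx, rfl⟩, hy1, hy2⟩ := hy
            have hxf : x ≠ f := by rintro rfl; simp at hy1
            rw [Function.update_of_ne hxf] at hy1 hy2 ⊢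
            simp only [Finset.mem_erase, Finset.mem_sdiff, Finset.mem_image]
            exact ⟨fun h => hxf (hinj hx hf h), ⟨x, hx, rfl⟩, hy2⟩
          refine (Finset.card_le_card hss).trans ?_
          rw [Finset.card_erase_of_mem (by
            simp only [Finset.mem_sdiff, Finset.mem_image]; exact ⟨⟨f, hf, rfl⟩, hfG⟩)]
          omega
  obtain ⟨dig, hdig, ψ, hinj, hψ, hc⟩ := key K
  refine ⟨dig, hdig, ψ, hinj, fun f hf => ⟨?_, (hψ f hf).2.2.1, (hψ f hf).2.2.2⟩⟩
  have : (U.image ψ) \ greedy nF u lab E dig K = ∅ := Finset.card_eq_zero.1 (by omega)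
  exact Finset.sdiff_eq_empty_iff_subset.1 this (Finset.mem_image_of_mem ψ hf)

end Greedy

/-! ### Opening facilities for a coded sequence of labels -/

namespace RealRAM

/-- An instance of the problem in terms of natural numbers: `C c f` is the distance of client `c`
and facility `f`, and `K` bounds the number of open facilities. -/
structure Problem where
  nF : ℕ
  nC : ℕ
  K : ℕ
  u : ℕ → ℕ
  C : ℕ → ℕ → ℝ

/-- The memory `s` holds the problem `p`. -/
structure State.Has (s : State) (p : Problem) : Prop where
  nF : s.nat 0 0 = p.nF
  nC : s.nat cNC 0 = p.nC
  K : s.nat cK 0 = p.K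
  u : s.nat aCap = p.u
  C : ∀ c f, s.real rDist (s.nat aRow (p.nF + c) + f) = p.C c f

theorem State.Has.of_frame {s s' : State} {p : Problem} (h : s.Has p) {P : Prog}
    (hf : Frame P s s') (hP : (P.writesNat 0 || P.writesNat cNC || P.writesNat cK ||
      P.writesNat aCap || P.writesNat aRow || P.writesReal rDist) = false) : s'.Has p := by
  simp only [Bool.or_eq_false_iff] at hP
  obtain ⟨⟨⟨⟨⟨h0, h1⟩, h2⟩, h3⟩, h4⟩, h5⟩ := hP
  exact ⟨by rw [hf.nat _ h0, h.nF], by rw [hf.nat _ h1, h.nC], by rw [hf.nat _ h2, h.K],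
    by rw [hf.nat _ h3, h.u], fun c f => by rw [hf.nat _ h4, hf.real _ h5, h.C]⟩

/-- The arrays `aOp`, `aOl` present the set `G` of open facilities. -/
structure State.Opens (s : State) (p : Problem) (G : Finset ℕ) : Prop where
  op : ∀ f < p.nF, s.nat aOp f = if f ∈ G then 1 else 0
  image : (Finset.range (s.nat cLen 0)).image (s.nat aOl) = G
  card : s.nat cLen 0 = G.card

theorem State.Opens.mem {s : State} {p : Problem} {G : Finset ℕ} (h : s.Opens p G) {j : ℕ}
    (hj : j < s.nat cLen 0) : s.nat aOl j ∈ G := by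
  rw [← h.image]; exact Finset.mem_image_of_mem _ (Finset.mem_range.2 hj)

theorem State.Opens.injOn {s : State} {p : Problem} {G : Finset ℕ} (h : s.Opens p G) :
    Set.InjOn (s.nat aOl) (Finset.range (s.nat cLen 0)) := by
  rw [← Finset.card_image_iff, h.image, Finset.card_range, h.card]

/-- The power with exponent `K - 1 - j`. -/
abbrev powE : NExp := .read aPw (.sub (.sub (nv cK) (.lit 1)) (nv cJ))

/-- Split off the next digit of the number in `cRem`. -/
def nextDigit : Prog :=
  .setNat cDig (.lit 0) (.lit 0) ;;
  .loop (.natLE powE (nv cRem))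
    (.setNat cRem (.lit 0) (.sub (nv cRem) powE) ;; .setNat cDig (.lit 0) (.add (nv cDig) (.lit 1)))

/-- The machine has no division of naturals. Repeated subtraction takes time linear in the digit,
not in the number. -/
theorem nextDigit_runs {s : State} {q B : ℕ} (hq : 0 < q)
    (hpw : s.nat aPw (s.nat cK 0 - 1 - s.nat cJ 0) = q) (hB : s.nat cRem 0 / q + 1 ≤ B) :
    Runs nextDigit s (fun s' => s'.nat cDig 0 = s.nat cRem 0 / q ∧
      s'.nat cRem 0 = s.nat cRem 0 % q) (B * 60) := by
  have hB1 : 1 ≤ B := (Nat.le_add_left 1 _).trans hB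
  refine (Runs.of_flat (T := 3) (Q := fun s' => s' = s.putNat cDig 0 0) rfl (by decide) rfl).seq
    (T₂ := B * 50) ?_ (by clear hB; omega)
  rintro s₁ rfl -
  refine (Runs.loop (s.nat cRem 0 / q) 30 (fun i s' => s'.nat cDig 0 = i ∧
    s'.nat cRem 0 + i * q = s.nat cRem 0) ?_ ?_).mono ?_ ?_
  · simp
  · rintro i s' hf ⟨h1, h2⟩ hb
    have e : s'.nat aPw (s'.nat cK 0 - 1 - s'.nat cJ 0) = q := by
      rw [hf.nat aPw rfl, hf.nat cK rfl, hf.nat cJ rfl]; simpa using hpw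
    simp only [Test.Holds, NExp.eval, e] at hb
    constructor
    · rw [Nat.lt_iff_add_one_le, Nat.le_div_iff_mul_le hq]; nlinarith
    · refine Runs.of_flat rfl (by decide) ?_
      simp only [Prog.den, NExp.eval, e, ne_eq, Nat.reduceEqDiff, not_false_eq_true,
        State.putNat_nat_ne, State.putNat_nat_self, Function.update_self, h1, true_and]
      rw [add_mul]; omega
  · rintro s' ⟨⟨i, h1, h2⟩, hb⟩ hf
    have e : s'.nat aPw (s'.nat cK 0 - 1 - s'.nat cJ 0) = q := by
      rw [hf.nat aPw rfl, hf.nat cK rfl, hf.nat cJ rfl]; simpa using hpw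
    simp only [Test.Holds, NExp.eval, e, not_le] at hb
    rw [← h2, h1, Nat.add_mul_div_right _ _ hq, Nat.add_mul_mod_self_right, Nat.div_eq_of_lt hb,
      Nat.mod_eq_of_lt hb]
    simp
  · simp only [Test.cost, NExp.cost]; nlinarith

/-- Open the next facility with the label `cDig`. -/
def openNext : Prog :=
  .setNat cPick (.lit 0) (nv 0) ;;
  forN cF 0 (.ite (.and (natEq (.read aLab (nv cF)) (nv cDig))
      (.and (.natLE (.read aOp (nv cF)) (.lit 0)) (.and (.realLE (.read rDel (nv cF)) (rv rD))
        (tor (.natLE (nv 0) (nv cPick)) (.natLE (.read aCap (nv cPick)) (.read aCap (nv cF)))))))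
    (.setNat cPick (.lit 0) (nv cF)) .skip) ;;
  .ite (natLT (nv cPick) (nv 0))
    (.setNat aOp (nv cPick) (.lit 1) ;; .setNat aOl (nv cLen) (nv cPick) ;;
      .setNat cLen (.lit 0) (.add (nv cLen) (.lit 1))) .skip

theorem openNext_runs {s : State} {p : Problem} {G : Finset ℕ} {B : ℕ} (hs : s.Has p)
    (hG : s.Opens p G) (hB : p.nF + 1 ≤ B) :
    Runs openNext s (fun s' => s'.Opens p
      (if nextOpen p.nF p.u (s.nat aLab) (fun f => s.real rDel f ≤ s.real rD 0) G (s.nat cDig 0)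
          < p.nF then
        insert (nextOpen p.nF p.u (s.nat aLab) (fun f => s.real rDel f ≤ s.real rD 0) G
          (s.nat cDig 0)) G
      else G)) (B * 150) := by
  refine (Runs.of_flat (T := 4) (Q := fun s' => s' = s.putNat cPick 0 p.nF) rfl (by decide) ?_).seq
    (T₂ := B * 140) ?_ (by omega)
  · simp only [Prog.den, NExp.eval, hs.nF]
  rintro s₁ rfl -
  set P : ℕ → Prop := fun f => s.nat aLab f = s.nat cDig 0 ∧ f ∉ G ∧ s.real rDel f ≤ s.real rD 0
    with hP
  refine (Runs.forN_flat (n := p.nF) (T := 60)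
    (Inv := fun i s' => s'.nat cPick 0 = pick p.u P p.nF i)
    (by simpa using hs.nF) rfl rfl rfl (by decide) ?_ ?_).seq (T₂ := 40) ?_ (by omega)
  · simp [pick]
  · intro i hi s' hf hcF hI
    simp only [Prog.den, Test.Holds, NExp.eval, RExp.eval, hcF, hI]
    rw [hf.nat aLab rfl, hf.nat cDig rfl, hf.nat aOp rfl, hf.nat 0 rfl, hf.nat aCap rfl,
      hf.real rDel rfl, hf.real rD rfl]
    simp only [ne_eq, Nat.reduceEqDiff, not_false_eq_true, State.putNat_nat_ne, State.putNat_real,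
      hs.nF, hs.u, hG.op i hi]
    rw [pick]
    -- Membership in `G` is stored as 0 or 1; this turns the machine test into the condition used by
    -- `pick`.
    have e : (((s.nat aLab i ≤ s.nat cDig 0 ∧ s.nat cDig 0 ≤ s.nat aLab i) ∧
        (if i ∈ G then 1 else 0) ≤ 0 ∧ s.real rDel i ≤ s.real rD 0 ∧
          ¬ (¬ p.nF ≤ pick p.u P p.nF i ∧ ¬ p.u (pick p.u P p.nF i) ≤ p.u i)) ↔
        (P i ∧ (p.nF ≤ pick p.u P p.nF i ∨ p.u (pick p.u P p.nF i) ≤ p.u i))) := by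
      rw [← le_antisymm_iff, hP, not_and_or, not_not, not_not]
      by_cases hi : i ∈ G <;> simp [hi, and_assoc]
    by_cases hc : P i ∧ (p.nF ≤ pick p.u P p.nF i ∨ p.u (pick p.u P p.nF i) ≤ p.u i)
    · rw [if_pos (e.2 hc), if_pos hc]; simp
    · rw [if_neg (fun h => hc (e.1 h)), if_neg hc, hI]
  intro s₂ h₂ f₂
  refine Runs.of_flat rfl (by decide) ?_
  have hg : nextOpen p.nF p.u (s.nat aLab) (fun f => s.real rDel f ≤ s.real rD 0) G (s.nat cDig 0)
    = s₂.nat cPick 0 := h₂.symm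
  rw [hg]
  have hs₂ := nextOpen_spec p.nF p.u (s.nat aLab) (fun f => s.real rDel f ≤ s.real rD 0) G
    (s.nat cDig 0)
  rw [hg] at hs₂
  set g := s₂.nat cPick 0 with hg_def
  have e0 : s₂.nat 0 0 = p.nF := by rw [f₂.nat 0 rfl]; simpa using hs.nF
  have eOp : s₂.nat aOp = s.nat aOp := by rw [f₂.nat aOp rfl]; simp
  have eOl : s₂.nat aOl = s.nat aOl := by rw [f₂.nat aOl rfl]; simp
  have eL : s₂.nat cLen = s.nat cLen := by rw [f₂.nat cLen rfl]; simp
  simp only [Prog.den, Test.Holds, NExp.eval, e0, ← hg_def, not_le]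
  split_ifs with hlt
  · obtain ⟨-, -, hgG, -⟩ := hs₂.resolve_left (fun h => hlt.ne h.1)
    refine ⟨fun f hf => ?_, ?_, ?_⟩
    · simp only [ne_eq, Nat.reduceEqDiff, not_false_eq_true, State.putNat_nat_ne,
        State.putNat_nat_self, eOp, Function.update_apply, Finset.mem_insert]
      by_cases h : f = g
      · simp [h]
      · simp [h, hG.op f hf]
    · simp only [ne_eq, Nat.reduceEqDiff, not_false_eq_true, State.putNat_nat_ne,
        State.putNat_nat_self, eOl, eL, Function.update_self, ← hg_def]
      rw [Finset.range_add_one, Finset.image_insert, Function.update_self]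
      congr 1
      rw [← hG.image]
      refine Finset.image_congr fun j hj => ?_
      rw [Function.update_of_ne]
      exact (Finset.mem_range.1 hj).ne
    · simp [eL, hG.card, Finset.card_insert_of_notMem hgG]
  · exact ⟨fun f hf => by rw [eOp, hG.op f hf], by rw [eL, eOl, hG.image], by rw [eL, hG.card]⟩

/-- Open facilities greedily for the labels that are the digits of the number in `cT`. -/
def openAll : Prog :=
  forN cF 0 (.setNat aOp (nv cF) (.lit 0)) ;; .setNat cLen (.lit 0) (.lit 0) ;;
  .setNat cRem (.lit 0) (nv cT) ;; forN cJ cK (nextDigit ;; openNext)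

/-- After `j` rounds the remainder is the number formed by the last `K - j` digits. Every digit is
below `M ≤ B`, so splitting it off is cheap. -/
theorem openAll_runs {s : State} {p : Problem} {M B : ℕ} (hs : s.Has p)
    (hM : 0 < M) (hpw : ∀ j < p.K, s.nat aPw j = M ^ j) (ht : s.nat cT 0 < M ^ p.K)
    (hMB : M ≤ B) (hB : p.nF + 1 ≤ B) (hK : p.K + 1 ≤ B) :
    Runs openAll s (fun s' => s'.Opens p (greedy p.nF p.u (s.nat aLab)
      (fun f => s.real rDel f ≤ s.real rD 0)
      (fun j => s.nat cT 0 / M ^ (p.K - 1 - j) % M) p.K)) (B * (B * 210 + 100)) := by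
  set t := s.nat cT 0 with ht_def
  refine (Runs.fillNat (n := p.nF) (fun _ => 0) hs.nF (by decide) (by decide) (by decide)
    (fun _ _ _ _ _ => rfl)).seq (T₂ := B * (B * 210 + 70)) ?_ (by simp only [NExp.cost]; nlinarith)
  intro s₁ h₁ f₁
  refine (Runs.of_flat (T := 10) (Q := fun s' => s' = s₁.putNat cLen 0 0) rfl (by decide)
    rfl).seq (T₂ := B * (B * 210 + 40)) ?_ (by nlinarith)
  rintro s₂ h₂ f₂
  refine (Runs.of_flat (T := 10) (Q := fun s' => s' = s₂.putNat cRem 0 t) rfl (by decide)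
    ?_).seq (T₂ := B * (B * 210 + 20)) ?_ (by nlinarith)
  · simp only [Prog.den, NExp.eval]
    rw [h₂, State.putNat_nat_ne _ _ _ _ _ (by decide), f₁.nat cT rfl]
  rintro s₃ h₃ f₃
  set E : ℕ → Prop := fun f => s.real rDel f ≤ s.real rD 0 with hE
  set dig : ℕ → ℕ := fun j => t / M ^ (p.K - 1 - j) % M with hdig
  have e : ∀ x, x ≠ cF → x ≠ aOp → x ≠ cLen → x ≠ cRem → s₃.nat x = s.nat x := by
    intro x h1 h2 h3 h4
    rw [h₃, State.putNat_nat_ne _ _ _ _ _ h4, h₂, State.putNat_nat_ne _ _ _ _ _ h3, f₁.nat]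
    simp [Prog.writesNat, h1, h2]
  have er : s₃.real = s.real := by
    rw [h₃, h₂]
    ext x : 1
    exact f₁.real x rfl
  have hs₃ : s₃.Has p := ((hs.of_frame f₁ rfl).of_frame f₂ rfl).of_frame f₃ rfl
  refine (Runs.forN (n := p.K) (T := B * 210) (Inv := fun j s' => s'.nat cRem 0 = t % M ^ (p.K - j)
    ∧ s'.Opens p (greedy p.nF p.u (s.nat aLab) E dig j)) hs₃.K rfl rfl ?_ ?_).mono
    (fun _ h _ => h.2) (by nlinarith)
  · refine ⟨?_, ?_, ?_, ?_⟩
    · simp [h₃, Nat.mod_eq_of_lt ht]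
    · intro f hf
      rw [State.putNat_nat_ne _ _ _ _ _ (by decide), h₃, State.putNat_nat_ne _ _ _ _ _ (by decide),
        h₂, State.putNat_nat_ne _ _ _ _ _ (by decide), h₁]
      simp [greedy, hf]
    · simp [greedy, h₃, h₂]
    · simp [greedy, h₃, h₂]
  · rintro j hj s' hf hcJ ⟨hrem, hO⟩
    have hs' : s'.Has p := hs₃.of_frame hf rfl
    have hq : 0 < M ^ (p.K - 1 - j) := Nat.pow_pos hM
    have hKj : M ^ (p.K - j) = M ^ (p.K - 1 - j) * M := by rw [← pow_succ]; congr 1; omega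
    have hdiv : s'.nat cRem 0 / M ^ (p.K - 1 - j) = dig j := by
      rw [hrem, hKj, Nat.mod_mul_right_div_self]
    have hmod : s'.nat cRem 0 % M ^ (p.K - 1 - j) = t % M ^ (p.K - (j + 1)) := by
      rw [hrem, hKj, Nat.mod_mul_right_mod, show p.K - 1 - j = p.K - (j + 1) by omega]
    refine (nextDigit_runs (q := M ^ (p.K - 1 - j)) (B := B) hq ?_ ?_).seq (T₂ := B * 150) ?_
      (by omega)
    · rw [hf.nat aPw rfl, e aPw (by decide) (by decide) (by decide) (by decide), hs'.K, hcJ,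
        hpw _ (by omega)]
    · rw [hdiv]
      exact (Nat.mod_lt _ hM : dig j < M).trans_le hMB
    rintro s₄ ⟨hd, hr⟩ f₄
    have hO₄ : s₄.Opens p (greedy p.nF p.u (s.nat aLab) E dig j) := by
      refine ⟨fun f hf => ?_, ?_, ?_⟩
      · rw [f₄.nat aOp rfl, hO.op f hf]
      · rw [f₄.nat cLen rfl, f₄.nat aOl rfl, hO.image]
      · rw [f₄.nat cLen rfl, hO.card]
    refine (openNext_runs (hs'.of_frame f₄ rfl) hO₄ hB).mono ?_ le_rfl
    intro s₅ h₅ f₅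
    refine ⟨?_, ?_⟩
    · rw [State.putNat_nat_ne _ _ _ _ _ (by decide), f₅.nat cRem rfl, hr, hmod]
    · have e1 : s₄.nat aLab = s.nat aLab := by
        rw [f₄.nat aLab rfl, hf.nat aLab rfl, e aLab (by decide) (by decide) (by decide)
          (by decide)]
      have e2 : (fun f => s₄.real rDel f ≤ s₄.real rD 0) = E := by
        rw [f₄.real rDel rfl, hf.real rDel rfl, f₄.real rD rfl, hf.real rD rfl, er]
      rw [e1, e2, hd, hdiv] at h₅
      rw [greedy]
      refine ⟨fun f hf => ?_, ?_, ?_⟩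
      · rw [State.putNat_nat_ne _ _ _ _ _ (by decide), h₅.op f hf]
      · rw [State.putNat_nat_ne _ _ _ _ _ (by decide), State.putNat_nat_ne _ _ _ _ _ (by decide),
          h₅.image]
      · rw [State.putNat_nat_ne _ _ _ _ _ (by decide), h₅.card]

/-! ### Evaluating a set of open facilities -/

/-- `Z` assigns the clients to facilities in `G` and respects their capacities. -/
structure Problem.Assigns (p : Problem) (G : Finset ℕ) (Z : ℕ → ℕ) : Prop where
  mem : ∀ c < p.nC, Z c ∈ G
  load_le : ∀ f ∈ G, load p.nC Z f ≤ p.u f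

/-- The cost of the assignment `Z`. -/
def Problem.cost (p : Problem) (Z : ℕ → ℕ) : ℝ := ∑ c ∈ Finset.range p.nC, p.C c (Z c)

/-- The memory records no solution or a feasible solution and its cost. -/
def State.Valid (s : State) (p : Problem) : Prop :=
  s.nat aFlag 0 = 0 ∨ (s.nat aFlag 0 = 1 ∧ ∃ G : Finset ℕ, G.card ≤ p.K ∧ (∀ f ∈ G, f < p.nF) ∧
    (∀ f < p.nF, s.nat aOpen f = if f ∈ G then 1 else 0) ∧ p.Assigns G (s.nat aAsg) ∧
    s.real rBest 0 = p.cost (s.nat aAsg))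

/-- The memory records a solution of cost at most `y`. -/
def State.Beats (s : State) (y : ℝ) : Prop := s.nat aFlag 0 = 1 ∧ s.real rBest 0 ≤ y

theorem State.Beats.mono {s : State} {y z : ℝ} (h : s.Beats y) (hyz : y ≤ z) : s.Beats z :=
  ⟨h.1, h.2.trans hyz⟩

theorem State.Has.dist_eq {s : State} {p : Problem} (h : s.Has p) :
    s.dist = fun i j => p.C i (s.nat aOl j) := by
  funext i j
  rw [← h.C, State.dist, h.nF]

section Positions

variable {p : Problem} {G : Finset ℕ} {ol : ℕ → ℕ} {m : ℕ}

theorem load_comp_of_injOn (hinj : Set.InjOn ol (Finset.range m)) {X : ℕ → ℕ} {n : ℕ}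
    (hX : ∀ i < n, X i < m) {j : ℕ} (hj : j < m) :
    load n (fun i => ol (X i)) (ol j) = load n X j := by
  rw [load, load]
  congr 1
  refine Finset.filter_congr fun i hi => ⟨fun h => ?_, fun h => by rw [h]⟩
  exact hinj (by simpa using hX i (Finset.mem_range.1 hi)) (by simpa using hj) h

/-- The Hungarian method assigns clients to positions in the list of open facilities; this
translates a competing assignment to positions. -/
theorem exists_positions (hG : (Finset.range m).image ol = G)
    (hinj : Set.InjOn ol (Finset.range m)) {Z : ℕ → ℕ} (hZ : p.Assigns G Z) :
    ∃ Y : ℕ → ℕ, (∀ i < p.nC, Y i < m) ∧ (∀ i < p.nC, ol (Y i) = Z i) ∧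
      ∀ j < m, load p.nC Y j ≤ p.u (ol j) := by
  have h : ∀ i, ∃ j, i < p.nC → j < m ∧ ol j = Z i := by
    intro i
    by_cases hi : i < p.nC
    · have := hZ.mem i hi
      rw [← hG] at this
      obtain ⟨j, hj, hjZ⟩ := Finset.mem_image.1 this
      exact ⟨j, fun _ => ⟨Finset.mem_range.1 hj, hjZ⟩⟩
    · exact ⟨0, fun h => absurd h hi⟩
  choose Y hY using h
  refine ⟨Y, fun i hi => (hY i hi).1, fun i hi => (hY i hi).2, fun j hj => ?_⟩
  have hm : ol j ∈ G := by rw [← hG]; exact Finset.mem_image_of_mem _ (Finset.mem_range.2 hj)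
  refine le_trans (le_of_eq ?_) (hZ.load_le _ hm)
  rw [← load_comp_of_injOn hinj (fun i hi => (hY i hi).1) hj, load, load]
  congr 1
  exact Finset.filter_congr fun i hi => by rw [(hY i (Finset.mem_range.1 hi)).2]

theorem Problem.Assigns.le_sum (hG : (Finset.range m).image ol = G)
    (hinj : Set.InjOn ol (Finset.range m)) {Z : ℕ → ℕ} (hZ : p.Assigns G Z) :
    p.nC ≤ ∑ j ∈ Finset.range m, p.u (ol j) := by
  obtain ⟨Y, hY, -, hl⟩ := exists_positions hG hinj hZ
  rw [← sum_load hY]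
  exact Finset.sum_le_sum fun j hj => hl j (Finset.mem_range.1 hj)

end Positions

/-- Record the current solution as the best one. -/
def record : Prog :=
  .setNat aFlag (.lit 0) (.lit 1) ;; .setReal rBest (.lit 0) (rv rCost) ;;
  forN cF 0 (.setNat aOpen (nv cF) (.read aOp (nv cF))) ;;
  forN cI cNC (.setNat aAsg (nv cI) (.read aOl (.read aX (nv cI))))

/-- Compute a best assignment to the open facilities and record it if it is better than the recorded
solution. -/
def evaluate : Prog :=
  .setNat cSum (.lit 0) (.lit 0) ;;
  forN cJ cLen (.setNat cSum (.lit 0) (.add (nv cSum) (.read aCap (.read aOl (nv cJ))))) ;;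
  .ite (.natLE (nv cNC) (nv cSum))
    (hungarian ;; .setReal rCost (.lit 0) (.lit 0) ;;
      forN cI cNC (.setReal rCost (.lit 0)
        (.add (rv rCost) (distE (nv cI) (.read aX (nv cI))))) ;;
      .ite (tor (.natLE (nv aFlag) (.lit 0)) (realLT (rv rCost) (rv rBest))) record .skip)
    .skip

theorem record_runs {s : State} {p : Problem} {G : Finset ℕ} {B : ℕ} (hs : s.Has p)
    (hG : s.Opens p G) (hGK : G.card ≤ p.K) (hGF : ∀ f ∈ G, f < p.nF)
    (hA : p.Assigns G fun i => s.nat aOl (s.nat aX i))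
    (hc : s.real rCost 0 = p.cost fun i => s.nat aOl (s.nat aX i))
    (hB : p.nF + 1 ≤ B) (hB' : p.nC + 1 ≤ B) :
    Runs record s (fun s' => s'.Valid p ∧ ∀ y, s.real rCost 0 ≤ y → s'.Beats y) (B * 70) := by
  refine (Runs.of_flat (T := 3) (Q := fun s' => s' = s.putNat aFlag 0 1) rfl (by decide) rfl).seq
    (T₂ := B * 60) ?_ (by omega)
  rintro s₁ h₁ f₁
  refine (Runs.of_flat (T := 4) (Q := fun s' => s' = s₁.putReal rBest 0 (s₁.real rCost 0)) rfl
    (by decide) rfl).seq (T₂ := B * 56) ?_ (by omega)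
  rintro s₂ h₂ f₂
  have hs₂ := (hs.of_frame f₁ rfl).of_frame f₂ rfl
  refine (Runs.fillNat (n := p.nF) (s.nat aOp) hs₂.nF (by decide) (by decide) (by decide)
    (fun i _ s' hf hv => ?_)).seq (T₂ := B * 30) ?_ (by simp only [NExp.cost]; nlinarith)
  · simp only [NExp.eval, hv]
    rw [hf.nat aOp rfl, f₂.nat aOp rfl, f₁.nat aOp rfl]
  intro s₃ h₃ f₃
  have hs₃ := hs₂.of_frame f₃ rfl
  refine (Runs.fillNat (n := p.nC) (fun i => s.nat aOl (s.nat aX i)) hs₃.nC (by decide) (by decide)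
    (by decide) (fun i _ s' hf hv => ?_)).mono ?_ (by simp only [NExp.cost]; nlinarith)
  · simp only [NExp.eval, hv]
    rw [hf.nat aOl rfl, f₃.nat aOl rfl, f₂.nat aOl rfl, f₁.nat aOl rfl, hf.nat aX rfl,
      f₃.nat aX rfl, f₂.nat aX rfl, f₁.nat aX rfl]
  intro s₄ h₄ f₄
  have e1 : s₄.nat aFlag 0 = 1 := by
    rw [f₄.nat aFlag rfl, f₃.nat aFlag rfl, f₂.nat aFlag rfl, h₁]; simp
  have e2 : s₄.real rBest 0 = s.real rCost 0 := by
    rw [f₄.real rBest rfl, f₃.real rBest rfl, h₂, f₁.real rCost rfl]; simp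
  have e3 : ∀ f < p.nF, s₄.nat aOpen f = if f ∈ G then 1 else 0 := by
    intro f hf
    rw [f₄.nat aOpen rfl, h₃]
    simp only [hf, if_true]
    rw [hG.op f hf]
  have e4 : ∀ c < p.nC, s₄.nat aAsg c = s.nat aOl (s.nat aX c) := by
    intro c hc
    rw [h₄]; simp [hc]
  refine ⟨Or.inr ⟨e1, G, hGK, hGF, e3, ⟨fun c hc => ?_, fun f hf => ?_⟩, ?_⟩, fun y hy => ⟨e1, ?_⟩⟩
  · rw [e4 c hc]; exact hA.mem c hc
  · refine le_trans (le_of_eq ?_) (hA.load_le f hf)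
    rw [load, load]
    congr 1
    exact Finset.filter_congr fun c hc => by rw [e4 c (Finset.mem_range.1 hc)]
  · rw [e2, hc]
    exact Finset.sum_congr rfl fun c hc => by rw [e4 c (Finset.mem_range.1 hc)]
  · rw [e2]; exact hy

theorem evaluate_runs {s : State} {p : Problem} {G : Finset ℕ} {B : ℕ} (hs : s.Has p)
    (hG : s.Opens p G) (hGK : G.card ≤ p.K) (hGF : ∀ f ∈ G, f < p.nF)
    (hC : ∀ c < p.nC, ∀ f < p.nF, 0 ≤ p.C c f) (hV : s.Valid p)
    (hB : p.nF + 1 ≤ B) (hB' : p.nC + 1 ≤ B) (hK : p.K + 1 ≤ B) :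
    Runs evaluate s (fun s' => s'.Valid p ∧ (∀ y, s.Beats y → s'.Beats y) ∧
      ∀ Z, p.Assigns G Z → s'.Beats (p.cost Z)) (1300 * B ^ 4) := by
  have hB1 : 1 ≤ B := by omega
  have hBB : B ≤ B ^ 4 := by nlinarith [Nat.pow_le_pow_right hB1 (show 1 ≤ 4 by norm_num)]
  set m := s.nat cLen 0 with hm
  have hmB : m + 1 ≤ B := by have := hG.card; omega
  refine (Runs.of_flat (T := 3) (Q := fun s' => s' = s.putNat cSum 0 0) rfl (by decide) rfl).seq
    (T₂ := 1000 * B ^ 4 + B * 250) ?_ (by omega)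
  rintro s₁ h₁ f₁
  refine (Runs.forN_flat (n := m) (T := 20) (Inv := fun j s' => s'.nat cSum 0 =
    ∑ i ∈ Finset.range j, p.u (s.nat aOl i)) (by rw [f₁.nat cLen rfl]) rfl rfl rfl (by decide)
    ?_ ?_).seq (T₂ := 1000 * B ^ 4 + B * 200) ?_ (by nlinarith)
  · simp [h₁]
  · intro j hj s' hf hv hI
    simp only [Prog.den, NExp.eval, hI, hv, (hs.of_frame f₁ rfl).of_frame hf rfl |>.u]
    rw [hf.nat aOl rfl, f₁.nat aOl rfl, Finset.sum_range_succ]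
    simp
  intro s₂ h₂ f₂
  have hs₂ := (hs.of_frame f₁ rfl).of_frame f₂ rfl
  have e : ∀ x, x ≠ cSum → x ≠ cJ → s₂.nat x = s.nat x := by
    intro x hx1 hx2
    rw [f₂.nat x, f₁.nat x] <;> simp [Prog.writesNat, hx1, hx2]
  have er : s₂.real = s.real := by
    ext x : 1
    rw [f₂.real x rfl, f₁.real x rfl]
  have eOl : s₂.nat aOl = s.nat aOl := by rw [e] <;> decide
  have em : s₂.nat cLen 0 = m := by rw [e] <;> decide
  have eFl : s₂.nat aFlag = s.nat aFlag := by rw [e] <;> decide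
  -- Two of the three outcomes leave the record untouched; both are settled here.
  have hkeep : ∀ {s' : State}, s'.nat aFlag 0 = s₂.nat aFlag 0 → s'.nat aOpen = s₂.nat aOpen →
      s'.nat aAsg = s₂.nat aAsg → s'.real rBest = s₂.real rBest →
      s'.Valid p ∧ (∀ y, s.Beats y → s'.Beats y) := by
    intro s' g1 g2 g3 g4
    rw [State.Valid, g1, g2, g3, g4, er, e aFlag (by decide) (by decide),
      e aOpen (by decide) (by decide), e aAsg (by decide) (by decide)]
    refine ⟨hV, fun y hy => ?_⟩
    rw [State.Beats, g1, g4, er, e aFlag (by decide) (by decide)]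
    exact hy
  refine Runs.ite (T' := 1000 * B ^ 4 + B * 190) (fun hb => ?_) (fun hb => ?_)
    (by simp only [Test.cost, NExp.cost]; omega)
  swap
  · refine Runs.of_flat rfl (by simp only [Prog.time]; omega) ?_
    obtain ⟨k1, k2⟩ := hkeep (s' := s₂) rfl rfl rfl rfl
    refine ⟨k1, k2, fun Z hZ => absurd ?_ hb⟩
    simp only [Test.Holds, NExp.eval, h₂, hs₂.nC]
    exact hZ.le_sum hG.image hG.injOn
  simp only [Test.Holds, NExp.eval, h₂, hs₂.nC] at hb
  refine (hungarian_runs (s := s₂) (B := B) ?_ ?_ ?_ ?_).seq (T₂ := B * 180) ?_ (by omega)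
  · rw [hs₂.nC, em, hs₂.u, eOl]; exact hb
  · intro i hi h hh
    rw [hs₂.dist_eq]
    rw [em] at hh
    rw [hs₂.nC] at hi
    exact hC i hi _ (hGF _ (by rw [eOl]; exact hG.mem hh))
  · rw [hs₂.nC]; exact hB'
  · rw [em]; exact hmB
  intro s₃ h₃ f₃
  rw [hs₂.nC, em, hs₂.u, eOl, hs₂.dist_eq, eOl] at h₃
  obtain ⟨hX, hl, hopt⟩ := h₃
  have hs₃ := hs₂.of_frame f₃ rfl
  refine (Runs.of_flat (T := 3) (Q := fun s' => s' = s₃.putReal rCost 0 0) rfl (by decide)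
    (by simp [Prog.den, NExp.eval, RExp.eval])).seq (T₂ := B * 150) ?_ (by omega)
  intro s₄ h₄ f₄
  have hs₄ := hs₃.of_frame f₄ rfl
  refine (Runs.forN_flat (n := p.nC) (T := 30) (Inv := fun i s' => s'.real rCost 0 =
    ∑ c ∈ Finset.range i, p.C c (s.nat aOl (s₃.nat aX c))) hs₄.nC rfl rfl rfl (by decide)
    ?_ ?_).seq (T₂ := B * 100) ?_ (by nlinarith)
  · simp [h₄]
  · intro i hi s' hf hv hI
    have hs' := hs₄.of_frame hf rfl
    have hd := congrFun (congrFun hs'.dist_eq i) (s'.nat aX i)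
    rw [State.dist] at hd
    simp only [Prog.den, NExp.eval, RExp.eval, hI, hv, hd]
    rw [hf.nat aOl rfl, f₄.nat aOl rfl, f₃.nat aOl rfl, eOl, hf.nat aX rfl, f₄.nat aX rfl,
      Finset.sum_range_succ]
    simp
  intro s₅ h₅ f₅
  have hs₅ := hs₄.of_frame f₅ rfl
  have g : ∀ x, hungarian.writesNat x = false → x ≠ cI → s₅.nat x = s₂.nat x := by
    intro x hx1 hx2
    rw [f₅.nat x, f₄.nat x, f₃.nat x hx1] <;> simp [Prog.writesNat, hx2]
  have gr : s₅.real rBest = s₂.real rBest := by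
    rw [f₅.real _ rfl, f₄.real _ rfl, f₃.real _ rfl]
  have gOl : s₅.nat aOl = s.nat aOl := by rw [g aOl rfl (by decide), eOl]
  have gX : s₅.nat aX = s₃.nat aX := by rw [f₅.nat aX rfl, f₄.nat aX rfl]
  have gL : s₅.nat cLen = s.nat cLen := by
    rw [g cLen rfl (by decide), e cLen (by decide) (by decide)]
  have hc₅ : s₅.real rCost 0 = p.cost fun i => s₅.nat aOl (s₅.nat aX i) := by
    rw [h₅, gOl, gX]; rfl
  have hA : p.Assigns G fun i => s₅.nat aOl (s₅.nat aX i) := by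
    rw [gOl, gX]
    refine ⟨fun c hc => hG.mem (hX c hc), fun f hf => ?_⟩
    rw [← hG.image] at hf
    obtain ⟨j, hj, rfl⟩ := Finset.mem_image.1 hf
    rw [load_comp_of_injOn hG.injOn hX (Finset.mem_range.1 hj)]
    exact hl j (Finset.mem_range.1 hj)
  have hmin : ∀ Z, p.Assigns G Z → s₅.real rCost 0 ≤ p.cost Z := by
    intro Z hZ
    obtain ⟨Y, hY, hYZ, hYl⟩ := exists_positions hG.image hG.injOn hZ
    rw [h₅]
    refine (hopt Y hY hYl).trans (le_of_eq ?_)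
    exact Finset.sum_congr rfl fun c hc => by beta_reduce; rw [hYZ c (Finset.mem_range.1 hc)]
  have hO₅ : s₅.Opens p G := by
    refine ⟨fun f hf => ?_, by rw [gL, gOl, hG.image], by rw [gL, hG.card]⟩
    rw [g aOp rfl (by decide), e aOp (by decide) (by decide), hG.op f hf]
  have gF : s₅.nat aFlag = s.nat aFlag := by rw [g aFlag rfl (by decide), eFl]
  obtain ⟨k1, k2⟩ := hkeep (s' := s₅) (by rw [g aFlag rfl (by decide)]) (g aOpen rfl (by decide))
    (g aAsg rfl (by decide)) gr
  refine Runs.ite (T' := B * 80) (fun hb => ?_) (fun hb => ?_)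
    (by simp only [Test.cost, NExp.cost, RExp.cost]; omega)
  · refine (record_runs hs₅ hO₅ hGK hGF hA hc₅ hB hB').mono ?_ (by omega)
    rintro s' ⟨hV', hbeat⟩ -
    refine ⟨hV', fun y hy => hbeat y ?_, fun Z hZ => hbeat _ (hmin Z hZ)⟩
    have hy' := k2 y hy
    simp only [Test.Holds, NExp.eval, RExp.eval, gF, hy.1] at hb
    norm_num at hb
    exact hb.le.trans hy'.2
  -- The failed test means that a solution is on record and costs no more than the new one.
  · refine Runs.of_flat rfl (by simp only [Prog.time]; omega) ⟨k1, k2, fun Z hZ => ?_⟩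
    simp only [Test.Holds, NExp.eval, RExp.eval, not_and_or, not_not, not_or, not_le] at hb
    refine ⟨?_, (not_lt.1 hb.2).trans (hmin Z hZ)⟩
    rcases k1 with h | h
    · omega
    · exact h.1

/-! ### Enumeration of the label sequences -/

/-- Try all sequences of labels. -/
def tryAll : Prog := forN cT cCnt (openAll ;; evaluate)

theorem tryAll_runs {s : State} {p : Problem} {M B : ℕ} (hs : s.Has p)
    (hC : ∀ c < p.nC, ∀ f < p.nF, 0 ≤ p.C c f) (hV : s.Valid p)
    (hM : 0 < M) (hpw : ∀ j < p.K, s.nat aPw j = M ^ j) (hcnt : s.nat cCnt 0 = M ^ p.K)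
    (hMB : M ≤ B) (hB : p.nF + 1 ≤ B) (hB' : p.nC + 1 ≤ B) (hK : p.K + 1 ≤ B) :
    Runs tryAll s (fun s' => s'.Valid p ∧ (∀ y, s.Beats y → s'.Beats y) ∧
      ∀ t < M ^ p.K, ∀ Z, p.Assigns (greedy p.nF p.u (s.nat aLab)
        (fun f => s.real rDel f ≤ s.real rD 0) (fun j => t / M ^ (p.K - 1 - j) % M) p.K) Z →
        s'.Beats (p.cost Z)) ((M ^ p.K + 1) * (1700 * B ^ 4)) := by
  have hB1 : 1 ≤ B := by omega
  have hB2 : B ≤ B ^ 4 := by nlinarith [Nat.pow_le_pow_right hB1 (show 1 ≤ 4 by norm_num)]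
  have hB3 : B * B ≤ B ^ 4 := by
    rw [← pow_two]; exact Nat.pow_le_pow_right hB1 (by norm_num)
  refine (Runs.forN (n := M ^ p.K) (T := 1650 * B ^ 4) (Inv := fun i s' => s'.Valid p ∧
    (∀ y, s.Beats y → s'.Beats y) ∧ ∀ t < i, ∀ Z, p.Assigns (greedy p.nF p.u (s.nat aLab)
      (fun f => s.real rDel f ≤ s.real rD 0) (fun j => t / M ^ (p.K - 1 - j) % M) p.K) Z →
        s'.Beats (p.cost Z)) hcnt rfl rfl ?_ ?_).mono (fun _ h _ => h)
        (Nat.mul_le_mul_left _ (by omega))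
  · refine ⟨?_, fun y hy => ?_, by simp⟩
    · simpa [State.Valid] using hV
    · simpa [State.Beats] using hy
  · rintro i hi s' hf hv ⟨hV', hm, hI⟩
    have hs' := hs.of_frame hf rfl
    refine (openAll_runs (M := M) (B := B) hs' hM ?_ (by rw [hv]; exact hi) hMB hB hK).seq
      (T₂ := 1300 * B ^ 4) ?_ (by nlinarith)
    · intro j hj
      rw [hf.nat aPw rfl]; exact hpw j hj
    intro s₂ h₂ f₂
    rw [hv, hf.nat aLab rfl, hf.real rDel rfl, hf.real rD rfl] at h₂
    have hV₂ : s₂.Valid p := by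
      rw [State.Valid, f₂.nat aFlag rfl, f₂.nat aOpen rfl, f₂.nat aAsg rfl, f₂.real rBest rfl]
      exact hV'
    have hbt : ∀ y, s₂.Beats y ↔ s'.Beats y := fun y => by
      rw [State.Beats, State.Beats, f₂.nat aFlag rfl, f₂.real rBest rfl]
    refine (evaluate_runs (B := B) (hs'.of_frame f₂ rfl) h₂ (card_greedy_le _ _ _ _ _ _)
      (fun f hf => (greedy_subset _ _ _ _ _ _ f hf).1) hC hV₂ hB hB' hK).mono ?_ le_rfl
    rintro s₃ ⟨hV₃, hm₃, hb₃⟩ -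
    have hbt' : ∀ y, (s₃.putNat cT 0 (i + 1)).Beats y ↔ s₃.Beats y := fun y => by
      simp [State.Beats]
    refine ⟨by simpa [State.Valid] using hV₃, fun y hy => ?_, fun t ht Z hZ => ?_⟩
    · rw [hbt']; exact hm₃ y ((hbt y).2 (hm y hy))
    · rw [hbt']
      rcases Nat.lt_succ_iff_lt_or_eq.1 ht with ht | rfl
      · exact hm₃ _ ((hbt _).2 (hI t ht Z hZ))
      · exact hb₃ Z hZ

/-- Compute the powers of the number of labels. -/
def powers : Prog :=
  .setNat aPw (.lit 0) (.lit 1) ;;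
  forN cJ cK (.setNat aPw (.add (nv cJ) (.lit 1)) (.lit 0) ;;
    forN cI cM (.setNat aPw (.add (nv cJ) (.lit 1))
      (.add (.read aPw (.add (nv cJ) (.lit 1))) (.read aPw (nv cJ))))) ;;
  .setNat cCnt (.lit 0) (.read aPw (nv cK))

/-- Naturals cannot be multiplied on the machine, so each power is obtained by adding the previous
one `M` times. -/
theorem powers_runs {s : State} {M K B : ℕ} (hM : s.nat cM 0 = M) (hK : s.nat cK 0 = K)
    (hB : M + 1 ≤ B) (hB' : K + 1 ≤ B) :
    Runs powers s (fun s' => (∀ j ≤ K, s'.nat aPw j = M ^ j) ∧ s'.nat cCnt 0 = M ^ K)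
      (B * (B * 50 + 50)) := by
  refine (Runs.of_flat (T := 3) (Q := fun s' => s' = s.putNat aPw 0 1) rfl (by decide) rfl).seq
    (T₂ := B * (B * 50 + 40)) ?_ (by nlinarith)
  rintro s₁ h₁ f₁
  refine (Runs.forN (n := K) (T := B * 50) (Inv := fun j s' => ∀ i ≤ j, s'.nat aPw i = M ^ i)
    (by rw [f₁.nat cK rfl, hK]) rfl rfl ?_ ?_).seq (T₂ := 10) ?_ (by nlinarith)
  · simp [h₁]
  · intro j hj s' hf hv hI
    refine (Runs.of_flat (T := 10) (Q := fun s'' => s'' = s'.putNat aPw (j + 1) 0) rfl (by decide)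
      (by simp only [Prog.den, NExp.eval, hv])).seq (T₂ := B * 40) ?_ (by omega)
    rintro s₂ h₂ f₂
    refine (Runs.forN_flat (n := M) (T := 20) (Inv := fun a s'' => s''.nat aPw (j + 1) = a * M ^ j ∧
      ∀ i ≤ j, s''.nat aPw i = M ^ i) (by rw [f₂.nat cM rfl, hf.nat cM rfl, f₁.nat cM rfl, hM]) rfl
      rfl rfl (by decide) ?_ ?_).mono ?_ (by nlinarith)
    · refine ⟨by simp [h₂], fun i hi => ?_⟩
      rw [State.putNat_nat_ne _ _ _ _ _ (by decide), h₂, State.putNat_nat_self,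
        Function.update_of_ne (by omega), hI i hi]
    · rintro a ha s'' hf' - ⟨h3, h4⟩
      have hcJ : s''.nat cJ 0 = j := by rw [hf'.nat cJ rfl, f₂.nat cJ rfl, hv]
      simp only [Prog.den, NExp.eval, hcJ, h3, h4 j le_rfl]
      refine ⟨?_, fun i hi => ?_⟩
      · simp [add_mul]
      · rw [State.putNat_nat_ne _ _ _ _ _ (by decide), State.putNat_nat_self,
          Function.update_of_ne (by omega), h4 i hi]
    · rintro s'' ⟨h3, h4⟩ - i hi
      rw [State.putNat_nat_ne _ _ _ _ _ (by decide)]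
      rcases Nat.le_succ_iff.1 hi with hi | rfl
      · exact h4 i hi
      · rw [h3, pow_succ, mul_comm]
  intro s₂ h₂ f₂
  refine Runs.of_flat rfl (by decide) ?_
  have e : s₂.nat cK 0 = K := by rw [f₂.nat cK rfl, f₁.nat cK rfl, hK]
  simp only [Prog.den, NExp.eval, e, h₂ K le_rfl]
  refine ⟨fun j hj => ?_, by simp⟩
  rw [State.putNat_nat_ne _ _ _ _ _ (by decide), h₂ j hj]

/-! ### Numbering the labels -/

/-- Give the facility `cF` the label of a previous facility with the same center and class, or else
a new one. -/
def labelOne : Prog :=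
  .setNat aLab (nv cF) (nv cM) ;;
  forN cG cF (.ite (.and (natEq (.read aSig (nv cG)) (.read aSig (nv cF)))
      (natEq (.read aCls (nv cG)) (.read aCls (nv cF))))
    (.setNat aLab (nv cF) (.read aLab (nv cG))) .skip) ;;
  .ite (.natLE (nv cM) (.read aLab (nv cF))) (.setNat cM (.lit 0) (.add (nv cM) (.lit 1))) .skip

/-- Label the facilities according to their centers and classes. -/
def labels : Prog := .setNat cM (.lit 0) (.lit 0) ;; forN cF 0 labelOne

/-- `lab` numbers the fibers of `key` on the first `n` numbers by `0`, …, `M - 1`. -/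
structure Labels (n M : ℕ) (lab : ℕ → ℕ) (key : ℕ → ℕ × ℕ) : Prop where
  lt : ∀ i < n, lab i < M
  iff : ∀ i < n, ∀ j < n, lab i = lab j ↔ key i = key j
  surj : ∀ x < M, ∃ i < n, lab i = x

/-- Only labels that occur are numbered, so `M` counts realized keys. With centers and classes as
the two components this gives the base of the exponential factor. -/
theorem Labels.le_of_maps {n M : ℕ} {lab : ℕ → ℕ} {key : ℕ → ℕ × ℕ} (h : Labels n M lab key)
    {a b : ℕ} (hk : ∀ i < n, (key i).1 < a ∧ (key i).2 < b) : M ≤ a * b := by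
  have h' : ∀ x, ∃ i, x < M → i < n ∧ lab i = x := by
    intro x
    by_cases hx : x < M
    · obtain ⟨i, hi⟩ := h.surj x hx; exact ⟨i, fun _ => hi⟩
    · exact ⟨0, fun h => absurd h hx⟩
  choose w hw using h'
  have := Finset.card_le_card_of_injOn (s := Finset.range M)
    (t := Finset.range a ×ˢ Finset.range b) (fun x => key (w x)) ?_ ?_
  · simpa using this
  · intro x hx
    have := hk _ (hw x (by simpa using hx)).1
    simpa using this
  · intro x hx y hy hxy
    have hx' := hw x (by simpa using hx)
    have hy' := hw y (by simpa using hy)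
    rw [← hx'.2, ← hy'.2]
    exact (h.iff _ hx'.1 _ hy'.1).2 hxy

/-- A second bound, free of centers and accuracy, which keeps the loops over `M` polynomial. -/
theorem Labels.le {n M : ℕ} {lab : ℕ → ℕ} {key : ℕ → ℕ × ℕ} (h : Labels n M lab key) : M ≤ n := by
  have : Finset.range M ⊆ (Finset.range n).image lab := by
    intro x hx
    obtain ⟨i, hi, hix⟩ := h.surj x (Finset.mem_range.1 hx)
    exact Finset.mem_image.2 ⟨i, Finset.mem_range.2 hi, hix⟩
  simpa using (Finset.card_le_card this).trans Finset.card_image_le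

theorem Labels.pos {n M : ℕ} {lab : ℕ → ℕ} {key : ℕ → ℕ × ℕ} (h : Labels n M lab key)
    (hn : 0 < n) : 0 < M := (Nat.zero_le _).trans_lt (h.lt 0 hn)

theorem Labels.congr {n M : ℕ} {lab lab' : ℕ → ℕ} {key : ℕ → ℕ × ℕ} (h : Labels n M lab key)
    (hl : ∀ i < n, lab' i = lab i) : Labels n M lab' key :=
  ⟨fun i hi => by rw [hl i hi]; exact h.lt i hi,
    fun i hi j hj => by rw [hl i hi, hl j hj]; exact h.iff i hi j hj,
    fun x hx => by obtain ⟨i, hi, e⟩ := h.surj x hx; exact ⟨i, hi, by rw [hl i hi, e]⟩⟩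

theorem Labels.extend_old {n M : ℕ} {lab : ℕ → ℕ} {key : ℕ → ℕ × ℕ} (h : Labels n M lab key)
    {i : ℕ} (hi : i < n) (hk : key i = key n) (hl : lab n = lab i) :
    Labels (n + 1) M lab key := by
  refine ⟨fun j hj => ?_, fun a ha b hb => ?_, fun x hx => ?_⟩
  · rcases Nat.lt_succ_iff_lt_or_eq.1 hj with hj | rfl
    · exact h.lt j hj
    · rw [hl]; exact h.lt i hi
  · rcases Nat.lt_succ_iff_lt_or_eq.1 ha with ha | rfl <;>
    rcases Nat.lt_succ_iff_lt_or_eq.1 hb with hb | rfl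
    · exact h.iff a ha b hb
    · rw [hl, ← hk]; exact h.iff a ha i hi
    · rw [hl, ← hk]; exact h.iff i hi b hb
    · simp
  · obtain ⟨j, hj, e⟩ := h.surj x hx; exact ⟨j, by omega, e⟩

theorem Labels.extend_new {n M : ℕ} {lab : ℕ → ℕ} {key : ℕ → ℕ × ℕ} (h : Labels n M lab key)
    (hk : ∀ i < n, key i ≠ key n) (hl : lab n = M) : Labels (n + 1) (M + 1) lab key := by
  refine ⟨fun j hj => ?_, fun a ha b hb => ?_, fun x hx => ?_⟩
  · rcases Nat.lt_succ_iff_lt_or_eq.1 hj with hj | rfl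
    · exact (h.lt j hj).trans (Nat.lt_succ_self M)
    · omega
  · rcases Nat.lt_succ_iff_lt_or_eq.1 ha with ha | rfl <;>
    rcases Nat.lt_succ_iff_lt_or_eq.1 hb with hb | rfl
    · exact h.iff a ha b hb
    · have := h.lt a ha
      exact ⟨fun e => by omega, fun e => absurd e (hk a ha)⟩
    · have := h.lt b hb
      exact ⟨fun e => by omega, fun e => absurd e.symm (hk b hb)⟩
    · simp
  · rcases Nat.lt_succ_iff_lt_or_eq.1 hx with hx | rfl
    · obtain ⟨j, hj, e⟩ := h.surj x hx; exact ⟨j, by omega, e⟩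
    · exact ⟨n, by omega, hl⟩

theorem labels_runs {s : State} {n B : ℕ} (hn : s.nat 0 0 = n) (hB : n + 1 ≤ B) :
    Runs labels s (fun s' => Labels n (s'.nat cM 0) (s'.nat aLab)
      (fun f => (s.nat aSig f, s.nat aCls f))) (B * (B * 80 + 80)) := by
  set key : ℕ → ℕ × ℕ := fun f => (s.nat aSig f, s.nat aCls f) with hkey
  refine (Runs.of_flat (T := 3) (Q := fun s' => s' = s.putNat cM 0 0) rfl (by decide) rfl).seq
    (T₂ := B * (B * 80 + 70)) ?_ (by nlinarith)
  rintro s₁ h₁ f₁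
  refine (Runs.forN (n := n) (T := B * 80 + 40) (Inv := fun f s' =>
    Labels f (s'.nat cM 0) (s'.nat aLab) key) (by rw [f₁.nat 0 rfl, hn]) rfl rfl ?_ ?_).mono
    (fun _ h _ => h) (by nlinarith)
  · simp only [ne_eq, Nat.reduceEqDiff, not_false_eq_true, State.putNat_nat_ne, h₁,
      State.putNat_nat_self, Function.update_self]
    exact ⟨by simp, by simp, by simp⟩
  · intro f hf s' hfr hv hI
    set M := s'.nat cM 0 with hM
    refine (Runs.of_flat (T := 10) (Q := fun s'' => s'' = s'.putNat aLab f M) rfl (by decide)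
      (by simp only [Prog.den, NExp.eval, hv, hM])).seq (T₂ := B * 80 + 30) ?_ (by omega)
    rintro s₂ h₂ f₂
    -- The provisional label `M` signals that no earlier facility has matched; labels already given
    -- are below `M`, so the final comparison detects a new key.
    refine (Runs.forN_flat (n := f) (T := 60) (Inv := fun g s'' =>
      (∀ i < f, s''.nat aLab i = s'.nat aLab i) ∧
      ((s''.nat aLab f = M ∧ ∀ i < g, key i ≠ key f) ∨
        ∃ i < g, key i = key f ∧ s''.nat aLab f = s'.nat aLab i))
      (by rw [f₂.nat cF rfl, hv]) rfl rfl rfl (by decide) ?_ ?_).seq (T₂ := 20) ?_ (by nlinarith)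
    · refine ⟨fun i hi => ?_, Or.inl ⟨by simp [h₂], by simp⟩⟩
      rw [State.putNat_nat_ne _ _ _ _ _ (by decide), h₂, State.putNat_nat_self,
        Function.update_of_ne hi.ne]
    · rintro g hg s'' hf' hcG ⟨hl, hI'⟩
      have hcF : s''.nat cF 0 = f := by rw [hf'.nat cF rfl, f₂.nat cF rfl, hv]
      have hsig : s''.nat aSig = s.nat aSig := by
        rw [hf'.nat aSig rfl, f₂.nat aSig rfl, hfr.nat aSig rfl, f₁.nat aSig rfl]
      have hcls : s''.nat aCls = s.nat aCls := by
        rw [hf'.nat aCls rfl, f₂.nat aCls rfl, hfr.nat aCls rfl, f₁.nat aCls rfl]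
      simp only [Prog.den, Test.Holds, NExp.eval, hcG, hcF, hsig, hcls, ← le_antisymm_iff]
      split_ifs with hc
      · have hk : key g = key f := Prod.ext hc.1 hc.2
        refine ⟨fun i hi => ?_, Or.inr ⟨g, Nat.lt_succ_self g, hk, ?_⟩⟩
        · rw [State.putNat_nat_ne _ _ _ _ _ (by decide), State.putNat_nat_self,
            Function.update_of_ne hi.ne, hl i hi]
        · simp [hl g hg]
      · have hk : key g ≠ key f := fun h => hc ⟨congrArg Prod.fst h, congrArg Prod.snd h⟩
        refine ⟨fun i hi => ?_, ?_⟩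
        · rw [State.putNat_nat_ne _ _ _ _ _ (by decide), hl i hi]
        · rw [State.putNat_nat_ne _ _ _ _ _ (by decide)]
          rcases hI' with ⟨h1, h2⟩ | ⟨i, hi, h1⟩
          · left
            refine ⟨h1, fun i hi => ?_⟩
            rcases Nat.lt_succ_iff_lt_or_eq.1 hi with hi | rfl
            · exact h2 i hi
            · exact hk
          · exact Or.inr ⟨i, hi.trans (Nat.lt_succ_self g), h1⟩
    rintro s₃ ⟨hl, h₃⟩ f₃
    refine Runs.of_flat rfl (by decide) ?_
    have hcF : s₃.nat cF 0 = f := by rw [f₃.nat cF rfl, f₂.nat cF rfl, hv]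
    have hcM : s₃.nat cM 0 = M := by rw [f₃.nat cM rfl, f₂.nat cM rfl]
    have hI₃ := hI.congr hl
    simp only [Prog.den, Test.Holds, NExp.eval, hcF, hcM]
    rcases h₃ with ⟨h1, h2⟩ | ⟨i, hi, hk, h1⟩
    · rw [if_pos h1.ge]
      simpa using hI₃.extend_new h2 h1
    · rw [if_neg (by rw [h1]; exact not_le.2 (hI.lt i hi))]
      simpa [hcM] using hI₃.extend_old hi hk (by rw [h1, hl i hi])

/-! ### Classes of distances -/

/-- Round the distances `rDel` that are at most `rD` up to `rMin` times a power of `1 + rEps`; the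
exponent is the class. -/
def classes : Prog :=
  forN cF 0 (.setNat aCls (nv cF) (.lit 0) ;; .setReal rThr (.lit 0) (rv rMin) ;;
    .loop (.and (realLT (rv rThr) (.read rDel (nv cF))) (.realLE (.read rDel (nv cF)) (rv rD)))
      (.setReal rThr (.lit 0) (.mul (rv rThr) (.add (.lit 1) (rv rEps))) ;;
        .setNat aCls (nv cF) (.add (.read aCls (nv cF)) (.lit 1))))

/-- `i` is the class of the distance `x`. -/
def IsClass (D t q x : ℝ) (i : ℕ) : Prop :=
  (∀ a < i, t * q ^ a < x) ∧ (x ≤ D → x ≤ t * q ^ i)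

/-- After `L` rounds the threshold is at least `rD`, so the loop has stopped. Without logarithms or
a conversion to naturals, the exponent is found by counting multiplications. Facilities beyond `rD`
get class 0, which is harmless as they are never opened. -/
theorem classes_runs {s : State} {n L B : ℕ} (hn : s.nat 0 0 = n) (hB : n + 1 ≤ B)
    (hL : s.real rD 0 ≤ s.real rMin 0 * (1 + s.real rEps 0) ^ L) :
    Runs classes s (fun s' => ∀ f < n, s'.nat aCls f ≤ L ∧ IsClass (s.real rD 0) (s.real rMin 0)
      (1 + s.real rEps 0) (s.real rDel f) (s'.nat aCls f)) (B * ((L + 1) * 40 + 50)) := by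
  set D := s.real rD 0 with hD
  set t := s.real rMin 0 with ht
  set q := 1 + s.real rEps 0 with hq
  refine (Runs.forN (n := n) (T := (L + 1) * 40 + 20) (Inv := fun j s' => ∀ f < j,
    s'.nat aCls f ≤ L ∧ IsClass D t q (s.real rDel f) (s'.nat aCls f)) hn rfl rfl (by simp)
    ?_).mono (fun _ h _ => h) (Nat.mul_le_mul hB (by omega))
  intro j hj s' hf hv hI
  refine (Runs.of_flat (T := 5) (Q := fun s'' => s'' = s'.putNat aCls j 0) rfl (by decide)
    (by simp only [Prog.den, NExp.eval, hv])).seq (T₂ := (L + 1) * 40 + 10) ?_ (by omega)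
  rintro s₁ h₁ f₁
  refine (Runs.of_flat (T := 5) (Q := fun s'' => s'' = s₁.putReal rThr 0 t) rfl (by decide)
    ?_).seq (T₂ := (L + 1) * 40) ?_ (by omega)
  · simp only [Prog.den, NExp.eval, RExp.eval]
    rw [f₁.real rMin rfl, hf.real rMin rfl]
  rintro s₂ h₂ f₂
  refine (Runs.loop L 25 (fun i s'' => s''.nat aCls j = i ∧ i ≤ L ∧ s''.real rThr 0 = t * q ^ i ∧
    (∀ a < i, t * q ^ a < s.real rDel j) ∧ ∀ f < j, s''.nat aCls f = s'.nat aCls f) ?_ ?_).mono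
    ?_ ?_
  · refine ⟨by simp [h₂, h₁], Nat.zero_le L, by simp [h₂], by simp, fun f hf => ?_⟩
    rw [h₂, State.putReal_nat, h₁, State.putNat_nat_self, Function.update_of_ne hf.ne]
  · rintro i s'' hf' ⟨c1, c0, c2, c3, c4⟩ hb
    have hcF : s''.nat cF 0 = j := by rw [hf'.nat cF rfl, f₂.nat cF rfl, f₁.nat cF rfl, hv]
    have e1 : s''.real rDel = s.real rDel := by
      rw [hf'.real _ rfl, f₂.real _ rfl, f₁.real _ rfl, hf.real _ rfl]
    have e2 : s''.real rD = s.real rD := by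
      rw [hf'.real _ rfl, f₂.real _ rfl, f₁.real _ rfl, hf.real _ rfl]
    have e3 : s''.real rEps = s.real rEps := by
      rw [hf'.real _ rfl, f₂.real _ rfl, f₁.real _ rfl, hf.real _ rfl]
    simp only [Test.Holds, NExp.eval, RExp.eval, hcF, e1, e2, c2, not_le, ← hD] at hb
    have hiL : i < L := by
      rcases c0.lt_or_eq with h | rfl
      · exact h
      · linarith [hb.1, hb.2]
    refine ⟨hiL, Runs.of_flat rfl (by decide) ?_⟩
    simp only [Prog.den, NExp.eval, RExp.eval, State.putReal_nat, hcF, c1, c2, e3, Nat.cast_one,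
      ← hq]
    refine ⟨by simp, hiL, ?_, fun a ha => ?_, fun f hf => ?_⟩
    · simp [pow_succ, mul_assoc]
    · rcases Nat.lt_succ_iff_lt_or_eq.1 ha with ha | rfl
      · exact c3 a ha
      · exact hb.1
    · rw [State.putNat_nat_self, Function.update_of_ne hf.ne, State.putReal_nat, c4 f hf]
  · rintro s'' ⟨⟨i, c1, c0, c2, c3, c4⟩, hb⟩ hf' f hfj
    have hcF : s''.nat cF 0 = j := by rw [hf'.nat cF rfl, f₂.nat cF rfl, f₁.nat cF rfl, hv]
    have e1 : s''.real rDel = s.real rDel := by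
      rw [hf'.real _ rfl, f₂.real _ rfl, f₁.real _ rfl, hf.real _ rfl]
    have e2 : s''.real rD = s.real rD := by
      rw [hf'.real _ rfl, f₂.real _ rfl, f₁.real _ rfl, hf.real _ rfl]
    simp only [Test.Holds, NExp.eval, RExp.eval, hcF, e1, e2, c2, not_le, ← hD] at hb
    rw [State.putNat_nat_ne _ _ _ _ _ (by decide)]
    rcases Nat.lt_succ_iff_lt_or_eq.1 hfj with hfj | rfl
    · rw [c4 f hfj]; exact hI f hfj
    · rw [c1]
      refine ⟨c0, c3, fun hx => ?_⟩
      by_contra hlt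
      exact hb ⟨not_le.1 hlt, hx⟩
  · simp only [Test.cost, NExp.cost, RExp.cost]
    exact Nat.mul_le_mul_left _ (by norm_num)

/-- For a positive class, `y ≤ t * q ^ (i + 1) ≤ q * x`. In class 0 only `y ≤ t` is known; this
accounts for the additive term. -/
theorem IsClass.le_of_eq {D t q x y : ℝ} {i : ℕ} (hq : 0 ≤ q) (ht : 0 ≤ t) (hx0 : 0 ≤ x)
    (hx : IsClass D t q x i) (hy : IsClass D t q y i) (hyD : y ≤ D) : y ≤ q * x + t := by
  rcases i with _ | i
  · have := hy.2 hyD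
    rw [pow_zero, mul_one] at this
    nlinarith [mul_nonneg hq hx0]
  · have h1 := hy.2 hyD
    have h2 := hx.1 i (Nat.lt_succ_self i)
    have h3 := mul_le_mul_of_nonneg_left h2.le hq
    rw [pow_succ] at h1
    linarith

/-! ### The cost of exchanging facilities -/

/-- `σ` and `δ` are the nearest centers of the facilities and the distances to them. -/
structure Problem.Nearest (p : Problem) (σ : ℕ → ℕ) (δ : ℕ → ℝ) : Prop where
  nonneg : ∀ f < p.nF, 0 ≤ δ f
  le : ∀ c < p.nC, ∀ f < p.nF, δ f ≤ p.C c f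
  exchange : ∀ c < p.nC, ∀ f < p.nF, ∀ g < p.nF, σ f = σ g → p.C c g ≤ p.C c f - δ f + δ g

/-- The approximation argument, to be applied to an arbitrary feasible `Y` whose farthest used
facility is `e`. Loads carry over because the exchange is injective. It matters that `e` is used and
not merely open: some client then pays for `δ e`. -/
theorem Problem.Nearest.exists_greedy {p : Problem} {σ lab cls : ℕ → ℕ} {δ : ℕ → ℝ} {M e n : ℕ}
    {ε : ℝ} (hN : p.Nearest σ δ) (hε : 0 < ε) (hn : 0 < n) (hnC : p.nC ≤ n)
    (hcls : ∀ f < p.nF, IsClass (δ e) (ε / 2 * δ e / n) (1 + ε / 2) (δ f) (cls f))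
    (hlab : Labels p.nF M lab fun f => (σ f, cls f)) {Y : ℕ → ℕ}
    (hY : ∀ c < p.nC, Y c < p.nF) (hl : ∀ f < p.nF, load p.nC Y f ≤ p.u f)
    (hcard : ((Finset.range p.nC).image Y).card ≤ p.K)
    (he : e ∈ (Finset.range p.nC).image Y)
    (hmax : ∀ f ∈ (Finset.range p.nC).image Y, δ f ≤ δ e) :
    ∃ t < M ^ p.K, ∃ Z, p.Assigns (greedy p.nF p.u lab (fun f => δ f ≤ δ e)
      (fun j => t / M ^ (p.K - 1 - j) % M) p.K) Z ∧ p.cost Z ≤ (1 + ε) * p.cost Y := by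
  set U := (Finset.range p.nC).image Y with hU
  have hUF : ∀ f ∈ U, f < p.nF := by
    intro f hf
    obtain ⟨c, hc, rfl⟩ := Finset.mem_image.1 hf
    exact hY c (Finset.mem_range.1 hc)
  have hYU : ∀ c < p.nC, Y c ∈ U := fun c hc => Finset.mem_image_of_mem _ (Finset.mem_range.2 hc)
  have heF := hUF e he
  obtain ⟨dig, hdig, ψ, hinj, hψ⟩ := exists_greedy_dominating p.nF p.u lab (fun f => δ f ≤ δ e)
    (hlab.pos (by omega)) (fun f hf => ⟨hUF f hf, hmax f hf, hlab.lt f (hUF f hf)⟩) hcard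
  obtain ⟨t, ht, htd⟩ := exists_digits dig fun j _ => hdig j
  rw [← greedy_congr p.nF p.u lab (fun f => δ f ≤ δ e) (j := p.K) htd] at hψ
  refine ⟨t, ht, fun c => ψ (Y c), ⟨fun c hc => (hψ _ (hYU c hc)).1, fun g hg => ?_⟩, ?_⟩
  · by_cases h : ∃ f ∈ U, ψ f = g
    · obtain ⟨f, hf, rfl⟩ := h
      refine le_trans (le_of_eq ?_) ((hl f (hUF f hf)).trans (hψ f hf).2.2)
      rw [load, load]
      congr 1
      refine Finset.filter_congr fun c hc => ⟨fun h => ?_, fun h => by rw [h]⟩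
      exact hinj (hYU c (Finset.mem_range.1 hc)) hf h
    · rw [load, Finset.filter_eq_empty_iff.2]
      · simp
      · exact fun c hc hcg => h ⟨_, hYU c (Finset.mem_range.1 hc), hcg⟩
  · set t₀ := ε / 2 * δ e / n with ht₀
    have hn' : (0 : ℝ) < n := by exact_mod_cast hn
    have hδe := hN.nonneg e heF
    have ht₀0 : 0 ≤ t₀ := by positivity
    -- The exchange costs at most `δ (ψ (Y c)) - δ (Y c)`. Equality of the classes bounds this by `ε
    -- / 2 * δ (Y c) + t₀`, and `δ (Y c)` is at most the cost of the client.
    have hstep : ∀ c ∈ Finset.range p.nC, p.C c (ψ (Y c)) ≤ (1 + ε / 2) * p.C c (Y c) + t₀ := by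
      intro c hc
      rw [Finset.mem_range] at hc
      have hYc := hY c hc
      obtain ⟨h1, h2, -⟩ := hψ _ (hYU c hc)
      obtain ⟨h3, h4⟩ := greedy_subset _ _ _ _ _ _ _ h1
      have hk := (hlab.iff _ h3 _ hYc).1 h2
      have hk1 : σ (ψ (Y c)) = σ (Y c) := congrArg Prod.fst hk
      have hk2 : cls (ψ (Y c)) = cls (Y c) := congrArg Prod.snd hk
      have h5 := hN.exchange c hc _ hYc _ h3 hk1.symm
      have h6 := IsClass.le_of_eq (by linarith) ht₀0 (hN.nonneg _ hYc) (hcls _ hYc)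
        (hk2 ▸ hcls _ h3) h4
      have h7 := hN.le c hc _ hYc
      nlinarith
    have hpos : ∀ c ∈ Finset.range p.nC, 0 ≤ p.C c (Y c) := fun c hc => by
      rw [Finset.mem_range] at hc
      exact (hN.nonneg _ (hY c hc)).trans (hN.le c hc _ (hY c hc))
    -- A single client served by `e` already pays at least `δ e`.
    have hD : δ e ≤ p.cost Y := by
      obtain ⟨c, hc, hce⟩ := Finset.mem_image.1 he
      refine le_trans ?_ (Finset.single_le_sum hpos hc)
      have := hN.le c (Finset.mem_range.1 hc) e heF
      rwa [← hce] at this ⊢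
    have h1 : p.cost (fun c => ψ (Y c)) ≤ (1 + ε / 2) * p.cost Y + p.nC * t₀ := by
      refine (Finset.sum_le_sum hstep).trans (le_of_eq ?_)
      rw [Finset.sum_add_distrib, ← Finset.mul_sum]
      simp [Problem.cost]
    have h2 : (p.nC : ℝ) * t₀ ≤ ε / 2 * δ e := by
      have : (p.nC : ℝ) ≤ n := by exact_mod_cast hnC
      calc (p.nC : ℝ) * t₀ ≤ n * t₀ := mul_le_mul_of_nonneg_right this ht₀0
        _ = ε / 2 * δ e := by rw [ht₀]; field_simp
    nlinarith

/-! ### Guessing the farthest facility -/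

/-- Try all solutions whose open facilities are at most as far from their centers as the facility
`cE`. -/
def guess : Prog :=
  .setReal rD (.lit 0) (.read rDel (nv cE)) ;;
  .setReal rMin (.lit 0) (.div (.mul (rv rEps) (rv rD)) (rv rSize)) ;;
  classes ;; labels ;; powers ;; tryAll

/-- `Q` dominates both the number of label sequences and the number of classes, so that the time is
`Q` times a polynomial in `B`. -/
theorem guess_runs {s : State} {p : Problem} {ε : ℝ} {e n L a B Q : ℕ} (hs : s.Has p)
    (hV : s.Valid p) (hN : p.Nearest (s.nat aSig) (s.real rDel)) (hε : 0 < ε) (hn : 0 < n)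
    (hnC : p.nC ≤ n) (heps : s.real rEps 0 = ε / 2) (hsize : s.real rSize 0 = n)
    (hL : (n : ℝ) ≤ ε / 2 * (1 + ε / 2) ^ L) (hcE : s.nat cE 0 = e) (heF : e < p.nF)
    (hsig : ∀ f < p.nF, s.nat aSig f < a)
    (hB : p.nF + 1 ≤ B) (hB' : p.nC + 1 ≤ B) (hK : p.K + 1 ≤ B) (hLQ : L + 1 ≤ Q)
    (hQ : (a * (L + 1)) ^ p.K ≤ Q) :
    Runs guess s (fun s' => s'.Valid p ∧ (∀ y, s.Beats y → s'.Beats y) ∧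
      ∀ Y : ℕ → ℕ, (∀ c < p.nC, Y c < p.nF) → (∀ f < p.nF, load p.nC Y f ≤ p.u f) →
        ((Finset.range p.nC).image Y).card ≤ p.K → e ∈ (Finset.range p.nC).image Y →
        (∀ f ∈ (Finset.range p.nC).image Y, s.real rDel f ≤ s.real rDel e) →
        s'.Beats ((1 + ε) * p.cost Y)) (Q * (4000 * B ^ 4)) := by
  have hB1 : 1 ≤ B := by omega
  have hB2 : B ≤ B ^ 4 := by nlinarith [Nat.pow_le_pow_right hB1 (show 1 ≤ 4 by norm_num)]
  have hB3 : B * B ≤ B ^ 4 := by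
    rw [← pow_two]; exact Nat.pow_le_pow_right hB1 (by norm_num)
  have hn' : (0 : ℝ) < n := by exact_mod_cast hn
  set D := s.real rDel e with hD
  refine (Runs.of_flat (T := 5) (Q := fun s' => s' = s.putReal rD 0 D) rfl (by decide)
    (by simp only [Prog.den, NExp.eval, RExp.eval, hcE, hD])).seq
    (T₂ := Q * (3990 * B ^ 4)) ?_ (by nlinarith)
  rintro s₁ h₁ f₁
  refine (Runs.of_flat (T := 10) (Q := fun s' => s' = s₁.putReal rMin 0 (ε / 2 * D / n)) rfl
    (by decide) ?_).seq (T₂ := Q * (3980 * B ^ 4)) ?_ (by nlinarith)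
  · simp only [Prog.den, NExp.eval, RExp.eval]
    rw [f₁.real rEps rfl, f₁.real rSize rfl, heps, hsize, h₁]
    simp
  rintro s₂ h₂ f₂
  have hs₂ := (hs.of_frame f₁ rfl).of_frame f₂ rfl
  have e1 : s₂.real rD 0 = D := by rw [f₂.real rD rfl, h₁]; simp
  have e2 : s₂.real rMin 0 = ε / 2 * D / n := by rw [h₂]; simp
  have e3 : s₂.real rEps 0 = ε / 2 := by rw [f₂.real rEps rfl, f₁.real rEps rfl, heps]
  have e4 : s₂.real rDel = s.real rDel := by rw [f₂.real rDel rfl, f₁.real rDel rfl]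
  have hD0 : 0 ≤ D := hN.nonneg e heF
  refine (classes_runs (L := L) (B := B) hs₂.nF hB ?_).seq (T₂ := Q * (3800 * B ^ 4)) ?_ ?_
  -- Scaled by `D / n`, `hL` says that `L` factors `1 + ε / 2` lead from `rMin` to at least `D`.
  · rw [e1, e2, e3]
    rw [div_mul_eq_mul_div, le_div_iff₀ hn']
    nlinarith [mul_le_mul_of_nonneg_left hL hD0]
  swap
  · have := Nat.mul_le_mul hB2 hLQ
    nlinarith [Nat.mul_le_mul hB2 (show 1 ≤ Q by omega)]
  intro s₃ h₃ f₃
  rw [e1, e2, e3, e4] at h₃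
  have hs₃ := hs₂.of_frame f₃ rfl
  refine (labels_runs (B := B) hs₃.nF hB).seq (T₂ := Q * (3600 * B ^ 4)) ?_
    (by nlinarith [Nat.mul_le_mul hB3 (show 1 ≤ Q by omega)])
  intro s₄ h₄ f₄
  have e5 : s₃.nat aSig = s.nat aSig := by
    rw [f₃.nat aSig rfl, f₂.nat aSig rfl, f₁.nat aSig rfl]
  rw [e5] at h₄
  set M := s₄.nat cM 0 with hM
  have hMF : M ≤ p.nF := h₄.le
  have hMQ : M ^ p.K ≤ Q := by
    refine (Nat.pow_le_pow_left (h₄.le_of_maps fun f hf => ⟨hsig f hf, ?_⟩) _).trans hQ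
    exact Nat.lt_succ_of_le (h₃ f hf).1
  have hs₄ := hs₃.of_frame f₄ rfl
  refine (powers_runs (B := B) hM.symm hs₄.K (by omega) hK).seq (T₂ := Q * (3400 * B ^ 4)) ?_
    (by nlinarith [Nat.mul_le_mul hB3 (show 1 ≤ Q by omega)])
  rintro s₅ ⟨h₅, h₅'⟩ f₅
  have hs₅ := hs₄.of_frame f₅ rfl
  have k : ∀ x, x ≠ aCls → x ≠ cF → x ≠ aLab → x ≠ cM → x ≠ cG → x ≠ aPw → x ≠ cJ → x ≠ cI →
      x ≠ cCnt → s₅.nat x = s.nat x := by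
    intro x k1 k2 k3 k4 k5 k6 k7 k8 k9
    rw [f₅.nat x, f₄.nat x, f₃.nat x, f₂.nat x rfl, f₁.nat x rfl] <;>
      simp [classes, labels, labelOne, powers, Prog.writesNat, k1, k2, k3, k4, k5, k6, k7, k8, k9]
  have kr : ∀ x, x ≠ rThr → s₅.real x = s₂.real x := by
    intro x k1
    rw [f₅.real x rfl, f₄.real x rfl, f₃.real x]
    simp [classes, Prog.writesReal, k1]
  have kb : s₅.real rBest = s.real rBest := by
    rw [kr _ (by decide), f₂.real _ rfl, f₁.real _ rfl]
  have kF : s₅.nat aFlag = s.nat aFlag := by rw [k] <;> decide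
  have hV₅ : s₅.Valid p := by
    rw [State.Valid, kF, kb, k aOpen, k aAsg] <;> first | exact hV | decide
  refine (tryAll_runs (M := M) (B := B) hs₅ (fun c hc f hf =>
    (hN.nonneg f hf).trans (hN.le c hc f hf)) hV₅ (h₄.pos (by omega)) (fun j hj => h₅ j hj.le) h₅'
    (by omega) hB hB' hK).mono ?_ ?_
  swap
  · have : M ^ p.K + 1 ≤ Q * 2 := by omega
    calc (M ^ p.K + 1) * (1700 * B ^ 4) ≤ (Q * 2) * (1700 * B ^ 4) := Nat.mul_le_mul_right _ this
      _ = Q * (3400 * B ^ 4) := by ring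
  rintro s₆ ⟨hV₆, hm₆, hb₆⟩ -
  refine ⟨hV₆, fun y hy => hm₆ y ?_, fun Y hY hYl hYc heY hYm => ?_⟩
  · rw [State.Beats, kF, kb]; exact hy
  · obtain ⟨t, ht, Z, hZ, hZc⟩ := hN.exists_greedy hε hn hnC (fun f hf => (h₃ f hf).2) h₄ hY hYl hYc
      heY hYm
    refine (hb₆ t ht Z ?_).mono hZc
    have e6 : s₅.nat aLab = s₄.nat aLab := f₅.nat aLab rfl
    rw [e6, kr rDel (by decide), kr rD (by decide), e4, e1]
    exact hZ

/-- Try all guesses of the farthest open facility. -/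
def search : Prog := forN cE 0 guess

/-- No guess has to be recognized as correct: wrong ones leave a valid record that is no worse. For
each `Y` a correct guess is a used facility of largest `δ`; it exists because there is a client. -/
theorem search_runs {s : State} {p : Problem} {ε : ℝ} {n L a B Q : ℕ} (hs : s.Has p)
    (hV : s.Valid p) (hN : p.Nearest (s.nat aSig) (s.real rDel)) (hε : 0 < ε) (hn : 0 < n)
    (hnC : p.nC ≤ n) (hC0 : 0 < p.nC) (heps : s.real rEps 0 = ε / 2) (hsize : s.real rSize 0 = n)
    (hL : (n : ℝ) ≤ ε / 2 * (1 + ε / 2) ^ L) (hsig : ∀ f < p.nF, s.nat aSig f < a)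
    (hB : p.nF + 1 ≤ B) (hB' : p.nC + 1 ≤ B) (hK : p.K + 1 ≤ B) (hLQ : L + 1 ≤ Q)
    (hQ : (a * (L + 1)) ^ p.K ≤ Q) :
    Runs search s (fun s' => s'.Valid p ∧
      ∀ Y : ℕ → ℕ, (∀ c < p.nC, Y c < p.nF) → (∀ f < p.nF, load p.nC Y f ≤ p.u f) →
        ((Finset.range p.nC).image Y).card ≤ p.K → s'.Beats ((1 + ε) * p.cost Y))
      (B * (Q * (4000 * B ^ 4) + 15)) := by
  refine (Runs.forN (n := p.nF) (T := Q * (4000 * B ^ 4)) (Inv := fun i s' => s'.Valid p ∧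
    ∀ Y : ℕ → ℕ, (∀ c < p.nC, Y c < p.nF) → (∀ f < p.nF, load p.nC Y f ≤ p.u f) →
      ((Finset.range p.nC).image Y).card ≤ p.K → ∀ e < i, e ∈ (Finset.range p.nC).image Y →
      (∀ f ∈ (Finset.range p.nC).image Y, s.real rDel f ≤ s.real rDel e) →
      s'.Beats ((1 + ε) * p.cost Y)) hs.nF rfl rfl ?_ ?_).mono ?_ (Nat.mul_le_mul_right _ hB)
  · exact ⟨by simpa [State.Valid] using hV, by simp⟩
  · rintro i hi s' hf hcE ⟨hV', hI⟩
    have eD : s'.real rDel = s.real rDel := hf.real rDel rfl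
    have eS : s'.nat aSig = s.nat aSig := hf.nat aSig rfl
    refine (guess_runs (n := n) (L := L) (a := a) (B := B) (Q := Q) (hs.of_frame hf rfl) hV'
      (by rw [eS, eD]; exact hN) hε hn hnC (by rw [hf.real rEps rfl, heps])
      (by rw [hf.real rSize rfl, hsize]) hL hcE hi (by rw [eS]; exact hsig) hB hB' hK hLQ hQ).mono
      ?_ le_rfl
    rintro s'' ⟨hV'', hm, hb⟩ -
    refine ⟨by simpa [State.Valid] using hV'', fun Y hY hYl hYc e he heY hYm => ?_⟩
    have : s''.Beats ((1 + ε) * p.cost Y) := by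
      rcases Nat.lt_succ_iff_lt_or_eq.1 he with he | rfl
      · exact hm _ (hI Y hY hYl hYc e he heY hYm)
      · exact hb Y hY hYl hYc heY (by rw [eD]; exact hYm)
    simpa [State.Beats] using this
  · rintro s' ⟨hV', hI⟩ -
    refine ⟨hV', fun Y hY hYl hYc => ?_⟩
    obtain ⟨e, he, hmax⟩ := Finset.exists_max_image ((Finset.range p.nC).image Y) (s.real rDel)
      ⟨Y 0, Finset.mem_image_of_mem _ (Finset.mem_range.2 hC0)⟩
    refine hI Y hY hYl hYc e ?_ he hmax
    obtain ⟨c, hc, rfl⟩ := Finset.mem_image.1 he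
    exact hY c (Finset.mem_range.1 hc)

/-! ### Nearest centers and preparation of the input -/

/-- The distance of facility `f` and center `x`. -/
abbrev centerE (f x : NExp) : RExp := .read rDist (.add (.read aRow f) (.add (nv cSize) x))

/-- Find the nearest centers of the facilities. -/
def nearest : Prog :=
  forN cF 0 (.setNat aSig (nv cF) (.lit 0) ;; .setReal rDel (nv cF) (centerE (nv cF) (.lit 0)) ;;
    forN cG cNS (.ite (realLT (centerE (nv cF) (nv cG)) (.read rDel (nv cF)))
      (.setNat aSig (nv cF) (nv cG) ;; .setReal rDel (nv cF) (centerE (nv cF) (nv cG))) .skip))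

/-- The center `x` is a nearest one among the first `m` centers, at distance `r`. -/
def IsNearest (W : ℕ → ℝ) (m x : ℕ) (r : ℝ) : Prop := r = W x ∧ ∀ y < m, r ≤ W y

/-- Center 0 is the initial candidate, hence `0 < m`. -/
theorem nearest_runs {s : State} {n m B : ℕ} (hn : s.nat 0 0 = n) (hm : s.nat cNS 0 = m)
    (hm0 : 0 < m) (hB : n + 1 ≤ B) :
    Runs nearest s (fun s' => ∀ f < n, s'.nat aSig f < m ∧
      IsNearest (fun x => s.real rDist (s.nat aRow f + (s.nat cSize 0 + x))) m (s'.nat aSig f)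
        (s'.real rDel f)) (B * ((m + 1) * 100 + 50)) := by
  refine (Runs.forN (n := n) (T := (m + 1) * 100 + 30) (Inv := fun j s' => ∀ f < j,
    s'.nat aSig f < m ∧ IsNearest (fun x => s.real rDist (s.nat aRow f + (s.nat cSize 0 + x))) m
      (s'.nat aSig f) (s'.real rDel f)) hn rfl rfl (by simp) ?_).mono (fun _ h _ => h)
      (Nat.mul_le_mul hB (by omega))
  intro j hj s' hf hv hI
  set W : ℕ → ℝ := fun x => s.real rDist (s.nat aRow j + (s.nat cSize 0 + x)) with hW
  refine (Runs.of_flat (T := 5) (Q := fun s'' => s'' = s'.putNat aSig j 0) rfl (by decide)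
    (by simp only [Prog.den, NExp.eval, hv])).seq (T₂ := (m + 1) * 100 + 20) ?_ (by omega)
  rintro s₁ h₁ f₁
  refine (Runs.of_flat (T := 15) (Q := fun s'' => s'' = s₁.putReal rDel j (W 0)) rfl (by decide)
    ?_).seq (T₂ := (m + 1) * 100) ?_ (by omega)
  · simp only [Prog.den, NExp.eval, RExp.eval]
    rw [f₁.nat cF rfl, hv, f₁.nat aRow rfl, hf.nat aRow rfl, f₁.nat cSize rfl, hf.nat cSize rfl,
      f₁.real rDist rfl, hf.real rDist rfl]
  rintro s₂ h₂ f₂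
  refine (Runs.forN_flat (n := m) (T := 50) (Inv := fun g s'' => s''.nat aSig j < m ∧
    IsNearest W g (s''.nat aSig j) (s''.real rDel j) ∧
    ∀ f < j, s''.nat aSig f = s'.nat aSig f ∧ s''.real rDel f = s'.real rDel f) ?_ rfl rfl rfl
    (by decide) ?_ ?_).mono ?_ (by omega)
  · rw [f₂.nat cNS rfl, f₁.nat cNS rfl, hf.nat cNS rfl, hm]
  · refine ⟨by simpa [h₂, h₁] using hm0, ⟨by simp [h₂, h₁], by simp⟩, fun f hf => ?_⟩
    have := hf.ne
    simp [h₂, h₁, this]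
  · rintro g hg s'' hf' hcG ⟨i1, ⟨i2, i3⟩, i4⟩
    have hcF : s''.nat cF 0 = j := by rw [hf'.nat cF rfl, f₂.nat cF rfl, f₁.nat cF rfl, hv]
    have hWg : s''.real rDist (s''.nat aRow j + (s''.nat cSize 0 + g)) = W g := by
      rw [hf'.nat aRow rfl, f₂.nat aRow rfl, f₁.nat aRow rfl, hf.nat aRow rfl, hf'.nat cSize rfl,
        f₂.nat cSize rfl, f₁.nat cSize rfl, hf.nat cSize rfl, hf'.real rDist rfl, f₂.real rDist rfl,
        f₁.real rDist rfl, hf.real rDist rfl]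
    simp only [Prog.den, Test.Holds, NExp.eval, RExp.eval, hcF, hcG, hWg, not_le, ne_eq,
      Nat.reduceEqDiff, not_false_eq_true, State.putNat_nat_ne, State.putNat_real]
    split_ifs with hc
    · refine ⟨by simpa using hg, ⟨by simp, fun y hy => ?_⟩, fun f hf => ?_⟩
      · simp only [State.putNat_real, State.putReal_real_self, Function.update_self]
        rcases Nat.lt_succ_iff_lt_or_eq.1 hy with hy | rfl
        · exact hc.le.trans (i3 y hy)
        · exact le_rfl
      · have := hf.ne
        simpa [this] using i4 f hf
    · refine ⟨by simpa using i1, ⟨by simpa using i2, fun y hy => ?_⟩, fun f hf => ?_⟩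
      · rcases Nat.lt_succ_iff_lt_or_eq.1 hy with hy | rfl
        · exact i3 y hy
        · exact not_lt.1 hc
      · simpa using i4 f hf
  · rintro s'' ⟨i1, i2, i3⟩ - f hfj
    simp only [ne_eq, Nat.reduceEqDiff, not_false_eq_true, State.putNat_nat_ne, State.putNat_real]
    rcases Nat.lt_succ_iff_lt_or_eq.1 hfj with hfj | rfl
    · rw [(i3 f hfj).1, (i3 f hfj).2]; exact hI f hfj
    · exact ⟨i1, i2⟩

/-- Compute the sizes, the accuracy that is used, and the offsets of the rows of the distance
matrix. -/
def setup : Prog :=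
  (.setNat cNS (.lit 0) (.read 0 (.lit 2)) ;; .setNat cSize (.lit 0) (.add (nv 0) (nv cNC)) ;;
    .setNat cNodes (.lit 0) (.add (nv cSize) (nv cNS)) ;;
    .ite (.natLE (.read 0 (.lit 3)) (nv 0)) (.setNat cK (.lit 0) (.read 0 (.lit 3)))
      (.setNat cK (.lit 0) (nv 0)) ;;
    .setReal rEps (.lit 0) (.div (rv 0) (.lit 2))) ;;
  forN cI cSize (.setReal rSize (.lit 0) (.add (rv rSize) (.lit 1))) ;;
  forN cI cSize (.setNat aRow (.add (nv cI) (.lit 1)) (.add (.read aRow (nv cI)) (nv cNodes)))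

/-- The approximation algorithm. -/
def algorithm : Prog :=
  .setNat cNC (.lit 0) (.read 0 (.lit 1)) ;;
  .ite (.natLE (nv cNC) (.lit 0)) (.setNat aFlag (.lit 0) (.lit 1))
    (.ite (.natLE (.read 0 (.lit 3)) (.lit 0)) .skip (setup ;; nearest ;; search))

/-- What `setup` has computed. -/
structure IsSetup (s : State) (I : CKM) (ε : ℝ) : Prop where
  nF : s.nat 0 0 = I.nF
  nC : s.nat cNC 0 = I.nC
  nS : s.nat cNS 0 = I.nS
  K : s.nat cK 0 = min I.k I.nF
  size : s.nat cSize 0 = I.size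
  flag : s.nat aFlag 0 = 0
  cap : s.nat aCap = (I.input ε).nat aCap
  eps : s.real rEps 0 = ε / 2
  rsize : s.real rSize 0 = I.size
  dist : s.real rDist = (I.input ε).real rDist
  row : ∀ i ≤ I.size, s.nat aRow i = i * I.numNodes

/-- Naturals cannot be converted to reals, so the real number `n` is obtained by counting; row
offsets come from repeated addition. Replacing `k` by `min k nF` keeps the work per label sequence
polynomial in `n`. -/
theorem setup_runs {s : State} {I : CKM} {ε : ℝ} {B : ℕ}
    (hs : s = (I.input ε).putNat cNC 0 I.nC) (hB : I.size + 1 ≤ B) :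
    Runs setup s (fun s' => IsSetup s' I ε) (B * 200) := by
  refine (Runs.of_flat (T := 60) (Q := fun s' => s'.nat 0 0 = I.nF ∧ s'.nat cNC 0 = I.nC ∧
    s'.nat cNS 0 = I.nS ∧ s'.nat cK 0 = min I.k I.nF ∧ s'.nat cSize 0 = I.size ∧
    s'.nat cNodes 0 = I.numNodes ∧ s'.real rEps 0 = ε / 2) rfl (by decide) ?_).seq
    (T₂ := B * 140) ?_ (by omega)
  · simp only [Prog.den, Test.Holds, NExp.eval, RExp.eval, hs]
    have hmin : min I.k I.nF = if I.k ≤ I.nF then I.k else I.nF := by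
      split_ifs with h
      · exact min_eq_left h
      · exact min_eq_right (le_of_not_ge h)
    rw [hmin]
    simp only [ne_eq, Nat.reduceEqDiff, not_false_eq_true, State.putNat_nat_ne,
      State.putNat_nat_self, Function.update_self]
    split_ifs with h h' h' <;> simp_all [CKM.input, CKM.size, CKM.numNodes, add_assoc]
  rintro s₁ ⟨a1, a2, a3, a4, a5, a6, a7⟩ f₁
  refine (Runs.forN_flat (n := I.size) (T := 10) (Inv := fun i s' => s'.real rSize 0 = i) a5 rfl rfl
    rfl (by decide) ?_ ?_).seq (T₂ := B * 100) ?_ (by omega)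
  · rw [State.putNat_real, f₁.real rSize rfl, hs]
    simp [CKM.input]
  · intro i hi s' hf hv hI
    simp only [Prog.den, NExp.eval, RExp.eval, hI]
    simp
  intro s₂ h₂ f₂
  refine (Runs.forN_flat (n := I.size) (T := 20) (Inv := fun i s' => ∀ j ≤ i,
    s'.nat aRow j = j * I.numNodes) (by rw [f₂.nat cSize rfl, a5]) rfl rfl rfl (by decide)
    ?_ ?_).mono ?_ (by omega)
  · intro j hj
    rw [State.putNat_nat_ne _ _ _ _ _ (by decide), f₂.nat aRow rfl, f₁.nat aRow rfl, hs,
      Nat.le_zero.1 hj]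
    simp [CKM.input]
  · intro i hi s' hf hv hI j hj
    have e : s'.nat cNodes 0 = I.numNodes := by rw [hf.nat cNodes rfl, f₂.nat cNodes rfl, a6]
    simp only [Prog.den, NExp.eval, hv, e, hI i le_rfl]
    rw [State.putNat_nat_ne _ _ _ _ _ (by decide), State.putNat_nat_self, Function.update_apply]
    split_ifs with h
    · rw [h, Nat.succ_mul]
    · exact hI j (by omega)
  · intro s₃ h₃ f₃
    refine ⟨?_, ?_, ?_, ?_, ?_, ?_, ?_, ?_, ?_, ?_, h₃⟩
    · rw [f₃.nat 0 rfl, f₂.nat 0 rfl, a1]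
    · rw [f₃.nat cNC rfl, f₂.nat cNC rfl, a2]
    · rw [f₃.nat cNS rfl, f₂.nat cNS rfl, a3]
    · rw [f₃.nat cK rfl, f₂.nat cK rfl, a4]
    · rw [f₃.nat cSize rfl, f₂.nat cSize rfl, a5]
    · rw [f₃.nat aFlag rfl, f₂.nat aFlag rfl, f₁.nat aFlag rfl, hs]
      simp [CKM.input]
    · rw [f₃.nat aCap rfl, f₂.nat aCap rfl, f₁.nat aCap rfl, hs]
      simp
    · rw [f₃.real rEps rfl, f₂.real rEps rfl, a7]
    · rw [f₃.real rSize rfl, h₂]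
    · rw [f₃.real rDist rfl, f₂.real rDist rfl, f₁.real rDist rfl, hs]
      simp

end RealRAM

/-! ### Reading the distance matrix -/

namespace CKM

open RealRAM

variable {I : CKM} {ε : ℝ}

theorem input_dist {i j : ℕ} (hi : i < I.numNodes) (hj : j < I.numNodes) :
    (I.input ε).real rDist (i * I.numNodes + j) = I.d (I.node ⟨i, hi⟩) (I.node ⟨j, hj⟩) := by
  have h : i * I.numNodes + j < I.numNodes * I.numNodes := by nlinarith
  have e : finProdFinEquiv.symm ⟨i * I.numNodes + j, h⟩ = (⟨i, hi⟩, ⟨j, hj⟩) := by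
    rw [Equiv.symm_apply_eq]
    ext
    simp [finProdFinEquiv, add_comm, mul_comm]
  simp only [input, one_ne_zero, if_false, if_true, dif_pos h, e]

theorem node_facility {f : ℕ} (hf : f < I.nF) (h : f < I.numNodes) :
    I.node ⟨f, h⟩ = I.facility ⟨f, hf⟩ := by
  change Sum.map id _ (finSumFinEquiv.symm (Fin.castAdd (I.nC + I.nS) ⟨f, hf⟩)) = _
  rw [finSumFinEquiv_symm_apply_castAdd]
  rfl

theorem node_client {c : ℕ} (hc : c < I.nC) (h : I.nF + c < I.numNodes) :
    I.node ⟨I.nF + c, h⟩ = I.client ⟨c, hc⟩ := by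
  change Sum.map id finSumFinEquiv.symm (finSumFinEquiv.symm
    (Fin.natAdd I.nF (Fin.castAdd I.nS ⟨c, hc⟩))) = _
  rw [finSumFinEquiv_symm_apply_natAdd, Sum.map_inr, finSumFinEquiv_symm_apply_castAdd]

theorem node_center {x : ℕ} (hx : x < I.nS) (h : I.size + x < I.numNodes) :
    I.node ⟨I.size + x, h⟩ = I.center ⟨x, hx⟩ := by
  have e : (⟨I.size + x, h⟩ : Fin I.numNodes) = Fin.natAdd I.nF (Fin.natAdd I.nC ⟨x, hx⟩) := by
    ext; simp [size, add_assoc]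
  rw [e]
  change Sum.map id finSumFinEquiv.symm (finSumFinEquiv.symm
    (Fin.natAdd I.nF (Fin.natAdd I.nC ⟨x, hx⟩))) = _
  rw [finSumFinEquiv_symm_apply_natAdd, Sum.map_inr, finSumFinEquiv_symm_apply_natAdd]

end CKM

/-! ### From the memory to solutions of the instance -/

namespace RealRAM

variable {I : CKM} {ε : ℝ}

/-- The problem that the memory holds after `setup`. -/
noncomputable def problemOf (I : CKM) (s : State) : Problem where
  nF := I.nF
  nC := I.nC
  K := min I.k I.nF
  u := s.nat aCap
  C c f := s.real rDist (s.nat aRow (I.nF + c) + f)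

theorem IsSetup.has {s : State} (h : IsSetup s I ε) : s.Has (problemOf I s) :=
  ⟨h.nF, h.nC, h.K, rfl, fun _ _ => rfl⟩

theorem IsSetup.u_eq {s : State} (h : IsSetup s I ε) {f : ℕ} (hf : f < I.nF) :
    s.nat aCap f = I.u ⟨f, hf⟩ := by
  rw [h.cap]
  simp [CKM.input, hf]

theorem IsSetup.C_eq {s : State} (h : IsSetup s I ε) {c f : ℕ} (hc : c < I.nC) (hf : f < I.nF) :
    (problemOf I s).C c f = I.d (I.client ⟨c, hc⟩) (I.facility ⟨f, hf⟩) := by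
  have h1 : I.nF + c < I.numNodes := by rw [CKM.numNodes]; omega
  have h2 : f < I.numNodes := by rw [CKM.numNodes]; omega
  change s.real rDist (s.nat aRow (I.nF + c) + f) = _
  rw [h.dist, h.row _ (by rw [CKM.size]; omega), CKM.input_dist h1 h2,
    CKM.node_client hc, CKM.node_facility hf]

theorem IsSetup.center_eq {s : State} (h : IsSetup s I ε) {f x : ℕ} (hf : f < I.nF)
    (hx : x < I.nS) : s.real rDist (s.nat aRow f + (s.nat cSize 0 + x)) =
      I.d (I.facility ⟨f, hf⟩) (I.center ⟨x, hx⟩) := by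
  have h1 : I.size + x < I.numNodes := by rw [CKM.numNodes, CKM.size]; omega
  have h2 : f < I.numNodes := by rw [CKM.numNodes]; omega
  rw [h.dist, h.row _ (by rw [CKM.size]; omega), h.size, CKM.input_dist h2 h1,
    CKM.node_facility hf, CKM.node_center hx]

theorem IsSetup.nearest {s : State} {ℓ : ℕ} (h : IsSetup s I ε) (hI : I.IsCentered ℓ)
    {σ : ℕ → ℕ} {δ : ℕ → ℝ} (H : ∀ f < I.nF, σ f < I.nS ∧
      IsNearest (fun x => s.real rDist (s.nat aRow f + (s.nat cSize 0 + x))) I.nS (σ f) (δ f)) :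
    (problemOf I s).Nearest σ δ := by
  have hδ : ∀ f (hf : f < I.nF), ∀ x (hx : x < I.nS), σ f = x →
      δ f = I.d (I.facility ⟨f, hf⟩) (I.center ⟨x, hx⟩) := by
    rintro f hf x hx rfl
    rw [(H f hf).2.1]
    exact h.center_eq hf hx
  have hmin : ∀ f (hf : f < I.nF) (s' : Fin I.nS),
      I.d (I.facility ⟨f, hf⟩) (I.center ⟨σ f, (H f hf).1⟩) ≤
        I.d (I.facility ⟨f, hf⟩) (I.center s') := by
    intro f hf s'
    rw [← hδ f hf _ (H f hf).1 rfl, ← h.center_eq hf s'.2]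
    exact (H f hf).2.2 _ s'.2
  refine ⟨fun f hf => ?_, fun c hc f hf => ?_, fun c hc f hf g hg hσ => ?_⟩
  · rw [hδ f hf _ (H f hf).1 rfl]
    exact hI.dist_nonneg _ _
  · rw [hδ f hf _ (H f hf).1 rfl, h.C_eq hc hf]
    exact hI.nearest_le (hmin f hf) _
  · rw [hδ f hf _ (H f hf).1 rfl, hδ g hg _ (H f hf).1 hσ.symm, h.C_eq hc hf, h.C_eq hc hg]
    exact hI.dist_le_of_nearest_eq (hmin f hf) _

theorem load_eq_card_filter {n m : ℕ} {X : ℕ → ℕ} {T : Fin n → Fin m}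
    (hX : ∀ c : Fin n, X c = T c) (f : Fin m) :
    load n X f = (Finset.univ.filter fun c => T c = f).card := by
  rw [load, Finset.card_filter, Finset.sum_range, Finset.card_filter]
  refine Finset.sum_congr rfl fun c _ => ?_
  rw [hX]
  simp [Fin.ext_iff]

theorem IsSetup.cost_eq {s : State} (h : IsSetup s I ε) {X : ℕ → ℕ} {T : I.Sol}
    (hX : ∀ c : Fin I.nC, X c = T.assign c) : (problemOf I s).cost X = T.cost := by
  rw [Problem.cost, CKM.Sol.cost]
  change ∑ c ∈ Finset.range I.nC, _ = _
  rw [Finset.sum_range]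
  refine Finset.sum_congr rfl fun c _ => ?_
  rw [hX, h.C_eq c.2 (T.assign c).2]

/-- The assignment of a solution, as a function on the natural numbers. -/
def assignFun (T : I.Sol) (c : ℕ) : ℕ := if h : c < I.nC then T.assign ⟨c, h⟩ else 0

theorem assignFun_eq (T : I.Sol) (c : Fin I.nC) : assignFun T c = T.assign c := by
  simp [assignFun]

/-- A feasible solution enters through the facilities it uses; there are at most as many as it
opens. If the flag is still 0, `hb` rules out every feasible solution. -/
theorem IsSetup.isApproxOutput {s s' : State} (h : IsSetup s I ε)
    (hV : s'.Valid (problemOf I s))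
    (hb : ∀ Y : ℕ → ℕ, (∀ c < I.nC, Y c < I.nF) → (∀ f < I.nF, load I.nC Y f ≤ s.nat aCap f) →
      ((Finset.range I.nC).image Y).card ≤ min I.k I.nF →
      s'.Beats ((1 + ε) * (problemOf I s).cost Y)) : I.IsApproxOutput (1 + ε) s' := by
  have key : ∀ T : I.Sol, T.IsFeasible → s'.Beats ((1 + ε) * T.cost) := by
    rintro T ⟨hk, hm, hu⟩
    have hlt : ∀ c < I.nC, assignFun T c < I.nF := by
      intro c hc
      have := assignFun_eq T ⟨c, hc⟩
      simp only at this
      rw [this]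
      exact (T.assign ⟨c, hc⟩).2
    rw [← h.cost_eq (assignFun_eq T)]
    refine hb _ hlt (fun f hf => ?_) (le_min ?_ ?_)
    · rw [load_eq_card_filter (assignFun_eq T) ⟨f, hf⟩, h.u_eq hf]
      by_cases hfo : (⟨f, hf⟩ : Fin I.nF) ∈ T.opened
      · exact hu _ hfo
      · rw [Finset.filter_eq_empty_iff.2]
        · simp
        · intro c _ hc
          exact hfo (hc ▸ hm c)
    · refine le_trans (Finset.card_le_card (t := T.opened.image Fin.val) ?_)
        (Finset.card_image_le.trans hk)
      intro x hx
      obtain ⟨c, hc, rfl⟩ := Finset.mem_image.1 hx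
      rw [Finset.mem_range] at hc
      exact Finset.mem_image.2 ⟨_, hm ⟨c, hc⟩, (assignFun_eq T ⟨c, hc⟩).symm⟩
    · refine (Finset.card_le_card (t := Finset.range I.nF) ?_).trans (Finset.card_range _).le
      intro x hx
      obtain ⟨c, hc, rfl⟩ := Finset.mem_image.1 hx
      exact Finset.mem_range.2 (hlt c (Finset.mem_range.1 hc))
  rcases hV with h0 | ⟨h1, G, hGK, hGF, hop, hA, hbest⟩
  · right
    refine ⟨?_, h0⟩
    rintro ⟨T, hT⟩
    have := (key T hT).1
    omega
  · left
    have hlt : ∀ c : Fin I.nC, s'.nat aAsg c < I.nF := fun c => hGF _ (hA.mem c c.2)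
    let T : I.Sol := ⟨Finset.univ.filter fun f => (f : ℕ) ∈ G, fun c => ⟨s'.nat aAsg c, hlt c⟩⟩
    have hTa : ∀ c : Fin I.nC, s'.nat aAsg c = T.assign c := fun c => rfl
    refine ⟨T, ⟨h1, fun f => ?_, hTa⟩, ⟨?_, fun c => ?_, fun f hf => ?_⟩, fun T' hT' => ?_⟩
    · rw [hop f f.2]
      simp [T]
    · refine le_trans ?_ (hGK.trans (min_le_left _ _))
      refine Finset.card_le_card_of_injOn Fin.val ?_ Fin.val_injective.injOn
      intro f hf
      simpa [T] using hf
    · simpa [T] using hA.mem c c.2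
    · rw [← load_eq_card_filter hTa f]
      have hfG : (f : ℕ) ∈ G := by simpa [T] using hf
      exact (hA.load_le f hfG).trans (h.u_eq f.2).le
    · rw [← h.cost_eq hTa, ← hbest]
      exact (key T' hT').2

/-- For `k = 0` the claimed time does not depend on the centers or on `ε`, so the program must stop
before it looks at them. Otherwise `Q` absorbs both dependences. -/
theorem algorithm_runs {ℓ L B Q : ℕ} (hI : I.IsCentered ℓ) (hsz : 2 ≤ I.size) (hε : 0 < ε)
    (hL : (I.size : ℝ) ≤ ε / 2 * (1 + ε / 2) ^ L) (hB : I.size + 1 ≤ B) (hLQ : L + 1 ≤ Q)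
    (hSQ : I.nS ≤ Q) (hQ : I.k ≠ 0 → (I.nS * (L + 1)) ^ min I.k I.nF ≤ Q) :
    Runs algorithm (I.input ε) (I.IsApproxOutput (1 + ε))
      (if I.k = 0 then 40 else Q * (5000 * B ^ 5)) := by
  have hB1 : 1 ≤ B := by omega
  have hQ1 : 1 ≤ Q := by omega
  have hB2 : B ≤ B ^ 5 := by nlinarith [Nat.pow_le_pow_right hB1 (show 1 ≤ 5 by norm_num)]
  have hQB : Q * B ≤ Q * B ^ 5 := Nat.mul_le_mul_left _ hB2
  have hQB1 : B ≤ Q * B := by nlinarith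
  refine (Runs.of_flat (T := 6) (Q := fun s' => s' = (I.input ε).putNat cNC 0 I.nC) rfl (by decide)
    (by simp [Prog.den, NExp.eval, CKM.input])).seq
    (T₂ := if I.k = 0 then 34 else Q * (4900 * B ^ 5)) ?_ ?_
  swap
  · split_ifs
    · norm_num
    · nlinarith
  rintro s₁ h₁ f₁
  refine Runs.ite (T' := if I.k = 0 then 25 else Q * (4800 * B ^ 5)) (fun hb => ?_) (fun hb => ?_) ?_
  rotate_left 2
  · simp only [Test.cost, NExp.cost]
    split_ifs
    · norm_num
    · nlinarith
  · simp only [Test.Holds, NExp.eval, h₁, State.putNat_nat_self, Function.update_self,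
      nonpos_iff_eq_zero] at hb
    refine Runs.of_flat rfl ?_ ?_
    · simp only [Prog.time, NExp.cost]
      split_ifs
      · norm_num
      · nlinarith
    -- Without clients the empty solution is feasible and costs 0.
    · have : IsEmpty (Fin I.nC) := by rw [hb]; infer_instance
      left
      refine ⟨⟨∅, isEmptyElim⟩, ⟨?_, fun f => ?_, isEmptyElim⟩, ⟨by simp, isEmptyElim, by simp⟩,
        fun T' _ => ?_⟩
      · simp [Prog.den, NExp.eval]
      · simp [Prog.den, NExp.eval, h₁, CKM.input]
      · simp [CKM.Sol.cost]
  · simp only [Test.Holds, NExp.eval, h₁, State.putNat_nat_self, Function.update_self,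
      nonpos_iff_eq_zero] at hb
    have hk3 : s₁.nat 0 3 = I.k := by simp [h₁, CKM.input]
    refine Runs.ite (T' := if I.k = 0 then 15 else Q * (4700 * B ^ 5)) (fun hk => ?_) (fun hk => ?_)
      ?_
    rotate_left 2
    · simp only [Test.cost, NExp.cost]
      split_ifs
      · norm_num
      · nlinarith
    · simp only [Test.Holds, NExp.eval, hk3, nonpos_iff_eq_zero] at hk
      -- There is a client but nothing may be opened; the flag still has its input value 0.
      refine Runs.of_flat rfl (by simp [hk, Prog.time]) ?_
      right
      refine ⟨?_, by simp [Prog.den, CKM.ReportsInfeasible, h₁, CKM.input]⟩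
      rintro ⟨T, hT1, hT2, -⟩
      rw [hk, nonpos_iff_eq_zero, Finset.card_eq_zero] at hT1
      have := hT2 ⟨0, Nat.pos_of_ne_zero hb⟩
      rw [hT1] at this
      simp at this
    · simp only [Test.Holds, NExp.eval, hk3, nonpos_iff_eq_zero] at hk
      rw [if_neg hk]
      have hS := hI.nS_pos hsz
      refine (setup_runs h₁ hB).seq (T₂ := Q * (4500 * B ^ 5)) ?_ (by nlinarith)
      intro s₂ h₂ f₂
      have hFB : I.nF + 1 ≤ B := by rw [CKM.size] at hB; omega
      have hCB : I.nC + 1 ≤ B := by rw [CKM.size] at hB; omega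
      refine (nearest_runs (B := B) h₂.nF h₂.nS hS hFB).seq (T₂ := Q * (4100 * B ^ 5)) ?_ ?_
      swap
      · have h3 : B * I.nS ≤ B * Q := Nat.mul_le_mul_left _ hSQ
        nlinarith
      intro s₃ h₃ f₃
      have hflag : s₃.nat aFlag 0 = 0 := by rw [f₃.nat aFlag rfl, h₂.flag]
      refine (search_runs (n := I.size) (L := L) (a := I.nS) (B := B) (Q := Q)
        (h₂.has.of_frame f₃ rfl) (Or.inl hflag) (h₂.nearest hI h₃) hε (by omega) ?_
        (Nat.pos_of_ne_zero hb) (by rw [f₃.real rEps rfl, h₂.eps])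
        (by rw [f₃.real rSize rfl, h₂.rsize]) hL (fun f hf => (h₃ f hf).1) hFB hCB ?_ hLQ
        (hQ hk)).mono ?_ ?_
      · change I.nC ≤ I.size
        rw [CKM.size]; omega
      · change min I.k I.nF + 1 ≤ B
        have := min_le_right I.k I.nF
        omega
      · rintro s₄ ⟨hV, hbt⟩ -
        exact h₂.isApproxOutput hV hbt
      · have : B * (Q * (4000 * B ^ 4)) = Q * (4000 * B ^ 5) := by ring
        nlinarith

end RealRAM

/-! ### The final time bound -/

theorem mainTheorem2 :
    ∃ (P : RealRAM.Prog) (A c : ℕ),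
      ∀ (I : CKM) (ℓ : ℕ) (ε : ℝ), I.IsCentered ℓ → 2 ≤ I.size → 0 < ε → ε ≤ 1 →
        ∃ (s : RealRAM.State) (t : ℕ),
          RealRAM.Exec P (I.input ε) s t ∧
          (t : ℝ) ≤ ((A : ℝ) * ((ℓ : ℝ) * (1 / ε) * Real.log ((I.size : ℝ) / ε))) ^ I.k
            * (I.size : ℝ) ^ c ∧
          I.IsApproxOutput (1 + ε) s := by
  -- The 10 comes from `exists_class_bound`. The exponent is 23 = 13 + 10, from `5000 ≤ 2 ^ 13 ≤ n ^
  -- 13` and `(n + 1) ^ 5 ≤ n ^ 10`.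
  refine ⟨RealRAM.algorithm, 10, 23, fun I ℓ ε hI hn h0 h1 => ?_⟩
  obtain ⟨L, hL, hL'⟩ := exists_class_bound hn h0 h1
  have hSℓ : I.nS ≤ ℓ := hI.1
  have hℓ : 1 ≤ ℓ := (hI.nS_pos hn).trans_le hSℓ
  have hbase : 1 ≤ ℓ * (L + 1) := Nat.mul_pos hℓ (Nat.succ_pos L)
  have hn' : (2 : ℝ) ≤ I.size := by exact_mod_cast hn
  have hx : ((ℓ * (L + 1) : ℕ) : ℝ) ≤
      ((10 : ℕ) : ℝ) * ((ℓ : ℝ) * (1 / ε) * Real.log ((I.size : ℝ) / ε)) := by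
    push_cast
    calc (ℓ : ℝ) * (L + 1) ≤ ℓ * (10 * (1 / ε * Real.log (I.size / ε))) :=
          mul_le_mul_of_nonneg_left hL' (Nat.cast_nonneg ℓ)
      _ = _ := by ring
  by_cases hk : I.k = 0
  -- Any sufficiently large `Q` serves, since the time is at most 40.
  · obtain ⟨s, t, he, ht, ho⟩ := RealRAM.algorithm_runs (ε := ε) (B := I.size + 1)
      (Q := L + 1 + I.nS) hI hn h0 hL le_rfl (by omega) (by omega) (fun h => absurd hk h)
    refine ⟨s, t, he, ?_, ho⟩
    rw [if_pos hk] at ht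
    rw [hk, pow_zero, one_mul]
    calc (t : ℝ) ≤ 40 := by exact_mod_cast ht
      _ ≤ 2 ^ 23 := by norm_num
      _ ≤ (I.size : ℝ) ^ 23 := pow_le_pow_left₀ (by norm_num) hn' _
  -- This is where `k ≥ 1` lets the power absorb the times linear in `L` and in the number of
  -- centers.
  · have hpow : ℓ * (L + 1) ≤ (ℓ * (L + 1)) ^ I.k := Nat.le_self_pow hk _
    obtain ⟨s, t, he, ht, ho⟩ := RealRAM.algorithm_runs (ε := ε) (B := I.size + 1)
      (Q := (ℓ * (L + 1)) ^ I.k) hI hn h0 hL le_rfl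
      (le_trans (by nlinarith) hpow) (le_trans (by nlinarith) hpow)
      (fun _ => (Nat.pow_le_pow_left (Nat.mul_le_mul_right _ hSℓ) _).trans
        (Nat.pow_le_pow_right hbase (min_le_left _ _)))
    refine ⟨s, t, he, ?_, ho⟩
    rw [if_neg hk] at ht
    have h5000 : 5000 * (I.size + 1) ^ 5 ≤ I.size ^ 23 := by
      calc 5000 * (I.size + 1) ^ 5 ≤ 2 ^ 13 * (I.size ^ 2) ^ 5 :=
            Nat.mul_le_mul (by norm_num) (Nat.pow_le_pow_left (by nlinarith) _)
        _ ≤ I.size ^ 13 * (I.size ^ 2) ^ 5 :=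
            Nat.mul_le_mul_right _ (Nat.pow_le_pow_left hn _)
        _ = I.size ^ 23 := by ring
    calc (t : ℝ) ≤ (((ℓ * (L + 1)) ^ I.k * I.size ^ 23 : ℕ) : ℝ) := by
          exact_mod_cast ht.trans (Nat.mul_le_mul_left _ h5000)
      _ = ((ℓ * (L + 1) : ℕ) : ℝ) ^ I.k * (I.size : ℝ) ^ 23 := by push_cast; ring
      _ ≤ _ := mul_le_mul_of_nonneg_right (pow_le_pow_left₀ (Nat.cast_nonneg _) hx _)
          (by positivity)
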